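/- Let $U\subset\mathbb R^3$ be open (a coordinate patch), with coordinates $x^1,x^2,x^3$ and $\partial_a=\partial/\partial x^a$. A torsion-free connection on $U$ is $\nabla_aX^c=\partial_aX^c+\Gamma_{ab}{}^cX^b$ with $\Gamma_{ab}{}^c=\Gamma_{ba}{}^c$ smooth. Two connections are projectively equivalent if they have the same unparametrised geodesics. A metric is a smooth non-degenerate symmetric tensor $g_{ab}$ of any signature. The connection $\nabla$ is metrisable on an open set $W$ if some metric on $W$ has Levi-Civita connection projectively equivalent to $\nabla$ on $W$; it is metrisable near $p$ if it is so on some open neighbourhood of $p$. Let $\epsilon_{abc}$ be a volume form on $U$ and $\epsilon^{abc}$ its dual, $\epsilon^{abc}\epsilon_{abc}=6$. If $\nabla\epsilon=0$, the Weyl tensor $V^{ab}{}_c$ is defined by $2\epsilon^{de(a}\nabla_d\nabla_eX^{b)}=V^{ab}{}_cX^c$, and $Q_{ab}{}^c=\epsilon_{pq(a}V^{pr}{}_{b)}V^{qc}{}_r$. The Weyl pencil at $x$ is $\{T_{ad}V^{a(b}{}_e\epsilon^{c)de}: T_{ab}=T_{ba}\}$. A pencil $\{sN+tH\}$ of symmetric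 matrices with $\det H\ne0$ is regular if $\det(sH^{-1}N+t\,\mathrm{Id})$ has three distinct zeros on $\mathbb{CP}_1$. Write $(S_a{}^{bc})_\circ=S_a{}^{bc}-\frac12\delta_a{}^{(b}S_d{}^{c)d}$. A normal form on an open set $W\subset U$ consists of smooth $\rho^{bc},\sigma^{bc},\xi_b$ such that at every point $\rho,\sigma$ is a basis of the Weyl pencil, $\sigma$ is invertible with inverse $\sigma_{bc}$, $\sigma_{bc}\rho^{bc}=0$, $\rho^{bc}\xi_b=0$ and $\xi\neq0$. With $\xi^a=\sigma^{ab}\xi_b$ put $$\phi=(\xi^d\xi_d\sigma_{bc}-5\xi_b\xi_c)\xi^a(\nabla_a\rho^{bc})_\circ,\qquad \psi=(\xi^d\xi_d\sigma_{bc}-5\xi_b\xi_c)\xi^a(\nabla_a\sigma^{bc})_\circ,$$ and, where $\phi\ne0$, $\hat\sigma=\sigma-(\psi/\phi)\rho$; where $\hat\sigma$ is invertible put $\hat\omega_a=\hat\sigma_{bc}(\nabla_a\hat\sigma^{bc})_\circ$. The structure is generic at $p$ if $Q=0$ near $p$, the Weyl pencil at $p$ contains a non-degenerate element and is regular, and some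 normal form near $p$ has $\phi(p)\neq0$. Then the metrisability problem is solved for generic three-dimensional projective structures by the following algorithm. (1) For every torsion-free connection and every volume form on $U$ there is a projectively equivalent torsion-free connection on $U$ preserving the volume form. (2) Let $\nabla$ be torsion-free on $U$ with $\nabla\epsilon=0$, and $p\in U$. (a) If $\nabla$ is metrisable near $p$, then $Q=0$ near $p$. (b) If $\nabla$ is metrisable near $p$ and $V(p)\ne0$, then the Weyl pencil at $p$ contains a non-degenerate element. (c) If $Q=0$ near $p$ and the Weyl pencil at $p$ contains a non-degenerate element and is regular, then the pencil at $p$ contains a non-zero degenerate $N$, and for each such $N$ there is a normal form on an open neighbourhood of $p$ with $\rho(p)=N$. (d) Given a normal form on an open neighbourhood of $p$ with $\phi(p)\neq0$ or $\psi(p)\ne0$, the connection is metrisable near $p$ if and only if $\phi(p)\ne0$, $\det\hat\sigma(p)\neq0$, and, on some neighbourhood of $p$, $d\hat\omega=0$ and $(\nabla_a\hat\sigma^{bc}-\frac25\hat\omega_a\hat\sigma^{bc})_\circ=0$. (e) Given a normal form on an open set $W\subset U$ such that at every point of $W$ one of $\phi,\psi$ is non-zero, the connection is metrisable on $W$ if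 and only if, on $W$, $\phi$ has no zero, $\hat\sigma$ is everywhere non-degenerate, $\hat\omega$ is exact, and $(\nabla_a\hat\sigma^{bc}-\frac25\hat\omega_a\hat\sigma^{bc})_\circ=0$. In particular, at a generic point the algorithm decides metrisability. (3) Genericity is an open condition on jets: there is an open set $O$ in the space of $2$-jets $(\Gamma,\partial\Gamma,\partial^2\Gamma)$ at a point such that, for all $U$, $\epsilon$, all torsion-free $\nabla$ on $U$ with $\nabla\epsilon=0$, and all $p\in U$ with $Q=0$ near $p$, the structure is generic at $p$ if and only if the $2$-jet of $\Gamma$ at $p$ lies in $O$. (4) The condition is non-empty, even among metrisable structures. On the non-empty open set $\{x\ne0,\ z\neq0,\ xy+z\ne0\}\subset\mathbb R^3$, let $\Gamma$ be symmetric in its lower indices with $$\Gamma_{11}{}^1=\tfrac{y+4xz+5x^2y}{(xy+z)(1+x^2)},\quad \Gamma_{12}{}^1=\tfrac{x}{xy+z},\quad \Gamma_{13}{}^1=\tfrac{xy+2z}{(xy+z)z},$$ $$\Gamma_{11}{}^2=-(xy+z)xz^2,\quad \Gamma_{11}{}^3=-(xy+z)(xy+2z)z,\quad \Gamma_{12}{}^2=\Gamma_{13}{}^3=\tfrac{2x}{1+x^2},$$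 all other components zero, up to the symmetry. This connection preserves the volume form with $\epsilon_{123}=(1+x^2)^4(xy+z)z$, is generic at every point of the set, and is metrisable on the set. -/

import Mathlib

open scoped ContDiff Topology BigOperators
open Set Filter

/-- Points of the coordinate space `ℝ³`. -/
abbrev Pt : Type := Fin 3 → ℝ

/-- Real `3 × 3` matrices. -/
abbrev Mat3 : Type := Matrix (Fin 3) (Fin 3) ℝ

/-- The coordinate derivative `∂f/∂xᵃ`. -/
noncomputable def pd (a : Fin 3) (f : Pt → ℝ) (x : Pt) : ℝ :=
  fderiv ℝ f x (Pi.single a 1)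

/-- The Kronecker delta. -/
def kron (a b : Fin 3) : ℝ := if a = b then 1 else 0

/-- The Levi-Civita permutation symbol on the indices `0, 1, 2`, with value `1` at `(0, 1, 2)`. -/
noncomputable def lcs (a b c : Fin 3) : ℝ :=
  (((b : ℕ) : ℝ) - ((a : ℕ) : ℝ)) * (((c : ℕ) : ℝ) - ((a : ℕ) : ℝ)) *
    (((c : ℕ) : ℝ) - ((b : ℕ) : ℝ)) / 2

/-! ### Connections, geodesics, metrics -/

/-- Christoffel symbols in coordinates: `Γ x a b c` is `Γ_{ab}{}^c(x)`, and the connection is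
`∇_a X^c = ∂_a X^c + Γ_{ab}{}^c X^b`. -/
abbrev Christoffel : Type := Pt → Fin 3 → Fin 3 → Fin 3 → ℝ

/-- `Γ` is a smooth torsion-free connection on `U`. -/
structure IsTorsionFreeOn (U : Set Pt) (Γ : Christoffel) : Prop where
  smooth : ∀ a b c, ContDiffOn ℝ ∞ (fun x => Γ x a b c) U
  symm : ∀ x ∈ U, ∀ a b c, Γ x a b c = Γ x b a c

/-- `vol` is a smooth nowhere zero function on `U`; it stands for the volume form
`ε_{abc} = vol · [abc]`, whose dual is `ε^{abc} = vol⁻¹ · [abc]`. -/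
structure IsVolumeOn (U : Set Pt) (vol : Pt → ℝ) : Prop where
  smooth : ContDiffOn ℝ ∞ vol U
  ne_zero : ∀ x ∈ U, vol x ≠ 0

/-- `∇_a ε_{bcd} = 0` on `U`. -/
def PreservesVolumeOn (U : Set Pt) (Γ : Christoffel) (vol : Pt → ℝ) : Prop :=
  ∀ x ∈ U, ∀ a, pd a vol x - (∑ b, Γ x a b b) * vol x = 0

/-- The regular curve `γ` on the set `I` of parameters is, up to reparametrisation, a geodesic of
`Γ`: its acceleration `∇_{γ'} γ'` is everywhere proportional to its velocity. -/
def IsUnparamGeodesic (Γ : Christoffel) (I : Set ℝ) (γ : ℝ → Pt) : Prop :=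
  ContDiffOn ℝ 2 γ I ∧ ∀ t ∈ I, deriv γ t ≠ 0 ∧ ∃ k : ℝ, ∀ c : Fin 3,
    deriv (deriv γ) t c + ∑ a, ∑ b, Γ (γ t) a b c * deriv γ t a * deriv γ t b = k * deriv γ t c

/-- The two connections have the same unparametrised geodesics in `W`. -/
def ProjEquivOn (W : Set Pt) (Γ Γ' : Christoffel) : Prop :=
  ∀ (s t : ℝ) (γ : ℝ → Pt), (∀ r ∈ Ioo s t, γ r ∈ W) →
    (IsUnparamGeodesic Γ (Ioo s t) γ ↔ IsUnparamGeodesic Γ' (Ioo s t) γ)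

/-- A smooth non-degenerate symmetric covariant 2-tensor on `W`, of any signature. -/
structure IsMetricOn (W : Set Pt) (g : Pt → Mat3) : Prop where
  smooth : ∀ a b, ContDiffOn ℝ ∞ (fun x => g x a b) W
  symm : ∀ x ∈ W, (g x).IsSymm
  nondeg : ∀ x ∈ W, (g x).det ≠ 0

/-- The Christoffel symbols of the Levi-Civita connection of `g`. -/
noncomputable def leviCivita (g : Pt → Mat3) : Christoffel := fun x a b c =>
  (1 / 2) * ∑ d, (g x)⁻¹ c d *
    (pd a (fun y => g y b d) x + pd b (fun y => g y a d) x - pd d (fun y => g y a b) x)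

/-- There is a metric on `W` whose geodesics are those of `Γ` as unparametrised curves. -/
def MetrisableOn (W : Set Pt) (Γ : Christoffel) : Prop :=
  ∃ g : Pt → Mat3, IsMetricOn W g ∧ ProjEquivOn W Γ (leviCivita g)

/-- `Γ` is metrisable on some open neighbourhood of `p`. -/
def MetrisableNear (Γ : Christoffel) (p : Pt) : Prop :=
  ∃ W : Set Pt, IsOpen W ∧ p ∈ W ∧ MetrisableOn W Γ

/-! ### The tensors `V` and `Q` -/

/-- Curvature: `curv Γ x a b c d` is `R_{ab}{}^c{}_d`, where
`(∇_a ∇_b - ∇_b ∇_a) X^c = R_{ab}{}^c{}_d X^d`. -/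
noncomputable def curv (Γ : Christoffel) (x : Pt) (a b c d : Fin 3) : ℝ :=
  pd a (fun y => Γ y b d c) x - pd b (fun y => Γ y a d c) x +
    ∑ e, (Γ x a e c * Γ x b d e - Γ x b e c * Γ x a d e)

/-- The Weyl tensor `V^{ab}{}_c`, determined by `2 ε^{de(a} ∇_d ∇_e X^{b)} = V^{ab}{}_c X^c`.
Since `ε^{dea}` is skew in `de`, one has `2 ε^{dea} ∇_d ∇_e X^b = ε^{dea} R_{de}{}^b{}_c X^c`. -/
noncomputable def weylV (Γ : Christoffel) (vol : Pt → ℝ) (x : Pt) (a b c : Fin 3) : ℝ :=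
  (1 / 2) * ∑ d, ∑ e, ((vol x)⁻¹ * lcs d e a * curv Γ x d e b c +
    (vol x)⁻¹ * lcs d e b * curv Γ x d e a c)

/-- `Q_{ab}{}^c = ε_{pq(a} V^{pr}{}_{b)} V^{qc}{}_r`. -/
noncomputable def tensorQ (Γ : Christoffel) (vol : Pt → ℝ) (x : Pt) (a b c : Fin 3) : ℝ :=
  (1 / 2) * ∑ p, ∑ q, ∑ r,
    (vol x * lcs p q a * weylV Γ vol x p r b * weylV Γ vol x q c r +
      vol x * lcs p q b * weylV Γ vol x p r a * weylV Γ vol x q c r)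

/-- `Q_{ab}{}^c = 0` at `x`. -/
def QVanishesAt (Γ : Christoffel) (vol : Pt → ℝ) (x : Pt) : Prop :=
  ∀ a b c, tensorQ Γ vol x a b c = 0

/-! ### The Weyl pencil and its normal form -/

/-- The symmetric tensor `T_{ad} V^{a(b}{}_e ε^{c)de}` at `x`. -/
noncomputable def pencilElt (Γ : Christoffel) (vol : Pt → ℝ) (x : Pt) (T : Mat3) : Mat3 :=
  Matrix.of fun b c => (1 / 2) * ∑ a, ∑ d, ∑ e,
    (T a d * weylV Γ vol x a b e * ((vol x)⁻¹ * lcs c d e) +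
      T a d * weylV Γ vol x a c e * ((vol x)⁻¹ * lcs b d e))

/-- The Weyl pencil at `x`: all `T_{ad} V^{a(b}{}_e ε^{c)de}` with `T` symmetric. -/
def weylPencil (Γ : Christoffel) (vol : Pt → ℝ) (x : Pt) : Set Mat3 :=
  {τ | ∃ T : Mat3, T.IsSymm ∧ τ = pencilElt Γ vol x T}

/-- The pencil contains a non-degenerate element. -/
def IsNonsingularPencil (P : Set Mat3) : Prop := ∃ H ∈ P, H.det ≠ 0

/-- The linear span `{s N + t H}` of two matrices. -/
def pencilOf (N H : Mat3) : Set Mat3 := {τ | ∃ s t : ℝ, τ = s • N + t • H}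

/-- The binary cubic `χ(s, t) = det (s H⁻¹ N + t Id)`, with complex arguments. -/
noncomputable def pencilCubic (N H : Mat3) (s t : ℂ) : ℂ :=
  (s • (H⁻¹ * N).map (algebraMap ℝ ℂ) + t • (1 : Matrix (Fin 3) (Fin 3) ℂ)).det

/-- The (non-singular) pencil is regular: the cubic `χ` has three distinct zeros on the complex
projective line. Since `χ(0, t) = t³`, every zero is of the form `[1 : t]`. -/
def IsRegularPencil (P : Set Mat3) : Prop :=
  ∃ N H : Mat3, H.det ≠ 0 ∧ P = pencilOf N H ∧ {t : ℂ | pencilCubic N H 1 t = 0}.ncard = 3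

/-- Smooth fields `ρ, σ, ξ` on `W` such that `ρ, σ` form a basis of the Weyl pencil at every point
and are in normal form: `σ` is invertible, `σ_{bc} ρ^{bc} = 0`, and `ρ^{bc} ξ_b = 0` with
`ξ` nowhere zero. -/
structure IsNormalFormOn (Γ : Christoffel) (vol : Pt → ℝ) (W : Set Pt)
    (ρ σ : Pt → Mat3) (ξ : Pt → Fin 3 → ℝ) : Prop where
  smooth_rho : ∀ b c, ContDiffOn ℝ ∞ (fun x => ρ x b c) W
  smooth_sigma : ∀ b c, ContDiffOn ℝ ∞ (fun x => σ x b c) W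
  smooth_xi : ∀ b, ContDiffOn ℝ ∞ (fun x => ξ x b) W
  pencil_eq : ∀ x ∈ W, weylPencil Γ vol x = pencilOf (ρ x) (σ x)
  linInd : ∀ x ∈ W, LinearIndependent ℝ ![ρ x, σ x]
  invertible : ∀ x ∈ W, (σ x).det ≠ 0
  trace_zero : ∀ x ∈ W, ∑ b, ∑ c, (σ x)⁻¹ b c * ρ x b c = 0
  kernel : ∀ x ∈ W, ∀ c, ∑ b, ρ x b c * ξ x b = 0
  xi_ne : ∀ x ∈ W, ξ x ≠ 0

/-! ### The functions `φ`, `ψ` and the tests -/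

/-- The covariant derivative `∇_a τ^{bc}`. -/
noncomputable def covD (Γ : Christoffel) (τ : Pt → Mat3) (x : Pt) (a b c : Fin 3) : ℝ :=
  pd a (fun y => τ y b c) x + ∑ d, Γ x a d b * τ x d c + ∑ d, Γ x a d c * τ x b d

/-- The trace-free part `(S_a{}^{bc})_∘ = S_a{}^{bc} - ½ δ_a{}^{(b} S_d{}^{c)d}`. -/
noncomputable def tracefree (S : Fin 3 → Fin 3 → Fin 3 → ℝ) (a b c : Fin 3) : ℝ :=
  S a b c - (1 / 4) * (kron a b * ∑ d, S d c d + kron a c * ∑ d, S d b d)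

/-- The vector `ξ^a = σ^{ab} ξ_b`. -/
noncomputable def raise (σ : Pt → Mat3) (ξ : Pt → Fin 3 → ℝ) (x : Pt) (a : Fin 3) : ℝ :=
  ∑ b, σ x a b * ξ x b

/-- `(ξ^d ξ_d σ_{bc} - 5 ξ_b ξ_c) ξ^a (∇_a τ^{bc})_∘`. -/
noncomputable def scaleTest (Γ : Christoffel) (σ : Pt → Mat3) (ξ : Pt → Fin 3 → ℝ)
    (τ : Pt → Mat3) (x : Pt) : ℝ :=
  ∑ a, ∑ b, ∑ c, ((∑ d, raise σ ξ x d * ξ x d) * (σ x)⁻¹ b c - 5 * ξ x b * ξ x c) *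
    raise σ ξ x a * tracefree (covD Γ τ x) a b c

/-- The function `φ` of a normal form. -/
noncomputable def phiFn (Γ : Christoffel) (ρ σ : Pt → Mat3) (ξ : Pt → Fin 3 → ℝ) : Pt → ℝ :=
  scaleTest Γ σ ξ ρ

/-- The function `ψ` of a normal form. -/
noncomputable def psiFn (Γ : Christoffel) (_ρ σ : Pt → Mat3) (ξ : Pt → Fin 3 → ℝ) : Pt → ℝ :=
  scaleTest Γ σ ξ σ

/-- The candidate `σ - (ψ/φ) ρ`, used where `φ` is non-zero. -/
noncomputable def candidate (Γ : Christoffel) (ρ σ : Pt → Mat3) (ξ : Pt → Fin 3 → ℝ) :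
    Pt → Mat3 := fun x =>
  σ x - (psiFn Γ ρ σ ξ x / phiFn Γ ρ σ ξ x) • ρ x

/-- The 1-form `ω_a = τ_{bc} (∇_a τ^{bc})_∘` of a non-degenerate `τ`. -/
noncomputable def omegaForm (Γ : Christoffel) (τ : Pt → Mat3) (x : Pt) (a : Fin 3) : ℝ :=
  ∑ b, ∑ c, (τ x)⁻¹ b c * tracefree (covD Γ τ x) a b c

/-- `(∇_a τ^{bc} - ⅖ ω_a τ^{bc})_∘ = 0` at `x`. -/
def ScaleEquationAt (Γ : Christoffel) (τ : Pt → Mat3) (x : Pt) : Prop :=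
  ∀ a b c, tracefree
    (fun a b c => covD Γ τ x a b c - (2 / 5) * omegaForm Γ τ x a * τ x b c) a b c = 0

/-- The 1-form `θ` is exact on `W`. -/
def ExactOn (W : Set Pt) (θ : Pt → Fin 3 → ℝ) : Prop :=
  ∃ u : Pt → ℝ, ContDiffOn ℝ ∞ u W ∧ ∀ x ∈ W, ∀ a, pd a u x = θ x a

/-- `dθ = 0` at `x`. -/
def ClosedAt (θ : Pt → Fin 3 → ℝ) (x : Pt) : Prop :=
  ∀ a b, pd a (fun y => θ y b) x = pd b (fun y => θ y a) x

/-- The outcome of the algorithm on an open set `W` is positive: `φ` has no zero (where `φ` vanishes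
and `ψ` does not, the answer is negative), the candidate is non-degenerate, its 1-form `ω` is exact,
and the candidate satisfies the scale equation. -/
def AlgorithmAcceptsOn (Γ : Christoffel) (ρ σ : Pt → Mat3) (ξ : Pt → Fin 3 → ℝ)
    (W : Set Pt) : Prop :=
  (∀ x ∈ W, phiFn Γ ρ σ ξ x ≠ 0) ∧ (∀ x ∈ W, (candidate Γ ρ σ ξ x).det ≠ 0) ∧
    ExactOn W (omegaForm Γ (candidate Γ ρ σ ξ)) ∧
    ∀ x ∈ W, ScaleEquationAt Γ (candidate Γ ρ σ ξ) x

/-- The outcome of the algorithm near a point `p` is positive: as before, exactness being tested by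
`dω = 0`, which is the same locally. -/
def AlgorithmAcceptsAt (Γ : Christoffel) (ρ σ : Pt → Mat3) (ξ : Pt → Fin 3 → ℝ)
    (p : Pt) : Prop :=
  phiFn Γ ρ σ ξ p ≠ 0 ∧ (candidate Γ ρ σ ξ p).det ≠ 0 ∧
    ∀ᶠ x in 𝓝 p, ClosedAt (omegaForm Γ (candidate Γ ρ σ ξ)) x ∧
      ScaleEquationAt Γ (candidate Γ ρ σ ξ) x

/-! ### Genericity and jets -/

/-- The structure is generic at `p`: `Q = 0` near `p`, the Weyl pencil at `p` is non-singular and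
regular, and the function `φ` of some normal form near `p` does not vanish at `p`. -/
def IsGenericAt (Γ : Christoffel) (vol : Pt → ℝ) (p : Pt) : Prop :=
  (∀ᶠ x in 𝓝 p, QVanishesAt Γ vol x) ∧
    IsNonsingularPencil (weylPencil Γ vol p) ∧ IsRegularPencil (weylPencil Γ vol p) ∧
    ∃ (W : Set Pt) (ρ σ : Pt → Mat3) (ξ : Pt → Fin 3 → ℝ),
      IsOpen W ∧ p ∈ W ∧ IsNormalFormOn Γ vol W ρ σ ξ ∧ phiFn Γ ρ σ ξ p ≠ 0

/-- The space of 2-jets of connections at a point, with its usual topology. -/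
abbrev Jet2 : Type :=
  (Fin 3 → Fin 3 → Fin 3 → ℝ) × (Fin 3 → Fin 3 → Fin 3 → Fin 3 → ℝ) ×
    (Fin 3 → Fin 3 → Fin 3 → Fin 3 → Fin 3 → ℝ)

/-- The 2-jet of `Γ` at `p`: values, first and second partial derivatives. -/
noncomputable def jet2 (Γ : Christoffel) (p : Pt) : Jet2 :=
  (fun a b c => Γ p a b c,
    fun d a b c => pd d (fun x => Γ x a b c) p,
    fun e d a b c => pd e (pd d (fun x => Γ x a b c)) p)

/-! ### The explicit connection, in coordinates `(x, y, z)` -/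

/-- The region where `x`, `z` and `xy + z` are non-zero. -/
def exDomain : Set Pt := {p | p 0 ≠ 0 ∧ p 2 ≠ 0 ∧ p 0 * p 1 + p 2 ≠ 0}

/-- The three matrices `Γ_{ab}{}^1`, `Γ_{ab}{}^2`, `Γ_{ab}{}^3` of the explicit connection. -/
noncomputable def exMatrices (x y z : ℝ) : Fin 3 → Mat3 :=
  ![!![(y + 4 * x * z + 5 * x ^ 2 * y) / ((x * y + z) * (1 + x ^ 2)), x / (x * y + z),
        (x * y + 2 * z) / ((x * y + z) * z);
      x / (x * y + z), 0, 0;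
      (x * y + 2 * z) / ((x * y + z) * z), 0, 0],
    !![-(x * y + z) * x * z ^ 2, 2 * x / (1 + x ^ 2), 0;
      2 * x / (1 + x ^ 2), 0, 0;
      0, 0, 0],
    !![-(x * y + z) * (x * y + 2 * z) * z, 0, 2 * x / (1 + x ^ 2);
      0, 0, 0;
      2 * x / (1 + x ^ 2), 0, 0]]

/-- The explicit connection. -/
noncomputable def exConn : Christoffel := fun p a b c => exMatrices (p 0) (p 1) (p 2) c a b

/-- The volume form `ε_{123} = (1 + x²)⁴ (xy + z) z` preserved by the explicit connection. -/
noncomputable def exVol : Pt → ℝ := fun p =>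
  (1 + p 0 ^ 2) ^ 4 * (p 0 * p 1 + p 2) * p 2

/-!
Two connections have the same unparametrised geodesics exactly when they differ by a tensor
`δ_a^c Υ_b + δ_b^c Υ_a` (`ProjEquivOn.eq_add`, which compares geodesics in all directions, and
`projEquivOn_of_eq_add`). Applied to a Levi-Civita connection this turns metrisability into a linear
problem: once a volume form is preserved, metrics with the geodesics of `Γ` correspond to the
non-degenerate symmetric solutions `η` of `(∇_a η^{bc})_∘ = 0`
(`SolvesMetrisability.metrisableOn`, `MetrisableOn.exists_solvesMetrisability`).

Commuting derivatives in this equation gives an algebraic condition `V^{(ab}{}_e η^{d)e} = 0`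
(`SolvesMetrisability.obstruction_eq_zero`). For a non-degenerate `η` it forces
`V^{ab}{}_c = 2 ε_{gpc} Φ^{g(a} η^{b)p}` for some symmetric `Φ` (`exists_eq_hook`), and such a `V` has
`Q = 0` and, when it is not zero, Weyl pencil spanned by `Φ` and `η`. So `Q` is an obstruction, and a
solution is always a section of the Weyl pencil, which is known from the connection
(`qOf_eq_zero_of_obstruction`, `pencilSet_eq_of_obstruction`). Conversely, if `Q = 0` then every
element of the pencil satisfies the algebraic condition (`obstruction_pencilMat`); hence the pencil is
two-dimensional near every point at which it is non-singular. If it is regular, a degenerate element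
is a simple root of a binary cubic and extends to a smooth degenerate section by the implicit function
theorem; a companion `σ` and the kernel `ξ` of the section are then given by polynomial formulae
(`exists_contDiffOn_degenerate`, `exists_isNormalFormOn`).

In a normal form a solution is `η = f ρ + k σ` with `k ≠ 0`. The functional defining `φ` and `ψ`
annihilates the trace-free parts of `α_a ρ^{bc}` and `α_a σ^{bc}` for all 1-forms `α`, so the
derivatives of `f` and `k` drop out and the equation for `η` implies the pointwise relation
`f φ + k ψ = 0` (`IsNormalFormOn.scaleTest_section`). Where `φ` and `ψ` are not both zero, this gives
`φ ≠ 0` and `η = k σ̂`. The equation for `k σ̂` says that the trace-free derivative of `σ̂` is that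
of `-(d log |k|) σ̂`, and contraction with the inverse of `σ̂` identifies this 1-form with `⅖ ω̂`. Thus
the scale equation holds and `ω̂` is exact, and conversely an integral of `ω̂` produces a solution
(`IsNormalFormOn.algorithmAcceptsOn`, `IsNormalFormOn.metrisableOn`). Near a point exact and closed
1-forms agree.

The same insensitivity to derivatives of the coefficients shows that `φ` at a point can be computed
from any section of the pencil with the right value there, in particular from one with constant `T`,
and so from the 2-jet of the connection (`IsNormalFormOn.phiFn_eq_testOf`). The conditions defining
genericity are then expressed by a simple root of a cubic and a non-vanishing continuous function of
the jet, and are therefore open (`isOpen_genericJets`).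

For the explicit connection, `η = (1 + x²)⁻² diag (q⁻², 1, 1)` with `q = (xy + z) z` solves the
metrisability equation, and a normal form with non-zero `φ` can be written down
(`solvesMetrisability_exSolution`, `isNormalFormOn_ex`, `phiFn_ex`).
-/

/-! ### Coordinate derivatives -/

theorem pd_congr {f g : Pt → ℝ} {x : Pt} (h : f =ᶠ[𝓝 x] g) (a : Fin 3) :
    pd a f x = pd a g x := by
  unfold pd; rw [h.fderiv_eq]

theorem pd_congr_of_eqOn {W : Set Pt} (hW : IsOpen W) {f g : Pt → ℝ} (h : ∀ y ∈ W, f y = g y)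
    {x : Pt} (hx : x ∈ W) (a : Fin 3) : pd a f x = pd a g x :=
  pd_congr (by filter_upwards [hW.mem_nhds hx] with y hy using h y hy) a

@[simp] theorem pd_const (a : Fin 3) (c : ℝ) (x : Pt) : pd a (fun _ => c) x = 0 := by
  simp [pd]

theorem pd_add {f g : Pt → ℝ} {x : Pt} (hf : DifferentiableAt ℝ f x)
    (hg : DifferentiableAt ℝ g x) (a : Fin 3) :
    pd a (fun y => f y + g y) x = pd a f x + pd a g x := by
  unfold pd; rw [fderiv_fun_add hf hg]; rfl

theorem pd_sub {f g : Pt → ℝ} {x : Pt} (hf : DifferentiableAt ℝ f x)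
    (hg : DifferentiableAt ℝ g x) (a : Fin 3) :
    pd a (fun y => f y - g y) x = pd a f x - pd a g x := by
  unfold pd; rw [fderiv_fun_sub hf hg]; rfl

theorem pd_mul {f g : Pt → ℝ} {x : Pt} (hf : DifferentiableAt ℝ f x)
    (hg : DifferentiableAt ℝ g x) (a : Fin 3) :
    pd a (fun y => f y * g y) x = pd a f x * g x + f x * pd a g x := by
  unfold pd; rw [fderiv_fun_mul hf hg]
  simp [mul_comm]; ring

theorem pd_const_mul {f : Pt → ℝ} {x : Pt} (hf : DifferentiableAt ℝ f x) (c : ℝ) (a : Fin 3) :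
    pd a (fun y => c * f y) x = c * pd a f x := by
  rw [pd_mul (differentiableAt_const c) hf]; simp

theorem pd_sum {ι : Type*} (s : Finset ι) {f : ι → Pt → ℝ} {x : Pt}
    (hf : ∀ i ∈ s, DifferentiableAt ℝ (f i) x) (a : Fin 3) :
    pd a (fun y => ∑ i ∈ s, f i y) x = ∑ i ∈ s, pd a (f i) x := by
  unfold pd; rw [fderiv_fun_sum hf]; simp

theorem pd_comp {f : Pt → ℝ} {x : Pt} {F : ℝ → ℝ} {F' : ℝ} (hF : HasDerivAt F F' (f x))
    (hf : DifferentiableAt ℝ f x) (a : Fin 3) :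
    pd a (fun y => F (f y)) x = F' * pd a f x := by
  have := (hF.comp_hasFDerivAt x hf.hasFDerivAt).fderiv
  unfold pd
  rw [show (fun y => F (f y)) = F ∘ f from rfl, this]; simp

theorem pd_div {f g : Pt → ℝ} {x : Pt} (hf : DifferentiableAt ℝ f x)
    (hg : DifferentiableAt ℝ g x) (h0 : g x ≠ 0) (a : Fin 3) :
    pd a (fun y => f y / g y) x = (pd a f x * g x - f x * pd a g x) / g x ^ 2 := by
  have hi : DifferentiableAt ℝ (fun y => (g y)⁻¹) x := hg.inv h0
  simp only [div_eq_mul_inv]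
  rw [pd_mul hf hi, pd_comp (hasDerivAt_inv h0) hg]
  field_simp
  ring

theorem pd_coord (a i : Fin 3) (x : Pt) : pd a (fun y => y i) x = kron a i := by
  unfold pd kron
  rw [(hasFDerivAt_apply i x).fderiv]
  simp [Pi.single_apply, eq_comm]

theorem ContDiffOn.pd_of_isOpen {U : Set Pt} (hU : IsOpen U) {f : Pt → ℝ} (hf : ContDiffOn ℝ ∞ f U)
    (a : Fin 3) : ContDiffOn ℝ ∞ (pd a f) U :=
  (hf.fderiv_of_isOpen hU (by simp)).clm_apply contDiffOn_const

theorem ContDiffOn.diffAt {U : Set Pt} (hU : IsOpen U) {f : Pt → ℝ} (hf : ContDiffOn ℝ ∞ f U)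
    {x : Pt} (hx : x ∈ U) : DifferentiableAt ℝ f x :=
  (hf.contDiffAt (hU.mem_nhds hx)).differentiableAt (by simp)

theorem pd_comm {U : Set Pt} (hU : IsOpen U) {f : Pt → ℝ} (hf : ContDiffOn ℝ ∞ f U)
    {x : Pt} (hx : x ∈ U) (a b : Fin 3) : pd a (pd b f) x = pd b (pd a f) x := by
  have h1 : ContDiffAt ℝ ∞ f x := hf.contDiffAt (hU.mem_nhds hx)
  have hd : DifferentiableAt ℝ (fderiv ℝ f) x :=
    (h1.fderiv_right (m := ∞) (by simp)).differentiableAt (by simp)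
  have key : ∀ a b, pd a (pd b f) x = fderiv ℝ (fderiv ℝ f) x (Pi.single a 1) (Pi.single b 1) := by
    intro a b
    have : pd b f = fun y => (fderiv ℝ f y) (Pi.single b 1) := rfl
    rw [this]
    unfold pd
    rw [fderiv_clm_apply hd (differentiableAt_const _)]
    simp
  rw [key, key]
  exact (h1.isSymmSndFDerivAt (by
    rw [minSmoothness_of_isRCLikeNormedField]
    exact WithTop.coe_le_coe.2 (le_top : (2 : ℕ∞) ≤ ⊤))) _ _

/-- A function whose coordinate derivatives are given is determined by them: the derivative in
coordinates. -/
theorem fderiv_apply_eq_sum_pd (f : Pt → ℝ) (x v : Pt) :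
    fderiv ℝ f x v = ∑ a, v a * pd a f x := by
  conv_lhs => rw [show v = ∑ a, v a • (Pi.single a (1 : ℝ) : Pt) by
    ext i; simp [Finset.sum_apply, Pi.single_apply]]
  simp [pd]

/-! ### Matrix-valued functions -/

/-- The matrix of the derivatives `∂_a τ^{bc}` at `x`. -/
noncomputable def dMat (a : Fin 3) (τ : Pt → Mat3) (x : Pt) : Mat3 :=
  Matrix.of fun b c => pd a (fun y => τ y b c) x

/-- The matrix of a Christoffel symbol with its first index fixed. -/
def cMat (Γ : Christoffel) (x : Pt) (a : Fin 3) : Mat3 := Matrix.of fun d b => Γ x a d b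

theorem covD_eq_matrix (Γ : Christoffel) (τ : Pt → Mat3) (x : Pt) (a b c : Fin 3) :
    covD Γ τ x a b c =
      (dMat a τ x + (cMat Γ x a).transpose * τ x + τ x * cMat Γ x a) b c := by
  simp [covD, dMat, cMat, Matrix.mul_apply, mul_comm]

section

variable {E : Type*} [NormedAddCommGroup E] [NormedSpace ℝ E]

/-- The entries of a matrix-valued function are smooth on a set. -/
def SmoothMat (W : Set E) (τ : E → Mat3) : Prop := ∀ b c, ContDiffOn ℝ ∞ (fun x => τ x b c) W

theorem SmoothMat.diffAt {W : Set Pt} (hW : IsOpen W) {τ : Pt → Mat3} (h : SmoothMat W τ)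
    {x : Pt} (hx : x ∈ W) (b c : Fin 3) : DifferentiableAt ℝ (fun y => τ y b c) x :=
  (h b c).diffAt hW hx

theorem SmoothMat.mono {W W' : Set E} {τ : E → Mat3} (h : SmoothMat W τ) (hs : W' ⊆ W) :
    SmoothMat W' τ := fun b c => (h b c).mono hs

theorem SmoothMat.det {W : Set E} {τ : E → Mat3} (h : SmoothMat W τ) :
    ContDiffOn ℝ ∞ (fun x => (τ x).det) W := by
  simp only [Matrix.det_fin_three]
  have h' : ∀ b c, ContDiffOn ℝ ∞ (fun x => τ x b c) W := h
  fun_prop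

theorem SmoothMat.adjugate {W : Set E} {τ : E → Mat3} (h : SmoothMat W τ) :
    SmoothMat W (fun x => (τ x).adjugate) := by
  have h' : ∀ b c, ContDiffOn ℝ ∞ (fun x => τ x b c) W := h
  intro b c
  simp only [Matrix.adjugate_fin_three]
  fin_cases b <;> fin_cases c <;> simp <;> fun_prop

theorem SmoothMat.inv {W : Set E} {τ : E → Mat3} (h : SmoothMat W τ)
    (h0 : ∀ x ∈ W, (τ x).det ≠ 0) : SmoothMat W (fun x => (τ x)⁻¹) := by
  intro b c
  simp only [Matrix.inv_def, Ring.inverse_eq_inv', Matrix.smul_apply, smul_eq_mul]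
  exact (h.det.inv h0).mul (h.adjugate b c)

theorem SmoothMat.smul {W : Set E} {τ : E → Mat3} {f : E → ℝ} (hf : ContDiffOn ℝ ∞ f W)
    (h : SmoothMat W τ) : SmoothMat W (fun x => f x • τ x) := by
  intro b c
  simp only [Matrix.smul_apply, smul_eq_mul]
  exact hf.mul (h b c)

theorem SmoothMat.add {W : Set E} {τ τ' : E → Mat3} (h : SmoothMat W τ) (h' : SmoothMat W τ') :
    SmoothMat W (fun x => τ x + τ' x) := by
  intro b c
  simp only [Matrix.add_apply]
  exact (h b c).add (h' b c)

theorem SmoothMat.sub {W : Set E} {τ τ' : E → Mat3} (h : SmoothMat W τ) (h' : SmoothMat W τ') :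
    SmoothMat W (fun x => τ x - τ' x) := by
  intro b c
  simp only [Matrix.sub_apply]
  exact (h b c).sub (h' b c)

theorem SmoothMat.trace_mul {W : Set E} {A B : E → Mat3} (hA : SmoothMat W A)
    (hB : SmoothMat W B) : ContDiffOn ℝ ∞ (fun x => (A x * B x).trace) W := by
  simp only [Matrix.trace, Matrix.diag, Matrix.mul_apply]
  exact ContDiffOn.sum fun b _ => ContDiffOn.sum fun c _ => (hA b c).mul (hB c b)

end

theorem dMat_smul {f : Pt → ℝ} {τ : Pt → Mat3} {x : Pt} (hf : DifferentiableAt ℝ f x)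
    (hτ : ∀ b c, DifferentiableAt ℝ (fun y => τ y b c) x) (a : Fin 3) :
    dMat a (fun y => f y • τ y) x = pd a f x • τ x + f x • dMat a τ x := by
  ext b c
  simp [dMat, pd_mul hf (hτ b c)]

theorem dMat_add {τ τ' : Pt → Mat3} {x : Pt}
    (hτ : ∀ b c, DifferentiableAt ℝ (fun y => τ y b c) x)
    (hτ' : ∀ b c, DifferentiableAt ℝ (fun y => τ' y b c) x) (a : Fin 3) :
    dMat a (fun y => τ y + τ' y) x = dMat a τ x + dMat a τ' x := by
  ext b c
  simp [dMat, pd_add (hτ b c) (hτ' b c)]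

theorem dMat_mul {τ τ' : Pt → Mat3} {x : Pt}
    (hτ : ∀ b c, DifferentiableAt ℝ (fun y => τ y b c) x)
    (hτ' : ∀ b c, DifferentiableAt ℝ (fun y => τ' y b c) x) (a : Fin 3) :
    dMat a (fun y => τ y * τ' y) x = dMat a τ x * τ' x + τ x * dMat a τ' x := by
  ext b c
  simp only [dMat, Matrix.mul_apply, Matrix.of_apply, Matrix.add_apply]
  rw [pd_sum (f := fun i y => τ y b i * τ' y i c) _ (fun i _ => (hτ b i).mul (hτ' i c)),
    ← Finset.sum_add_distrib]
  exact Finset.sum_congr rfl fun i _ => pd_mul (hτ b i) (hτ' i c) a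

theorem dMat_congr {W : Set Pt} (hW : IsOpen W) {τ τ' : Pt → Mat3} (h : ∀ y ∈ W, τ y = τ' y)
    {x : Pt} (hx : x ∈ W) (a : Fin 3) : dMat a τ x = dMat a τ' x := by
  ext b c
  exact pd_congr_of_eqOn hW (fun y hy => by rw [h y hy]) hx a

theorem dMat_inv {W : Set Pt} (hW : IsOpen W) {τ : Pt → Mat3} (h : SmoothMat W τ)
    (h0 : ∀ x ∈ W, (τ x).det ≠ 0) {x : Pt} (hx : x ∈ W) (a : Fin 3) :
    dMat a (fun y => (τ y)⁻¹) x = -((τ x)⁻¹ * dMat a τ x * (τ x)⁻¹) := by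
  have hu : IsUnit (τ x).det := (h0 x hx).isUnit
  have h1 : dMat a (fun y => (τ y)⁻¹ * τ y) x = 0 := by
    rw [dMat_congr hW (τ' := fun _ => 1)
      (fun y hy => Matrix.nonsing_inv_mul _ (h0 y hy).isUnit) hx]
    ext b c; simp [dMat]
  rw [dMat_mul ((h.inv h0).diffAt hW hx) (h.diffAt hW hx)] at h1
  have h2 : dMat a (fun y => (τ y)⁻¹) x * τ x = -((τ x)⁻¹ * dMat a τ x) :=
    eq_neg_of_add_eq_zero_left h1
  calc _ = dMat a (fun y => (τ y)⁻¹) x * τ x * (τ x)⁻¹ := by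
        rw [Matrix.mul_assoc, Matrix.mul_nonsing_inv _ hu, Matrix.mul_one]
    _ = _ := by rw [h2, Matrix.neg_mul]

theorem pd_det {τ : Pt → Mat3} {x : Pt} (h : ∀ b c, DifferentiableAt ℝ (fun y => τ y b c) x)
    (h0 : (τ x).det ≠ 0) (a : Fin 3) :
    pd a (fun y => (τ y).det) x = (τ x).det * ((τ x)⁻¹ * dMat a τ x).trace := by
  have h1 : (τ x).det * ((τ x)⁻¹ * dMat a τ x).trace = ((τ x).adjugate * dMat a τ x).trace := by
    rw [Matrix.inv_def, Ring.inverse_eq_inv', Matrix.smul_mul, Matrix.trace_smul, smul_eq_mul,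
      mul_inv_cancel_left₀ h0]
  rw [h1, Matrix.adjugate_fin_three]
  simp only [Matrix.det_fin_three, Matrix.trace, Matrix.diag, Matrix.mul_apply,
    Fin.sum_univ_three, dMat, Matrix.of_apply]
  have p : ∀ b c b' c', DifferentiableAt ℝ (fun y => τ y b c * τ y b' c') x :=
    fun b c b' c' => (h b c).mul (h b' c')
  have q : ∀ b c b' c' d e, DifferentiableAt ℝ (fun y => τ y b c * τ y b' c' * τ y d e) x :=
    fun b c b' c' d e => (p b c b' c').mul (h d e)
  have e : ∀ b c b' c' d e, pd a (fun y => τ y b c * τ y b' c' * τ y d e) x =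
      (pd a (fun y => τ y b c) x * τ x b' c' + τ x b c * pd a (fun y => τ y b' c') x) * τ x d e +
      τ x b c * τ x b' c' * pd a (fun y => τ y d e) x := fun b c b' c' d e => by
    rw [pd_mul (p b c b' c') (h d e), pd_mul (h b c) (h b' c')]
  rw [pd_sub (by fun_prop) (by fun_prop), pd_add (by fun_prop) (by fun_prop),
    pd_add (by fun_prop) (by fun_prop), pd_sub (by fun_prop) (by fun_prop),
    pd_sub (by fun_prop) (by fun_prop)]
  simp only [e, Matrix.cons_val', Matrix.cons_val_zero, Matrix.cons_val_one, Matrix.cons_val,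
    Matrix.cons_val_fin_one]
  ring

/-! ### Algebra of the Weyl tensor at a point -/

theorem lcs_values :
    (lcs 0 1 2 = 1 ∧ lcs 1 2 0 = 1 ∧ lcs 2 0 1 = 1 ∧ lcs 0 2 1 = -1 ∧ lcs 2 1 0 = -1 ∧
      lcs 1 0 2 = -1) ∧ (∀ a b, lcs a a b = 0) ∧ (∀ a b, lcs a b a = 0) ∧ ∀ a b, lcs b a a = 0 := by
  norm_num [lcs]

theorem lcs_012 : lcs 0 1 2 = 1 := lcs_values.1.1
theorem lcs_120 : lcs 1 2 0 = 1 := lcs_values.1.2.1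
theorem lcs_201 : lcs 2 0 1 = 1 := lcs_values.1.2.2.1
theorem lcs_021 : lcs 0 2 1 = -1 := lcs_values.1.2.2.2.1
theorem lcs_210 : lcs 2 1 0 = -1 := lcs_values.1.2.2.2.2.1
theorem lcs_102 : lcs 1 0 2 = -1 := lcs_values.1.2.2.2.2.2
theorem lcs_aab (a b : Fin 3) : lcs a a b = 0 := lcs_values.2.1 a b
theorem lcs_aba (a b : Fin 3) : lcs a b a = 0 := lcs_values.2.2.1 a b
theorem lcs_baa (a b : Fin 3) : lcs b a a = 0 := lcs_values.2.2.2 a b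

theorem kron_values : ((kron 0 0 = 1 ∧ kron 1 1 = 1 ∧ kron 2 2 = 1) ∧
    (kron 0 1 = 0 ∧ kron 0 2 = 0 ∧ kron 1 2 = 0)) ∧ kron 1 0 = 0 ∧ kron 2 0 = 0 ∧ kron 2 1 = 0 := by
  simp [kron]

theorem forall_fin_three {P : Fin 3 → Prop} : (∀ i, P i) ↔ P 0 ∧ P 1 ∧ P 2 := by
  constructor
  · exact fun h => ⟨h 0, h 1, h 2⟩
  · rintro ⟨h0, h1, h2⟩ i
    fin_cases i <;> assumption

/-- If a quadratic vector-valued form `D(v, v)` is everywhere proportional to `v`, then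
`D_{ab}{}^c = δ_a^c Υ_b + δ_b^c Υ_a` where `Υ` is a quarter of the trace. -/
theorem eq_kron_of_quadratic_parallel (D : Fin 3 → Fin 3 → Fin 3 → ℝ)
    (hs : ∀ a b c, D a b c = D b a c)
    (h : ∀ v : Fin 3 → ℝ, v ≠ 0 → ∃ k : ℝ, ∀ c, ∑ a, ∑ b, D a b c * v a * v b = k * v c)
    (a b c : Fin 3) :
    D a b c = kron a c * ((1 / 4) * ∑ d, D b d d) + kron b c * ((1 / 4) * ∑ d, D a d d) := by
  have key : ∀ v : Fin 3 → ℝ, v ≠ 0 → ∀ c d,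
      (∑ a, ∑ b, D a b c * v a * v b) * v d = (∑ a, ∑ b, D a b d * v a * v b) * v c := by
    intro v hv c d
    obtain ⟨k, hk⟩ := h v hv
    rw [hk, hk]; ring
  have ne : ∀ {x y z : ℝ}, (x ≠ 0 ∨ y ≠ 0 ∨ z ≠ 0) → (![x, y, z] : Fin 3 → ℝ) ≠ 0 := by
    intro x y z h0 e
    have e0 := congrFun e 0
    have e1 := congrFun e 1
    have e2 := congrFun e 2
    simp at e0 e1 e2
    simp_all
  have h1 := key ![1, 0, 0] (ne (by norm_num))
  have h2 := key ![0, 1, 0] (ne (by norm_num))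
  have h3 := key ![0, 0, 1] (ne (by norm_num))
  have h4 := key ![1, 1, 0] (ne (by norm_num))
  have h5 := key ![1, -1, 0] (ne (by norm_num))
  have h6 := key ![1, 0, 1] (ne (by norm_num))
  have h7 := key ![1, 0, -1] (ne (by norm_num))
  have h8 := key ![0, 1, 1] (ne (by norm_num))
  have h9 := key ![0, 1, -1] (ne (by norm_num))
  simp only [forall_fin_three, Fin.sum_univ_three, Matrix.cons_val_zero, Matrix.cons_val_one,
    Matrix.cons_val, mul_zero, mul_one, add_zero, zero_add, true_and, and_true, mul_neg, neg_neg]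
    at h1 h2 h3 h4 h5 h6 h7 h8 h9
  have s01 := hs 0 1
  have s02 := hs 0 2
  have s12 := hs 1 2
  simp only [forall_fin_three] at s01 s02 s12
  revert a b c
  simp only [forall_fin_three, Fin.sum_univ_three, kron_values, zero_mul, one_mul]
  refine ⟨⟨⟨?_, ?_, ?_⟩, ⟨?_, ?_, ?_⟩, ?_, ?_, ?_⟩, ⟨⟨?_, ?_, ?_⟩, ⟨?_, ?_, ?_⟩, ?_, ?_, ?_⟩,
    ⟨?_, ?_, ?_⟩, ⟨?_, ?_, ?_⟩, ?_, ?_, ?_⟩ <;> linarith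

/-- The tensor `ε^{de(a} R_{de}{}^{b)}{}_c` built from the components of a curvature tensor. -/
noncomputable def weylOf (R : Fin 3 → Fin 3 → Fin 3 → Fin 3 → ℝ) (a b c : Fin 3) : ℝ :=
  (1 / 2) * ∑ d, ∑ e, (lcs d e a * R d e b c + lcs d e b * R d e a c)

/-- The symmetric matrix `T_{ad} V^{a(b}{}_e ε^{c)de}` for the volume form `dx¹ ∧ dx² ∧ dx³`. -/
noncomputable def pencilMat (V : Fin 3 → Fin 3 → Fin 3 → ℝ) (T : Mat3) : Mat3 :=
  Matrix.of fun b c => (1 / 2) * ∑ a, ∑ d, ∑ e,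
    (T a d * V a b e * lcs c d e + T a d * V a c e * lcs b d e)

/-- The tensor `ε_{pq(a} V^{pr}{}_{b)} V^{qc}{}_r` for the volume form `dx¹ ∧ dx² ∧ dx³`. -/
noncomputable def qOf (V : Fin 3 → Fin 3 → Fin 3 → ℝ) (a b c : Fin 3) : ℝ :=
  (1 / 2) * ∑ p, ∑ q, ∑ r,
    (lcs p q a * V p r b * V q c r + lcs p q b * V p r a * V q c r)

/-- The symmetrisation `3 V^{(ab}{}_e H^{d)e}`, whose vanishing is the integrability condition on a
solution `H` of the metrisability equation. -/
def obstruction (V : Fin 3 → Fin 3 → Fin 3 → ℝ) (H : Mat3) (a b d : Fin 3) : ℝ :=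
  ∑ e, (V a b e * H e d + V b d e * H e a + V d a e * H e b)

/-- The tensor `2 ε_{gpc} Φ^{g(a} H^{b)p}` built from two symmetric matrices: the Weyl tensor of a
metric with inverse `H` has this form, `Φ` being its trace-free Ricci tensor up to scale. -/
noncomputable def hook (Φ H : Mat3) (a b c : Fin 3) : ℝ :=
  ∑ g, ∑ p, lcs g p c * (Φ a g * H p b + Φ b g * H p a)

/-- The contraction `T_{ab} H^{ab}`. -/
def contr (T H : Mat3) : ℝ := ∑ a, ∑ b, T a b * H a b

theorem isSymm_entries {H : Mat3} (h : H.IsSymm) : H 1 0 = H 0 1 ∧ H 2 0 = H 0 2 ∧ H 2 1 = H 1 2 :=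
  ⟨h.apply 0 1, h.apply 0 2, h.apply 1 2⟩

theorem pencilMat_hook {Φ H T : Mat3} (hΦ : Φ.IsSymm) (hH : H.IsSymm) (hT : T.IsSymm) :
    pencilMat (hook Φ H) T = contr T H • Φ - contr T Φ • H := by
  obtain ⟨a1, a2, a3⟩ := isSymm_entries hΦ
  obtain ⟨b1, b2, b3⟩ := isSymm_entries hH
  obtain ⟨c1, c2, c3⟩ := isSymm_entries hT
  ext b c
  revert b c
  simp only [forall_fin_three, pencilMat, hook, contr, Fin.sum_univ_three, Matrix.of_apply,
    Matrix.sub_apply, Matrix.smul_apply, smul_eq_mul, lcs_012, lcs_120, lcs_201, lcs_021, lcs_210,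
    lcs_102, lcs_aab, lcs_aba, lcs_baa, a1, a2, a3, b1, b2, b3, c1, c2, c3]
  refine ⟨⟨?_, ?_, ?_⟩, ⟨?_, ?_, ?_⟩, ?_, ?_, ?_⟩ <;> ring

theorem qOf_hook {Φ H : Mat3} (hΦ : Φ.IsSymm) (hH : H.IsSymm) (a b c : Fin 3) :
    qOf (hook Φ H) a b c = 0 := by
  obtain ⟨a1, a2, a3⟩ := isSymm_entries hΦ
  obtain ⟨b1, b2, b3⟩ := isSymm_entries hH
  -- `hook` is expanded only after the vanishing terms of the sums defining `qOf` are gone.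
  have hv : ∀ a b c, hook Φ H a b c = hook Φ H a b c := fun _ _ _ => rfl
  conv at hv =>
    intro a b c
    rhs
    simp only [hook, Fin.sum_univ_three]
  revert a b c
  simp only [qOf, forall_fin_three, Fin.sum_univ_three, lcs_012, lcs_120, lcs_201, lcs_021, lcs_210,
    lcs_102, lcs_aab, lcs_aba, lcs_baa, zero_mul, add_zero, zero_add, one_mul]
  simp only [hv, lcs_012, lcs_120, lcs_201, lcs_021, lcs_210,
    lcs_102, lcs_aab, lcs_aba, lcs_baa, a1, a2, a3, b1, b2, b3, zero_mul, add_zero, zero_add,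
    one_mul]
  refine ⟨⟨⟨?_, ?_, ?_⟩, ⟨?_, ?_, ?_⟩, ?_, ?_, ?_⟩, ⟨⟨?_, ?_, ?_⟩, ⟨?_, ?_, ?_⟩, ?_, ?_, ?_⟩,
    ⟨?_, ?_, ?_⟩, ⟨?_, ?_, ?_⟩, ?_, ?_, ?_⟩ <;> ring

/-- If `Q = 0`, every element of the Weyl pencil satisfies the algebraic integrability condition:
up to traces of `V`, the obstruction is a contraction of `Q`. -/
theorem obstruction_pencilMat {V : Fin 3 → Fin 3 → Fin 3 → ℝ} (hs : ∀ a b c, V a b c = V b a c)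
    (ht : ∀ a, ∑ b, V a b b = 0) (hQ : ∀ a b c, qOf V a b c = 0) {T : Mat3} (hT : T.IsSymm)
    (a b c : Fin 3) : obstruction V (pencilMat V T) a b c = 0 := by
  let X : Fin 3 → Fin 3 → Fin 3 → ℝ := fun a b c =>
    ∑ e, ∑ f, ∑ g, ∑ h, T e f * lcs c f g * lcs e b h * qOf V h g a
  have hX : ∀ a b c, X a b c = 0 := by
    intro a b c
    simp only [X, hQ, mul_zero, Finset.sum_const_zero]
  have h10 := hs 1 0
  have h20 := hs 2 0
  have h21 := hs 2 1
  have t0 : V 0 0 0 = -V 0 1 1 - V 0 2 2 := by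
    have := ht 0; rw [Fin.sum_univ_three] at this; linarith
  have t1 : V 1 1 1 = -V 0 1 0 - V 1 2 2 := by
    have := ht 1; rw [Fin.sum_univ_three, h10] at this; linarith
  have t2 : V 2 2 2 = -V 0 2 0 - V 1 2 1 := by
    have := ht 2; rw [Fin.sum_univ_three, h20, h21] at this; linarith
  obtain ⟨c1, c2, c3⟩ := isSymm_entries hT
  have key : obstruction V (pencilMat V T) a b c =
      (1 / 4) * (X a b c + X a c b + X b a c + X b c a + X c a b + X c b a) := by
    revert a b c
    simp only [X, qOf, obstruction, pencilMat, Matrix.of_apply, forall_fin_three,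
      Fin.sum_univ_three, lcs_012, lcs_120, lcs_201, lcs_021, lcs_210,
      lcs_102, lcs_aab, lcs_aba, lcs_baa, zero_mul, mul_zero, add_zero, zero_add, one_mul, mul_one,
      h10, h20, h21, c1, c2, c3, t0, t1, t2]
    refine ⟨⟨⟨?_, ?_, ?_⟩, ⟨?_, ?_, ?_⟩, ?_, ?_, ?_⟩, ⟨⟨?_, ?_, ?_⟩, ⟨?_, ?_, ?_⟩, ?_, ?_, ?_⟩,
      ⟨?_, ?_, ?_⟩, ⟨?_, ?_, ?_⟩, ?_, ?_, ?_⟩ <;> ring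
  rw [key]
  simp only [hX]
  norm_num

theorem cofactor_contraction {G H : Mat3} (hG : G.IsSymm) (hGH : G * H = 1) (g a c : Fin 3) :
    ∑ f, ∑ d, lcs f a d * G g f * G d c = G.det * ∑ p, lcs g p c * H p a := by
  obtain ⟨a1, a2, a3⟩ := isSymm_entries hG
  -- The volume form with all indices lowered by `G`.
  have h1 : ∀ g c k, ∑ f, ∑ e, ∑ d, lcs f e d * G g f * G k e * G d c = G.det * lcs g k c := by
    simp only [forall_fin_three, Fin.sum_univ_three, Matrix.det_fin_three, lcs_012, lcs_120,
      lcs_201, lcs_021, lcs_210, lcs_102, lcs_aab, lcs_aba, lcs_baa, a1, a2, a3, zero_mul, mul_zero,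
      add_zero, zero_add, one_mul]
    refine ⟨⟨⟨?_, ?_, ?_⟩, ⟨?_, ?_, ?_⟩, ?_, ?_, ?_⟩, ⟨⟨?_, ?_, ?_⟩, ⟨?_, ?_, ?_⟩, ?_, ?_, ?_⟩,
      ⟨?_, ?_, ?_⟩, ⟨?_, ?_, ?_⟩, ?_, ?_, ?_⟩ <;> ring
  have h2 : ∀ e, ∑ k, G k e * H k a = kron e a := by
    intro e
    have := congrFun (congrFun hGH e) a
    simp only [Matrix.mul_apply, Matrix.one_apply] at this
    rw [kron, ← this]
    exact Finset.sum_congr rfl fun k _ => by rw [hG.apply e k]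
  have h3 : ∑ k, (∑ f, ∑ e, ∑ d, lcs f e d * G g f * G k e * G d c) * H k a =
      ∑ f, ∑ e, ∑ d, lcs f e d * G g f * G d c * ∑ k, G k e * H k a := by
    simp only [Fin.sum_univ_three]; ring
  rw [Finset.mul_sum]
  simp only [h1, h2] at h3
  simp only [← mul_assoc]
  rw [h3]
  clear h2 h3
  revert a
  simp only [forall_fin_three, Fin.sum_univ_three, kron_values, mul_zero, mul_one, add_zero,
    zero_add, and_self]

theorem hook_self {H : Mat3} (hH : H.IsSymm) (a b c : Fin 3) : hook H H a b c = 0 := by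
  obtain ⟨a1, a2, a3⟩ := isSymm_entries hH
  revert a b c
  simp only [hook, forall_fin_three, Fin.sum_univ_three, lcs_012, lcs_120, lcs_201, lcs_021,
    lcs_210, lcs_102, lcs_aab, lcs_aba, lcs_baa, zero_mul, add_zero, zero_add, one_mul, a1, a2, a3]
  refine ⟨⟨⟨?_, ?_, ?_⟩, ⟨?_, ?_, ?_⟩, ?_, ?_, ?_⟩, ⟨⟨?_, ?_, ?_⟩, ⟨?_, ?_, ?_⟩, ?_, ?_, ?_⟩,
    ⟨?_, ?_, ?_⟩, ⟨?_, ?_, ?_⟩, ?_, ?_, ?_⟩ <;> ring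

theorem hook_smul (r : ℝ) (Φ H : Mat3) (a b c : Fin 3) :
    hook (r • Φ) H a b c = r * hook Φ H a b c := by
  simp only [hook, Fin.sum_univ_three, Matrix.smul_apply, smul_eq_mul]; ring

/-- A trace-free `V^{ab}{}_c` annihilated by the obstruction map of a non-degenerate `H` has the
shape `2 ε_{gpc} Φ^{g(a} H^{b)p}` of the Weyl tensor of a metric. Raising the last index with `H`
gives a tensor of hook symmetry, thus of the form `2 U^{(b}{}_f ε^{a)fd}`, and the vanishing trace
makes `U H` symmetric. -/
theorem exists_eq_hook {V : Fin 3 → Fin 3 → Fin 3 → ℝ} (hs : ∀ a b c, V a b c = V b a c)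
    (ht : ∀ a, ∑ b, V a b b = 0) {H : Mat3} (hH : H.IsSymm) (hdet : H.det ≠ 0)
    (hO : ∀ a b c, obstruction V H a b c = 0) :
    ∃ Φ : Mat3, Φ.IsSymm ∧ ∀ a b c, V a b c = hook Φ H a b c := by
  set G : Mat3 := H⁻¹ with hGdef
  have hGH : G * H = 1 := Matrix.nonsing_inv_mul _ hdet.isUnit
  have hHG : H * G = 1 := Matrix.mul_nonsing_inv _ hdet.isUnit
  have hG : G.IsSymm := by
    rw [Matrix.IsSymm, hGdef, Matrix.transpose_nonsing_inv, hH.eq]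
  obtain ⟨W, hW⟩ : ∃ W : Fin 3 → Fin 3 → Fin 3 → ℝ, ∀ a b d, W a b d = ∑ e, V a b e * H e d :=
    ⟨_, fun _ _ _ => rfl⟩
  have hWs : ∀ a b d, W a b d = W b a d := fun a b d => by
    rw [hW, hW]; exact Finset.sum_congr rfl fun e _ => by rw [hs]
  have hWc : ∀ a b d, W a b d + W b d a + W d a b = 0 := fun a b d => by
    rw [hW, hW, hW, ← Finset.sum_add_distrib, ← Finset.sum_add_distrib]
    exact hO a b d
  have hVW : ∀ a b c, V a b c = ∑ d, W a b d * G d c := by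
    intro a b c
    have h1 : ∀ e, ∑ d, H e d * G d c = kron e c := fun e => by
      have := congrFun (congrFun hHG e) c
      simpa only [Matrix.mul_apply, Matrix.one_apply, kron] using this
    have h2 : ∑ d, W a b d * G d c = ∑ e, V a b e * ∑ d, H e d * G d c := by
      simp only [hW, Fin.sum_univ_three]; ring
    simp only [h2, h1, kron, mul_ite, mul_one, mul_zero, Finset.sum_ite_eq', Finset.mem_univ,
      if_true]
  obtain ⟨U, hU⟩ : ∃ U : Mat3, ∀ b f, U b f = (1 / 3) * ∑ a, ∑ d, lcs f a d * W a b d :=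
    ⟨Matrix.of fun b f => (1 / 3) * ∑ a, ∑ d, lcs f a d * W a b d, fun _ _ => rfl⟩
  have hWU : ∀ a b d, W a b d = ∑ f, (U b f * lcs f a d + U a f * lcs f b d) := by
    have s01 := hWs 0 1
    have s02 := hWs 0 2
    have s12 := hWs 1 2
    simp only [forall_fin_three] at hWc s01 s02 s12
    simp only [hU, forall_fin_three, Fin.sum_univ_three, lcs_012, lcs_120, lcs_201, lcs_021,
      lcs_210, lcs_102, lcs_aab, lcs_aba, lcs_baa, zero_mul, mul_zero, add_zero, zero_add, one_mul,
      mul_one]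
    refine ⟨⟨⟨?_, ?_, ?_⟩, ⟨?_, ?_, ?_⟩, ?_, ?_, ?_⟩, ⟨⟨?_, ?_, ?_⟩, ⟨?_, ?_, ?_⟩, ?_, ?_, ?_⟩,
      ⟨?_, ?_, ?_⟩, ⟨?_, ?_, ?_⟩, ?_, ?_, ?_⟩ <;> linarith
  -- `V^{ab}_b = 0` says that `Uᵀ G` is symmetric.
  have hX : (U.transpose * G).IsSymm := by
    obtain ⟨g1, g2, g3⟩ := isSymm_entries hG
    have ht' : ∀ a, ∑ b, ∑ d, (∑ f, (U b f * lcs f a d + U a f * lcs f b d)) * G d b = 0 := by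
      intro a
      rw [← ht a]
      exact Finset.sum_congr rfl fun b _ => by simp only [hVW a b b, hWU a b]
    simp only [forall_fin_three, Fin.sum_univ_three, lcs_012, lcs_120, lcs_201, lcs_021,
      lcs_210, lcs_102, lcs_aab, lcs_aba, lcs_baa, zero_mul, mul_zero, add_zero, zero_add,
      mul_one, g1, g2, g3] at ht'
    obtain ⟨e0, e1, e2⟩ := ht'
    apply Matrix.IsSymm.ext
    simp only [forall_fin_three, Matrix.mul_apply, Matrix.transpose_apply, Fin.sum_univ_three,
      g1, g2, g3]
    refine ⟨⟨?_, ?_, ?_⟩, ⟨?_, ?_, ?_⟩, ?_, ?_, ?_⟩ <;> first | trivial | linarith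
  have hUG : U.transpose * G = G * U := by
    rw [← hX.eq, Matrix.transpose_mul, Matrix.transpose_transpose, hG.eq]
  have hΦs : (U * H).IsSymm := by
    rw [Matrix.IsSymm, Matrix.transpose_mul, hH.eq]
    calc H * U.transpose = H * (U.transpose * G) * H := by
          rw [Matrix.mul_assoc, Matrix.mul_assoc, hGH, Matrix.mul_one]
      _ = U * H := by rw [hUG, ← Matrix.mul_assoc, hHG, Matrix.one_mul]
  have hUΦ : ∀ b f, U b f = ∑ g, (U * H) b g * G g f := fun b f => by
    rw [← Matrix.mul_apply, Matrix.mul_assoc, hHG, Matrix.mul_one]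
  refine ⟨G.det • (U * H), hΦs.smul _, fun a b c => ?_⟩
  have h1 : V a b c = ∑ g, ((U * H) b g * (∑ f, ∑ d, lcs f a d * G g f * G d c) +
      (U * H) a g * (∑ f, ∑ d, lcs f b d * G g f * G d c)) := by
    rw [hVW]
    simp only [hWU]
    rw [show (fun d => (∑ f, (U b f * lcs f a d + U a f * lcs f b d)) * G d c) = fun d =>
      (∑ f, ((∑ g, (U * H) b g * G g f) * lcs f a d + (∑ g, (U * H) a g * G g f) * lcs f b d))
        * G d c by funext d; simp only [← hUΦ]]
    simp only [Fin.sum_univ_three]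
    ring
  rw [h1, hook_smul]
  simp only [cofactor_contraction hG hGH]
  simp only [hook, Fin.sum_univ_three]
  ring

/-! ### Pencils of symmetric matrices -/

/-- All `T_{ad} V^{a(b}{}_e ε^{c)de}` with `T` symmetric. -/
def pencilSet (V : Fin 3 → Fin 3 → Fin 3 → ℝ) : Set Mat3 :=
  {τ | ∃ T : Mat3, T.IsSymm ∧ τ = pencilMat V T}

theorem linearIndependent_pair_iff' {A B : Mat3} : LinearIndependent ℝ ![A, B] ↔
    ∀ s t : ℝ, s • A + t • B = 0 → s = 0 ∧ t = 0 := LinearIndependent.pair_iff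

theorem contr_self_eq_zero {A : Mat3} (h : contr A A = 0) : A = 0 := by
  have h2 : ∀ a ∈ Finset.univ, (∑ b, A a b * A a b) = 0 :=
    (Finset.sum_eq_zero_iff_of_nonneg fun a _ =>
      Finset.sum_nonneg fun b _ => mul_self_nonneg _).1 h
  ext a b
  have h3 := (Finset.sum_eq_zero_iff_of_nonneg fun b _ => mul_self_nonneg (A a b)).1
    (h2 a (Finset.mem_univ _)) b (Finset.mem_univ _)
  simpa using h3

theorem exists_contr_eq {Φ H : Mat3} (hΦ : Φ.IsSymm) (hH : H.IsSymm)
    (hi : LinearIndependent ℝ ![Φ, H]) (s t : ℝ) :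
    ∃ T : Mat3, T.IsSymm ∧ contr T H = s ∧ contr T Φ = t := by
  have hlin : ∀ (x y : ℝ) (A B C : Mat3),
      contr (x • A + y • B) C = x * contr A C + y * contr B C := by
    intro x y A B C
    simp only [contr, Fin.sum_univ_three, Matrix.add_apply, Matrix.smul_apply, smul_eq_mul]; ring
  have hcomm : ∀ A B : Mat3, contr A B = contr B A := by
    intro A B; simp only [contr, mul_comm]
  rw [linearIndependent_pair_iff'] at hi
  -- The Gram determinant of two independent matrices does not vanish.
  have hgram : contr Φ Φ * contr H H - contr Φ H * contr Φ H ≠ 0 := by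
    intro h0
    have h1 : contr Φ Φ • H - contr Φ H • Φ = 0 := by
      apply contr_self_eq_zero
      rw [sub_eq_add_neg, ← neg_smul, hlin, hcomm H, hcomm Φ (_ + _), hlin, hlin, hcomm H Φ]
      linear_combination contr Φ Φ * h0
    have h2 := (hi (-contr Φ H) (contr Φ Φ) (by rw [neg_smul, neg_add_eq_sub, h1])).2
    have h3 := (hi 1 0 (by rw [contr_self_eq_zero h2]; simp)).1
    exact one_ne_zero h3
  refine ⟨((s * (-contr Φ H) + t * contr H H) /
      (contr Φ Φ * contr H H - contr Φ H * contr Φ H)) • Φ +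
    ((s * contr Φ Φ - t * contr Φ H) /
      (contr Φ Φ * contr H H - contr Φ H * contr Φ H)) • H, ?_, ?_, ?_⟩
  · exact (hΦ.smul _).add (hH.smul _)
  · rw [hlin, div_mul_eq_mul_div, div_mul_eq_mul_div, ← add_div, div_eq_iff hgram]; ring
  · rw [hlin, hcomm H Φ, div_mul_eq_mul_div, div_mul_eq_mul_div, ← add_div, div_eq_iff hgram]
    ring

theorem pencilSet_hook {Φ H : Mat3} (hΦ : Φ.IsSymm) (hH : H.IsSymm)
    (hi : LinearIndependent ℝ ![Φ, H]) : pencilSet (hook Φ H) = pencilOf Φ H := by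
  ext τ
  constructor
  · rintro ⟨T, hT, rfl⟩
    exact ⟨contr T H, -contr T Φ, by rw [pencilMat_hook hΦ hH hT, neg_smul, sub_eq_add_neg]⟩
  · rintro ⟨s, t, rfl⟩
    obtain ⟨T, hT, h1, h2⟩ := exists_contr_eq hΦ hH hi s (-t)
    exact ⟨T, hT, by rw [pencilMat_hook hΦ hH hT, h1, h2, neg_smul, sub_neg_eq_add]⟩

/-- A non-degenerate symmetric matrix satisfying the algebraic integrability condition for a
non-zero `V` belongs to the pencil, which it spans together with another symmetric matrix. -/
theorem pencilSet_eq_of_obstruction {V : Fin 3 → Fin 3 → Fin 3 → ℝ}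
    (hs : ∀ a b c, V a b c = V b a c) (ht : ∀ a, ∑ b, V a b b = 0) {H : Mat3} (hH : H.IsSymm)
    (hdet : H.det ≠ 0) (hO : ∀ a b c, obstruction V H a b c = 0) (hV : ∃ a b c, V a b c ≠ 0) :
    ∃ Φ : Mat3, Φ.IsSymm ∧ LinearIndependent ℝ ![Φ, H] ∧ pencilSet V = pencilOf Φ H := by
  obtain ⟨Φ, hΦ, hV'⟩ := exists_eq_hook hs ht hH hdet hO
  have hVe : V = hook Φ H := by funext a b c; exact hV' a b c
  have hi : LinearIndependent ℝ ![Φ, H] := by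
    rw [linearIndependent_pair_iff']
    intro s t hst
    have hs0 : s = 0 := by
      by_contra hs0
      have : Φ = (-(t / s)) • H := by
        have h1 : s • Φ = -(t • H) := eq_neg_of_add_eq_zero_left hst
        rw [neg_smul, div_eq_inv_mul, mul_smul, ← smul_neg, ← h1, smul_smul,
          inv_mul_cancel₀ hs0, one_smul]
      obtain ⟨a, b, c, hne⟩ := hV
      apply hne
      rw [hV', this, hook_smul, hook_self hH, mul_zero]
    subst hs0
    refine ⟨rfl, ?_⟩
    by_contra ht0
    rw [zero_smul, zero_add, smul_eq_zero] at hst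
    rcases hst with h | h
    · exact ht0 h
    · apply hdet; rw [h, Matrix.det_zero]
  exact ⟨Φ, hΦ, hi, by rw [hVe, pencilSet_hook hΦ hH hi]⟩

theorem qOf_eq_zero_of_obstruction {V : Fin 3 → Fin 3 → Fin 3 → ℝ}
    (hs : ∀ a b c, V a b c = V b a c) (ht : ∀ a, ∑ b, V a b b = 0) {H : Mat3} (hH : H.IsSymm)
    (hdet : H.det ≠ 0) (hO : ∀ a b c, obstruction V H a b c = 0) (a b c : Fin 3) :
    qOf V a b c = 0 := by
  obtain ⟨Φ, hΦ, hV'⟩ := exists_eq_hook hs ht hH hdet hO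
  rw [show V = hook Φ H by funext a b c; exact hV' a b c, qOf_hook hΦ hH]

theorem det_combination {R : Type*} [CommRing R] (H K : Matrix (Fin 3) (Fin 3) R) (c s : R) :
    (c • H + s • K).det = c ^ 3 * H.det + c ^ 2 * s * (H.adjugate * K).trace +
      c * s ^ 2 * (K.adjugate * H).trace + s ^ 3 * K.det := by
  simp only [Matrix.det_fin_three, Matrix.adjugate_fin_three, Matrix.trace, Matrix.diag,
    Matrix.mul_apply, Fin.sum_univ_three, Matrix.add_apply, Matrix.smul_apply, smul_eq_mul,
    Matrix.of_apply, Matrix.cons_val', Matrix.cons_val_zero, Matrix.cons_val_one, Matrix.cons_val,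
    Matrix.cons_val_fin_one]
  ring

theorem trace_adjugate_combination (H K : Mat3) (c s : ℝ) :
    ((c • H + s • K).adjugate * K).trace = c ^ 2 * (H.adjugate * K).trace +
      2 * c * s * (K.adjugate * H).trace + 3 * s ^ 2 * K.det := by
  simp only [Matrix.det_fin_three, Matrix.adjugate_fin_three, Matrix.trace, Matrix.diag,
    Matrix.mul_apply, Fin.sum_univ_three, Matrix.add_apply, Matrix.smul_apply, smul_eq_mul,
    Matrix.of_apply, Matrix.cons_val', Matrix.cons_val_zero, Matrix.cons_val_one, Matrix.cons_val,
    Matrix.cons_val_fin_one]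
  ring

/-! ### The binary cubic of a pencil -/

theorem det_mul_pencilCubic {N H : Mat3} (hH : H.det ≠ 0) (t : ℂ) :
    (H.det : ℂ) * pencilCubic N H 1 t = N.det + t * (N.adjugate * H).trace +
      t ^ 2 * (H.adjugate * N).trace + t ^ 3 * H.det := by
  have hHN : H.map (algebraMap ℝ ℂ) * (H⁻¹ * N).map (algebraMap ℝ ℂ) = N.map (algebraMap ℝ ℂ) := by
    rw [← Matrix.map_mul, ← Matrix.mul_assoc, Matrix.mul_nonsing_inv _ hH.isUnit, Matrix.one_mul]
  have hd : ∀ A : Mat3, ((A.det : ℝ) : ℂ) = (A.map (algebraMap ℝ ℂ)).det := fun A =>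
    RingHom.map_det (algebraMap ℝ ℂ) A
  have ht : ∀ A B : Mat3, (((A.adjugate * B).trace : ℝ) : ℂ) =
      ((A.map (algebraMap ℝ ℂ)).adjugate * B.map (algebraMap ℝ ℂ)).trace := by
    intro A B
    have h1 : (A.map (algebraMap ℝ ℂ)).adjugate = A.adjugate.map (algebraMap ℝ ℂ) :=
      (RingHom.map_adjugate (algebraMap ℝ ℂ) A).symm
    rw [h1, ← Matrix.map_mul]
    exact (AddMonoidHom.map_trace (algebraMap ℝ ℂ : ℝ →+ ℂ) (A.adjugate * B))
  rw [hd, hd, ht, ht, pencilCubic, ← Matrix.det_mul, Matrix.mul_add, one_smul, hHN,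
    Matrix.mul_smul, Matrix.mul_one]
  have := det_combination (N.map (algebraMap ℝ ℂ)) (H.map (algebraMap ℝ ℂ)) 1 t
  rw [one_smul] at this
  rw [this]
  ring

/-- If `ρ` is degenerate and `H` is not, `det (s ρ + t H) = t (β s² + α s t + d t²)`; regularity of
the pencil means that this binary cubic has no multiple factor. -/
theorem isRegularPencil_of_coefficients {ρ H : Mat3} (hH : H.det ≠ 0) (hρ : ρ.det = 0)
    (hβ : (ρ.adjugate * H).trace ≠ 0)
    (hdisc : 4 * (ρ.adjugate * H).trace * H.det ≠ (H.adjugate * ρ).trace ^ 2) :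
    IsRegularPencil (pencilOf ρ H) := by
  refine ⟨ρ, H, hH, rfl, ?_⟩
  set α := (H.adjugate * ρ).trace
  set β := (ρ.adjugate * H).trace
  set d := H.det
  obtain ⟨r, hr⟩ := IsAlgClosed.exists_pow_nat_eq ((α : ℂ) ^ 2 - 4 * β * d) (n := 2) (by norm_num)
  have hd : (d : ℂ) ≠ 0 := by exact_mod_cast hH
  have hβ' : (β : ℂ) ≠ 0 := by exact_mod_cast hβ
  have hr0 : r ≠ 0 := by
    rintro rfl
    apply hdisc
    have : (4 * β * d : ℂ) = α ^ 2 := by linear_combination hr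
    exact_mod_cast this
  have hset : {t : ℂ | pencilCubic ρ H 1 t = 0} =
      {0, (-α + r) / (2 * d), (-α - r) / (2 * d)} := by
    ext t
    have h1 : (d : ℂ) * pencilCubic ρ H 1 t = (0 : ℝ) + t * β + t ^ 2 * α + t ^ 3 * d := by
      rw [← hρ]; exact det_mul_pencilCubic hH t
    have h2 : pencilCubic ρ H 1 t = 0 ↔ t * ((2 * d * t - (-α + r)) * (2 * d * t - (-α - r))) = 0 := by
      rw [← mul_right_inj' hd, h1, mul_zero]
      have : t * ((2 * d * t - (-α + r)) * (2 * d * t - (-α - r))) = (4 * d : ℂ) *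
          ((0 : ℝ) + t * β + t ^ 2 * α + t ^ 3 * d) := by
        push_cast
        linear_combination (-t) * hr
      rw [this, mul_eq_zero]
      simp [hd]
    have hd2 : (2 * d : ℂ) ≠ 0 := by simp [hd]
    simp only [Set.mem_ofPred_eq, h2, mul_eq_zero, mem_insert_iff, mem_singleton_iff, sub_eq_zero,
      eq_div_iff hd2, mul_comm t]
    tauto
  rw [hset, Set.ncard_eq_three]
  have hd2 : (2 * d : ℂ) ≠ 0 := by simp [hd]
  refine ⟨0, _, _, ?_, ?_, ?_, rfl⟩
  · intro h
    rw [eq_comm, div_eq_zero_iff, or_iff_left hd2] at h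
    have : (4 * β * d : ℂ) = 0 := by linear_combination hr - (r + α) * h
    simp [hd, hβ'] at this
  · intro h
    rw [eq_comm, div_eq_zero_iff, or_iff_left hd2] at h
    have : (4 * β * d : ℂ) = 0 := by linear_combination hr + (r - α) * h
    simp [hd, hβ'] at this
  · intro h
    rw [div_left_inj' hd2] at h
    apply hr0
    linear_combination (1 / 2) * h

theorem coefficients_of_isRegularPencil {ρ H : Mat3} (hH : H.det ≠ 0) (hρ : ρ.det = 0)
    (hP : IsRegularPencil (pencilOf ρ H)) : (ρ.adjugate * H).trace ≠ 0 ∧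
      4 * (ρ.adjugate * H).trace * H.det ≠ (H.adjugate * ρ).trace ^ 2 := by
  obtain ⟨N₀, H₀, hH₀, hP, hcard⟩ := hP
  obtain ⟨a, b, hN⟩ : N₀ ∈ pencilOf ρ H := hP ▸ ⟨1, 0, by simp⟩
  obtain ⟨c, e, hHe⟩ : H₀ ∈ pencilOf ρ H := hP ▸ ⟨0, 1, by simp⟩
  set α := (H.adjugate * ρ).trace with hα
  set β := (ρ.adjugate * H).trace with hβ
  set d := H.det with hd
  have hdet : ∀ s t : ℝ, (s • ρ + t • H).det = t * (d * t ^ 2 + α * s * t + β * s ^ 2) := by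
    intro s t
    rw [det_combination, hρ, ← hα, ← hβ, ← hd]; ring
  have hdet₀ : H₀.det = e * (d * e ^ 2 + α * c * e + β * c ^ 2) := by rw [hHe, hdet]
  -- The cubic of `N₀ + t H₀` in terms of `α`, `β`, `d`, first for real `t`, where it is a
  -- determinant, and so coefficientwise.
  have hcub : ∀ t : ℂ, (H₀.det : ℂ) * pencilCubic N₀ H₀ 1 t =
      (b + t * e) * (d * (b + t * e) ^ 2 + α * (a + t * c) * (b + t * e) + β * (a + t * c) ^ 2) := by
    intro t
    rw [det_mul_pencilCubic hH₀]
    have key : ∀ x : ℝ, N₀.det + x * (N₀.adjugate * H₀).trace + x ^ 2 * (H₀.adjugate * N₀).trace +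
        x ^ 3 * H₀.det = (b + x * e) *
          (d * (b + x * e) ^ 2 + α * (a + x * c) * (b + x * e) + β * (a + x * c) ^ 2) := by
      intro x
      have h1 := det_combination N₀ H₀ 1 x
      have h2 : (1 : ℝ) • N₀ + x • H₀ = (a + x * c) • ρ + (b + x * e) • H := by
        rw [hN, hHe]; module
      rw [h2, hdet] at h1
      linear_combination -h1
    have k0 := key 0
    have k1 := key 1
    have k2 := key (-1)
    have k3 := key 2
    have e0 : N₀.det = b * (d * b ^ 2 + α * a * b + β * a ^ 2) := by linear_combination k0
    have e3 : H₀.det = e * (d * e ^ 2 + α * c * e + β * c ^ 2) := hdet₀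
    have e2 : (H₀.adjugate * N₀).trace = 3 * d * b * e ^ 2 + α * (a * e ^ 2 + 2 * b * c * e) +
        β * (b * c ^ 2 + 2 * a * c * e) := by
      linear_combination (1 / 2) * k1 + (1 / 2) * k2 - e0
    have e1 : (N₀.adjugate * H₀).trace = 3 * d * b ^ 2 * e + α * (b ^ 2 * c + 2 * a * b * e) +
        β * (a ^ 2 * e + 2 * a * b * c) := by
      linear_combination k1 - e0 - e2 - e3
    rw [e0, e1, e2, e3]
    push_cast
    ring
  -- A double factor leaves at most two zeros.
  have hfew : ∀ k l : ℝ, (k * e + l * c ≠ 0) → e ≠ 0 → (∀ t : ℂ, pencilCubic N₀ H₀ 1 t = 0 →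
      (b + t * e : ℂ) = 0 ∨ (k * (b + t * e) + l * (a + t * c) : ℂ) = 0) → False := by
    intro k l hkl he h
    have he' : (e : ℂ) ≠ 0 := by exact_mod_cast he
    have hkl' : (k * e + l * c : ℂ) ≠ 0 := by exact_mod_cast hkl
    have hsub : {t : ℂ | pencilCubic N₀ H₀ 1 t = 0} ⊆
        ({(-b / e : ℂ), (-(k * b + l * a) / (k * e + l * c) : ℂ)} : Set ℂ) := by
      intro t ht
      rcases h t ht with h1 | h1
      · left
        rw [eq_div_iff he']; linear_combination h1
      · right
        rw [mem_singleton_iff, eq_div_iff hkl']; linear_combination h1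
    have := Set.ncard_le_ncard hsub (Set.toFinite _)
    rw [hcard] at this
    have h2 := Set.ncard_insert_le (-b / e : ℂ) {(-(k * b + l * a) / (k * e + l * c) : ℂ)}
    rw [Set.ncard_singleton] at h2
    omega
  have he : e ≠ 0 := by
    rintro rfl
    exact hH₀ (by rw [hdet₀]; ring)
  have hzero : ∀ t : ℂ, pencilCubic N₀ H₀ 1 t = 0 → (b + t * e : ℂ) *
      (d * (b + t * e) ^ 2 + α * (a + t * c) * (b + t * e) + β * (a + t * c) ^ 2) = 0 := by
    intro t ht
    rw [← hcub, ht, mul_zero]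
  constructor
  · intro hβ0
    refine hfew d α ?_ he fun t ht => ?_
    · intro h0
      exact hH₀ (by rw [hdet₀, hβ0]; linear_combination e ^ 2 * h0)
    · have h1 := hzero t ht
      rw [hβ0] at h1
      have h2 : (b + t * e : ℂ) * ((b + t * e) * (d * (b + t * e) + α * (a + t * c))) = 0 := by
        push_cast at h1
        linear_combination h1
      rcases mul_eq_zero.1 h2 with h3 | h3
      · exact Or.inl h3
      · exact mul_eq_zero.1 h3
  · intro h4
    refine hfew (2 * d) α ?_ he fun t ht => ?_
    · intro h0
      have : 4 * d * H₀.det = 0 := by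
        rw [hdet₀]
        linear_combination e * (2 * d * e + α * c) * h0 + e * c ^ 2 * h4
      simp [hH, hH₀] at this
    · have h1 := hzero t ht
      have h4' : (4 * β * d : ℂ) = α ^ 2 := by exact_mod_cast h4
      have h2 : (b + t * e : ℂ) * (2 * d * (b + t * e) + α * (a + t * c)) ^ 2 = 0 := by
        linear_combination (4 * d) * h1 - (b + t * e) * (a + t * c) ^ 2 * h4'
      rcases mul_eq_zero.1 h2 with h3 | h3
      · exact Or.inl h3
      · right
        push_cast
        exact pow_eq_zero_iff (two_ne_zero) |>.1 h3

/-! ### Unparametrised geodesics and projective equivalence -/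

theorem IsTorsionFreeOn.mono {U W : Set Pt} {Γ : Christoffel} (h : IsTorsionFreeOn U Γ)
    (hs : W ⊆ U) : IsTorsionFreeOn W Γ :=
  ⟨fun a b c => (h.smooth a b c).mono hs, fun x hx => h.symm x (hs hx)⟩

/-- Through every point of an open set there is a geodesic with given non-zero initial velocity. -/
theorem exists_isUnparamGeodesic {W : Set Pt} (hW : IsOpen W) {Γ : Christoffel}
    (hΓ : IsTorsionFreeOn W Γ) {x v : Pt} (hx : x ∈ W) (hv : v ≠ 0) :
    ∃ ε > 0, ∃ γ : ℝ → Pt, (∀ t ∈ Ioo (-ε) ε, γ t ∈ W) ∧ IsUnparamGeodesic Γ (Ioo (-ε) ε) γ ∧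
      γ 0 = x ∧ deriv γ 0 = v := by
  -- The geodesic equation as a first-order system on positions and velocities.
  let acc : Pt × Pt → Pt := fun z c => -∑ a, ∑ b, Γ z.1 a b c * z.2 a * z.2 b
  have hacc : ContDiffOn ℝ ∞ acc (W ×ˢ univ) := by
    rw [contDiffOn_pi]
    intro c
    have h1 : ∀ a b, ContDiffOn ℝ ∞ (fun z : Pt × Pt => Γ z.1 a b c) (W ×ˢ univ) := fun a b =>
      (hΓ.smooth a b c).comp contDiffOn_fst fun z hz => hz.1
    have h2 : ∀ a, ContDiffOn ℝ ∞ (fun z : Pt × Pt => z.2 a) (W ×ˢ univ) := fun a => by fun_prop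
    exact (ContDiffOn.sum fun a _ => ContDiffOn.sum fun b _ => ((h1 a b).mul (h2 a)).mul (h2 b)).neg
  have hopen : IsOpen (W ×ˢ (univ : Set Pt)) := hW.prod isOpen_univ
  have hf : ContDiffAt ℝ 1 (fun z : Pt × Pt => (z.2, acc z)) (x, v) :=
    (contDiffAt_snd.prodMk (hacc.contDiffAt (hopen.mem_nhds ⟨hx, mem_univ _⟩))).of_le (by simp)
  obtain ⟨α, hα0, δ, hδ, hα⟩ :=
    hf.exists_forall_mem_closedBall_exists_eq_forall_mem_Ioo_hasDerivAt₀ 0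
  have hcont : ContinuousAt α 0 := (hα 0 ⟨by linarith, by linarith⟩).continuousAt
  have hev : ∀ᶠ t in 𝓝 (0 : ℝ), (α t).1 ∈ W ∧ (α t).2 ≠ 0 := by
    have h1 : ∀ᶠ z in 𝓝 (α 0), z.1 ∈ W ∧ z.2 ≠ 0 := by
      rw [hα0]
      exact (continuousAt_fst.eventually (hW.mem_nhds hx)).and
        (continuousAt_snd.eventually_ne hv)
    exact hcont.eventually h1
  obtain ⟨ε₁, hε₁, hball⟩ := Metric.eventually_nhds_iff.1 hev
  have hgood : ∀ t ∈ Ioo (-min ε₁ δ) (min ε₁ δ),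
      ((α t).1 ∈ W ∧ (α t).2 ≠ 0) ∧ HasDerivAt α ((α t).2, acc (α t)) t := by
    intro t ht
    have h1 : |t| < min ε₁ δ := abs_lt.2 ht
    refine ⟨hball (by simpa using h1.trans_le (min_le_left _ _)), hα t ?_⟩
    have h2 := abs_lt.1 (h1.trans_le (min_le_right _ _))
    exact ⟨by linarith [h2.1], by linarith [h2.2]⟩
  set I : Set ℝ := Ioo (-min ε₁ δ) (min ε₁ δ) with hI
  have hIo : IsOpen I := isOpen_Ioo
  have hd1 : ∀ t ∈ I, HasDerivAt (fun t => (α t).1) (α t).2 t := fun t ht => (hgood t ht).2.fst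
  have hd2 : ∀ t ∈ I, HasDerivAt (fun t => (α t).2) (acc (α t)) t := fun t ht => (hgood t ht).2.snd
  have hder : ∀ t ∈ I, deriv (fun t => (α t).1) t = (α t).2 := fun t ht => (hd1 t ht).deriv
  have hdd : ∀ t ∈ I, HasDerivAt (deriv fun t => (α t).1) (acc (α t)) t := fun t ht =>
    (hd2 t ht).congr_of_eventuallyEq (by filter_upwards [hIo.mem_nhds ht] with s hs using hder s hs)
  have h0 : (0 : ℝ) ∈ I := ⟨by simp [hε₁, hδ], by simp [hε₁, hδ]⟩
  refine ⟨min ε₁ δ, by positivity, fun t => (α t).1, fun t ht => (hgood t ht).1.1, ⟨?_, ?_⟩,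
    by simp [hα0], by rw [hder 0 h0, hα0]⟩
  · have hαc : ContinuousOn α I := fun t ht => (hgood t ht).2.continuousAt.continuousWithinAt
    rw [show (2 : WithTop ℕ∞) = 1 + 1 by norm_num, contDiffOn_succ_iff_deriv_of_isOpen hIo]
    refine ⟨fun t ht => (hd1 t ht).differentiableAt.differentiableWithinAt, by simp, ?_⟩
    rw [show (1 : WithTop ℕ∞) = 0 + 1 by norm_num, contDiffOn_succ_iff_deriv_of_isOpen hIo]
    refine ⟨fun t ht => (hdd t ht).differentiableAt.differentiableWithinAt, by simp, ?_⟩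
    rw [contDiffOn_zero]
    exact (hacc.continuousOn.comp hαc fun t ht => ⟨(hgood t ht).1.1, mem_univ _⟩).congr
      fun t ht => (hdd t ht).deriv
  · intro t ht
    refine ⟨by rw [hder t ht]; exact (hgood t ht).1.2, 0, fun c => ?_⟩
    rw [(hdd t ht).deriv, hder t ht]
    simp [acc]

/-- Connections with the same unparametrised geodesics differ by `δ_a^c Υ_b + δ_b^c Υ_a`: compare
accelerations along the geodesic with an arbitrary initial velocity. -/
theorem ProjEquivOn.eq_add {W : Set Pt} (hW : IsOpen W) {Γ Γ' : Christoffel}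
    (hΓ : IsTorsionFreeOn W Γ) (hs : ∀ x ∈ W, ∀ a b c, Γ' x a b c = Γ' x b a c)
    (h : ProjEquivOn W Γ Γ') {x : Pt} (hx : x ∈ W) (a b c : Fin 3) :
    Γ' x a b c = Γ x a b c + kron a c * ((1 / 4) * ∑ d, (Γ' x b d d - Γ x b d d)) +
      kron b c * ((1 / 4) * ∑ d, (Γ' x a d d - Γ x a d d)) := by
  have key := eq_kron_of_quadratic_parallel (fun a b c => Γ' x a b c - Γ x a b c)
    (fun a b c => by rw [hs x hx a b c, hΓ.symm x hx a b c]) ?_ a b c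
  · linarith
  · intro v hv
    obtain ⟨ε, hε, γ, hγW, hγ, hγ0, hγ1⟩ := exists_isUnparamGeodesic hW hΓ hx hv
    have hγ' := (h (-ε) ε γ hγW).1 hγ
    have h0 : (0 : ℝ) ∈ Ioo (-ε) ε := ⟨by linarith, hε⟩
    obtain ⟨-, k, hk⟩ := hγ.2 0 h0
    obtain ⟨-, k', hk'⟩ := hγ'.2 0 h0
    refine ⟨k' - k, fun c => ?_⟩
    have h1 := hk c
    have h2 := hk' c
    rw [hγ0, hγ1] at h1 h2
    simp only [sub_mul, Finset.sum_sub_distrib]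
    linarith

/-- A change `δ_a^c Υ_b + δ_b^c Υ_a` of the connection alters the acceleration of a curve by a
multiple of its velocity. -/
theorem projEquivOn_of_eq_add {W : Set Pt} {Γ Γ' : Christoffel} (Υ : Pt → Fin 3 → ℝ)
    (h : ∀ x ∈ W, ∀ a b c, Γ' x a b c = Γ x a b c + kron a c * Υ x b + kron b c * Υ x a) :
    ProjEquivOn W Γ Γ' := by
  have hsum : ∀ x ∈ W, ∀ (v : Fin 3 → ℝ) c, ∑ a, ∑ b, Γ' x a b c * v a * v b =
      ∑ a, ∑ b, Γ x a b c * v a * v b + 2 * (∑ a, Υ x a * v a) * v c := by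
    intro x hx v c
    simp only [h x hx]
    revert c
    simp only [forall_fin_three, Fin.sum_univ_three, kron_values]
    refine ⟨?_, ?_, ?_⟩ <;> ring
  intro s t γ hγ
  constructor
  · rintro ⟨h1, h2⟩
    refine ⟨h1, fun r hr => ?_⟩
    obtain ⟨hne, k, hk⟩ := h2 r hr
    refine ⟨hne, k + 2 * ∑ a, Υ (γ r) a * deriv γ r a, fun c => ?_⟩
    rw [hsum _ (hγ r hr)]
    linear_combination hk c
  · rintro ⟨h1, h2⟩
    refine ⟨h1, fun r hr => ?_⟩
    obtain ⟨hne, k, hk⟩ := h2 r hr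
    refine ⟨hne, k - 2 * ∑ a, Υ (γ r) a * deriv γ r a, fun c => ?_⟩
    have := hk c
    rw [hsum _ (hγ r hr)] at this
    linear_combination this

/-- The projective change by `Υ_a` adds `4 Υ_a` to the trace `Γ_{ab}{}^b`, so `Υ` is a quarter of the
difference of `d log |vol|` and this trace. -/
theorem exists_projEquivOn_preservesVolumeOn {U : Set Pt} {Γ : Christoffel} {vol : Pt → ℝ}
    (hU : IsOpen U) (hΓ : IsTorsionFreeOn U Γ) (hvol : IsVolumeOn U vol) :
    ∃ Γ' : Christoffel, IsTorsionFreeOn U Γ' ∧ ProjEquivOn U Γ Γ' ∧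
      PreservesVolumeOn U Γ' vol := by
  let Υ : Pt → Fin 3 → ℝ := fun x a => (1 / 4) * (pd a vol x / vol x - ∑ b, Γ x a b b)
  have hΥ : ∀ a, ContDiffOn ℝ ∞ (fun x => Υ x a) U := fun a =>
    contDiffOn_const.mul (((hvol.smooth.pd_of_isOpen hU a).div hvol.smooth hvol.ne_zero).sub
      (ContDiffOn.sum fun b _ => hΓ.smooth a b b))
  refine ⟨fun x a b c => Γ x a b c + kron a c * Υ x b + kron b c * Υ x a, ⟨fun a b c => ?_, ?_⟩,
    projEquivOn_of_eq_add Υ fun x _ a b c => rfl, ?_⟩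
  · exact ((hΓ.smooth a b c).add (contDiffOn_const.mul (hΥ b))).add (contDiffOn_const.mul (hΥ a))
  · intro x hx a b c
    simp only [hΓ.symm x hx a b c]
    ring
  · intro x hx a
    have h0 := hvol.ne_zero x hx
    have h1 : ∑ b, (Γ x a b b + kron a b * Υ x b + kron b b * Υ x a) =
        (∑ b, Γ x a b b) + 4 * Υ x a := by
      revert a
      simp only [forall_fin_three, Fin.sum_univ_three, kron_values]
      refine ⟨?_, ?_, ?_⟩ <;> ring
    rw [h1]
    simp only [Υ]
    field_simp
    ring

/-! ### The Levi-Civita connection -/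

theorem IsMetricOn.mono {U W : Set Pt} {g : Pt → Mat3} (h : IsMetricOn U g) (hs : W ⊆ U) :
    IsMetricOn W g :=
  ⟨fun a b => (h.smooth a b).mono hs, fun x hx => h.symm x (hs hx), fun x hx => h.nondeg x (hs hx)⟩

theorem IsMetricOn.pd_symm {W : Set Pt} (hW : IsOpen W) {g : Pt → Mat3} (hg : IsMetricOn W g)
    {x : Pt} (hx : x ∈ W) (a b c : Fin 3) :
    pd a (fun y => g y b c) x = pd a (fun y => g y c b) x :=
  pd_congr_of_eqOn hW (fun y hy => (hg.symm y hy).apply c b) hx a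

theorem leviCivita_symm {W : Set Pt} (hW : IsOpen W) {g : Pt → Mat3} (hg : IsMetricOn W g)
    {x : Pt} (hx : x ∈ W) (a b c : Fin 3) : leviCivita g x a b c = leviCivita g x b a c := by
  unfold leviCivita
  congr 1
  refine Finset.sum_congr rfl fun d _ => ?_
  rw [hg.pd_symm hW hx d a b]
  ring

theorem leviCivita_lower {g : Pt → Mat3} {x : Pt} (hs : (g x).IsSymm) (h0 : (g x).det ≠ 0)
    (a b e : Fin 3) : ∑ c, leviCivita g x a b c * g x c e = (1 / 2) *
      (pd a (fun y => g y b e) x + pd b (fun y => g y a e) x - pd e (fun y => g y a b) x) := by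
  have h1 : ∀ d, ∑ c, (g x)⁻¹ c d * g x c e = if e = d then 1 else 0 := by
    intro d
    have := congrFun (congrFun (Matrix.mul_nonsing_inv _ h0.isUnit) e) d
    rw [Matrix.mul_apply, Matrix.one_apply] at this
    rw [← this]
    exact Finset.sum_congr rfl fun c _ => by rw [hs.apply e c, mul_comm]
  have h2 : ∑ c, leviCivita g x a b c * g x c e = (1 / 2) * ∑ d, (∑ c, (g x)⁻¹ c d * g x c e) *
      (pd a (fun y => g y b d) x + pd b (fun y => g y a d) x - pd d (fun y => g y a b) x) := by
    simp only [leviCivita, Fin.sum_univ_three]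
    ring
  rw [h2]
  simp only [h1, ite_mul, one_mul, zero_mul, Finset.sum_ite_eq, Finset.mem_univ, if_true]

theorem dMat_metric {W : Set Pt} (hW : IsOpen W) {g : Pt → Mat3} (hg : IsMetricOn W g)
    {x : Pt} (hx : x ∈ W) (a : Fin 3) : dMat a g x =
      cMat (leviCivita g) x a * g x + g x * (cMat (leviCivita g) x a).transpose := by
  ext b c
  have h1 := leviCivita_lower (hg.symm x hx) (hg.nondeg x hx) a b c
  have h2 := leviCivita_lower (hg.symm x hx) (hg.nondeg x hx) a c b
  have h3 : ∑ d, g x b d * leviCivita g x a c d = ∑ d, leviCivita g x a c d * g x d b :=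
    Finset.sum_congr rfl fun d _ => by rw [(hg.symm x hx).apply d b, mul_comm]
  simp only [dMat, cMat, Matrix.add_apply, Matrix.mul_apply, Matrix.of_apply,
    Matrix.transpose_apply, h1, h2, h3]
  rw [hg.pd_symm hW hx a c b, hg.pd_symm hW hx b a c, hg.pd_symm hW hx c a b]
  ring

/-- A torsion-free connection for which the metric is parallel is its Levi-Civita connection. -/
theorem leviCivita_eq_of_dMat {W : Set Pt} {g : Pt → Mat3} (hg : IsMetricOn W g)
    {Γ : Christoffel} {x : Pt} (hx : x ∈ W) (hs : ∀ a b c, Γ x a b c = Γ x b a c)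
    (h : ∀ a, dMat a g x = cMat Γ x a * g x + g x * (cMat Γ x a).transpose) (a b c : Fin 3) :
    leviCivita g x a b c = Γ x a b c := by
  have hent : ∀ a b c, pd a (fun y => g y b c) x =
      ∑ d, Γ x a b d * g x d c + ∑ d, Γ x a c d * g x d b := by
    intro a b c
    have := congrFun (congrFun (h a) b) c
    simp only [dMat, cMat, Matrix.add_apply, Matrix.mul_apply, Matrix.of_apply,
      Matrix.transpose_apply] at this
    rw [this]
    congr 1
    exact Finset.sum_congr rfl fun d _ => by rw [(hg.symm x hx).apply d b, mul_comm]
  have hlow : ∀ e, ∑ c, leviCivita g x a b c * g x c e = ∑ c, Γ x a b c * g x c e := by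
    intro e
    rw [leviCivita_lower (hg.symm x hx) (hg.nondeg x hx), hent, hent, hent]
    simp only [hs b a, hs e a, hs e b]
    ring
  have hm : Matrix.vecMul (fun c => leviCivita g x a b c) (g x) =
      Matrix.vecMul (fun c => Γ x a b c) (g x) := by
    funext e
    exact hlow e
  have hinj := Matrix.vecMul_injective_of_isUnit
    ((Matrix.isUnit_iff_isUnit_det _).2 (hg.nondeg x hx).isUnit)
  exact congrFun (hinj hm) c

/-! ### The metrisability equation -/

/-- A smooth non-degenerate solution `η` on `W` of the linear metrisability equation
`(∇_a η^{bc})_∘ = 0`. The volume form trivialises the density weight of `η`. -/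
structure SolvesMetrisability (W : Set Pt) (Γ : Christoffel) (η : Pt → Mat3) : Prop where
  smooth : SmoothMat W η
  symm : ∀ x ∈ W, (η x).IsSymm
  nondeg : ∀ x ∈ W, (η x).det ≠ 0
  eq : ∀ x ∈ W, ∀ a b c, tracefree (covD Γ η x) a b c = 0

theorem tracefree_kron (μ : Fin 3 → ℝ) (a b c : Fin 3) :
    tracefree (fun a b c => kron a b * μ c + kron a c * μ b) a b c = 0 := by
  revert a b c
  simp only [tracefree, forall_fin_three, Fin.sum_univ_three, kron_values]
  refine ⟨⟨⟨?_, ?_, ?_⟩, ⟨?_, ?_, ?_⟩, ?_, ?_, ?_⟩, ⟨⟨?_, ?_, ?_⟩, ⟨?_, ?_, ?_⟩, ?_, ?_, ?_⟩,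
    ⟨?_, ?_, ?_⟩, ⟨?_, ?_, ?_⟩, ?_, ?_, ?_⟩ <;> ring

theorem eq_kron_of_tracefree {S : Fin 3 → Fin 3 → Fin 3 → ℝ} {a b c : Fin 3}
    (h : tracefree S a b c = 0) :
    S a b c = kron a b * ((1 / 4) * ∑ d, S d c d) + kron a c * ((1 / 4) * ∑ d, S d b d) := by
  unfold tracefree at h
  linarith

/-- The matrix of the pure-trace tensor `δ_a^b μ^c + δ_a^c μ^b`, the index `a` being fixed. -/
def pureTrace (μ : Fin 3 → ℝ) (a : Fin 3) : Mat3 :=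
  Matrix.of fun b c => kron a b * μ c + kron a c * μ b

/-- The matrix `δ_a^q Υ_p + δ_p^q Υ_a`, the index `a` being fixed, of a projective change. -/
def projChange (Υ : Fin 3 → ℝ) (a : Fin 3) : Mat3 :=
  Matrix.of fun p q => kron a q * Υ p + kron p q * Υ a

theorem conj_pureTrace {G : Mat3} (hG : G.IsSymm) (μ : Fin 3 → ℝ) (a : Fin 3) :
    G * pureTrace μ a * G = projChange (G.mulVec μ) a * G + G * (projChange (G.mulVec μ) a).transpose
      - (2 * G.mulVec μ a) • G := by
  obtain ⟨g1, g2, g3⟩ := isSymm_entries hG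
  revert a
  simp only [← Matrix.ext_iff, pureTrace, projChange, forall_fin_three, Matrix.mul_apply,
    Matrix.sub_apply, Matrix.add_apply, Matrix.smul_apply, Matrix.of_apply, Matrix.transpose_apply,
    Fin.sum_univ_three, kron_values, Matrix.mulVec, dotProduct, smul_eq_mul, g1, g2, g3]
  refine ⟨⟨⟨?_, ?_, ?_⟩, ⟨?_, ?_, ?_⟩, ?_, ?_, ?_⟩, ⟨⟨?_, ?_, ?_⟩, ⟨?_, ?_, ?_⟩, ?_, ?_, ?_⟩,
    ⟨?_, ?_, ?_⟩, ⟨?_, ?_, ?_⟩, ?_, ?_, ?_⟩ <;> ring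

theorem trace_mul_pureTrace {G : Mat3} (hG : G.IsSymm) (μ : Fin 3 → ℝ) (a : Fin 3) :
    (G * pureTrace μ a).trace = 2 * G.mulVec μ a := by
  obtain ⟨g1, g2, g3⟩ := isSymm_entries hG
  revert a
  simp only [pureTrace, forall_fin_three, Matrix.mul_apply, Matrix.trace, Matrix.diag,
    Matrix.of_apply, Fin.sum_univ_three, kron_values, Matrix.mulVec, dotProduct, g1, g2, g3]
  refine ⟨?_, ?_, ?_⟩ <;> ring

theorem projChange_mul_add {G : Mat3} (hG : G.IsSymm) (Υ : Fin 3 → ℝ) (a : Fin 3) :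
    (projChange Υ a).transpose * G + G * projChange Υ a =
      (2 * Υ a) • G + pureTrace (G.mulVec Υ) a := by
  obtain ⟨g1, g2, g3⟩ := isSymm_entries hG
  revert a
  simp only [← Matrix.ext_iff, pureTrace, projChange, forall_fin_three, Matrix.mul_apply,
    Matrix.add_apply, Matrix.smul_apply, Matrix.of_apply, Matrix.transpose_apply,
    Fin.sum_univ_three, kron_values, Matrix.mulVec, dotProduct, smul_eq_mul, g1, g2, g3]
  refine ⟨⟨⟨?_, ?_, ?_⟩, ⟨?_, ?_, ?_⟩, ?_, ?_, ?_⟩, ⟨⟨?_, ?_, ?_⟩, ⟨?_, ?_, ?_⟩, ?_, ?_, ?_⟩,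
    ⟨?_, ?_, ?_⟩, ⟨?_, ?_, ?_⟩, ?_, ?_, ?_⟩ <;> ring

theorem isSymm_inv {A : Mat3} (h : A.IsSymm) : (A⁻¹).IsSymm := by
  rw [Matrix.IsSymm, Matrix.transpose_nonsing_inv, h.eq]

theorem SolvesMetrisability.dMat_eq {W : Set Pt} {Γ : Christoffel} {η : Pt → Mat3}
    (h : SolvesMetrisability W Γ η) {x : Pt} (hx : x ∈ W) (a : Fin 3) : dMat a η x =
      pureTrace (fun c => (1 / 4) * ∑ d, covD Γ η x d c d) a -
        (cMat Γ x a).transpose * η x - η x * cMat Γ x a := by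
  ext b c
  have h1 := eq_kron_of_tracefree (h.eq x hx a b c)
  rw [covD_eq_matrix] at h1
  simp only [Matrix.add_apply] at h1
  simp only [Matrix.sub_apply, pureTrace, Matrix.of_apply]
  linarith

theorem PreservesVolumeOn.pd_eq {U : Set Pt} {Γ : Christoffel} {vol : Pt → ℝ}
    (h : PreservesVolumeOn U Γ vol) {x : Pt} (hx : x ∈ U) (a : Fin 3) :
    pd a vol x = (cMat Γ x a).trace * vol x := by
  have := h x hx a
  simp only [cMat, Matrix.trace, Matrix.diag, Matrix.of_apply]
  linarith

/-- A solution `η` of the metrisability equation gives the metric with inverse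
`vol² det(η) η^{ab}`. -/
theorem SolvesMetrisability.metrisableOn {W : Set Pt} (hW : IsOpen W) {Γ : Christoffel}
    {vol : Pt → ℝ} (hΓ : IsTorsionFreeOn W Γ) (hvol : IsVolumeOn W vol)
    (hp : PreservesVolumeOn W Γ vol) {η : Pt → Mat3} (h : SolvesMetrisability W Γ η) :
    MetrisableOn W Γ := by
  set Δ : Pt → ℝ := fun x => vol x * vol x * (η x).det with hΔ
  have hΔs : ContDiffOn ℝ ∞ Δ W := (hvol.smooth.mul hvol.smooth).mul h.smooth.det
  have hΔ0 : ∀ x ∈ W, Δ x ≠ 0 := fun x hx =>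
    mul_ne_zero (mul_ne_zero (hvol.ne_zero x hx) (hvol.ne_zero x hx)) (h.nondeg x hx)
  set g : Pt → Mat3 := fun x => (Δ x)⁻¹ • (η x)⁻¹ with hgdef
  have hgs : SmoothMat W g := (h.smooth.inv h.nondeg).smul (hΔs.inv hΔ0)
  have hg : IsMetricOn W g := by
    refine ⟨hgs, fun x hx => (isSymm_inv (h.symm x hx)).smul _, fun x hx => ?_⟩
    rw [hgdef, Matrix.det_smul, Matrix.det_nonsing_inv, Ring.inverse_eq_inv']
    exact mul_ne_zero (pow_ne_zero _ (inv_ne_zero (hΔ0 x hx))) (inv_ne_zero (h.nondeg x hx))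
  let μ : Pt → Fin 3 → ℝ := fun x c => (1 / 4) * ∑ d, covD Γ η x d c d
  let Υ : Pt → Fin 3 → ℝ := fun x => (η x)⁻¹.mulVec (μ x)
  let Γ' : Christoffel := fun x a b c => Γ x a b c - (kron a c * Υ x b + kron b c * Υ x a)
  have hΓ' : ∀ x a, cMat Γ' x a = cMat Γ x a - projChange (Υ x) a := by
    intro x a
    ext b c
    rfl
  have hdet : ∀ x ∈ W, ∀ a, pd a Δ x = Δ x * (2 * Υ x a) := by
    intro x hx a
    have hG := isSymm_inv (h.symm x hx)
    have hu := (h.nondeg x hx).isUnit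
    have hv := hvol.smooth.diffAt hW hx
    have htr : ((η x)⁻¹ * dMat a η x).trace = 2 * Υ x a - 2 * (cMat Γ x a).trace := by
      rw [h.dMat_eq hx, Matrix.mul_sub, Matrix.mul_sub, Matrix.trace_sub, Matrix.trace_sub,
        trace_mul_pureTrace hG, ← Matrix.mul_assoc, Matrix.trace_mul_comm (_ * _) (η x),
        ← Matrix.mul_assoc, Matrix.mul_nonsing_inv _ hu, Matrix.one_mul, ← Matrix.mul_assoc,
        Matrix.nonsing_inv_mul _ hu, Matrix.one_mul, Matrix.trace_transpose]
      simp only [Υ, μ]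
      ring
    have hv2 : DifferentiableAt ℝ (fun y => vol y * vol y) x := hv.mul hv
    change pd a (fun y => vol y * vol y * (η y).det) x = vol x * vol x * (η x).det * _
    rw [pd_mul hv2 (h.smooth.det.diffAt hW hx), pd_mul hv hv,
      pd_det (h.smooth.diffAt hW hx) (h.nondeg x hx), htr, hp.pd_eq hx]
    ring
  refine ⟨g, hg, projEquivOn_of_eq_add (fun x a => -Υ x a) fun x hx a b c => ?_⟩
  have hs : ∀ a b c, Γ' x a b c = Γ' x b a c := fun a b c => by
    simp only [Γ', hΓ.symm x hx a b c]; ring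
  rw [leviCivita_eq_of_dMat hg hx hs ?_ a b c]
  · simp only [Γ']; ring
  · intro a
    have hG := isSymm_inv (h.symm x hx)
    have hu := (h.nondeg x hx).isUnit
    have hinv : pd a (fun y => (Δ y)⁻¹) x = -(Δ x)⁻¹ * (2 * Υ x a) := by
      rw [pd_comp (hasDerivAt_inv (hΔ0 x hx)) (hΔs.diffAt hW hx), hdet x hx]
      have := hΔ0 x hx
      field_simp
    have hconj : (η x)⁻¹ * dMat a η x * (η x)⁻¹ =
        projChange (Υ x) a * (η x)⁻¹ + (η x)⁻¹ * (projChange (Υ x) a).transpose -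
          (2 * Υ x a) • (η x)⁻¹ - (η x)⁻¹ * (cMat Γ x a).transpose - cMat Γ x a * (η x)⁻¹ := by
      rw [h.dMat_eq hx, Matrix.mul_sub, Matrix.mul_sub, Matrix.sub_mul, Matrix.sub_mul,
        conj_pureTrace hG]
      congr 1
      · congr 1
        rw [Matrix.mul_assoc, Matrix.mul_assoc, Matrix.mul_nonsing_inv _ hu, Matrix.mul_one]
      · rw [← Matrix.mul_assoc, Matrix.nonsing_inv_mul _ hu, Matrix.one_mul]
    have hi : DifferentiableAt ℝ (fun y => (Δ y)⁻¹) x := (hΔs.inv hΔ0).diffAt hW hx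
    change dMat a (fun y => (Δ y)⁻¹ • (η y)⁻¹) x = cMat Γ' x a * ((Δ x)⁻¹ • (η x)⁻¹) +
      ((Δ x)⁻¹ • (η x)⁻¹) * (cMat Γ' x a).transpose
    rw [hΓ', dMat_smul hi ((h.smooth.inv h.nondeg).diffAt hW hx),
      dMat_inv hW h.smooth h.nondeg hx, hinv, hconj]
    simp only [Matrix.sub_mul, Matrix.mul_sub, Matrix.transpose_sub, Matrix.mul_smul,
      Matrix.smul_mul]
    module

/-- If `g` is a metric with the geodesics of `Γ`, a suitable multiple of its inverse solves the
metrisability equation; the factor `|det g|^{1/4} |vol|^{-1/2}` accounts for the volume form. -/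
theorem MetrisableOn.exists_solvesMetrisability {W : Set Pt} (hW : IsOpen W) {Γ : Christoffel}
    {vol : Pt → ℝ} (hΓ : IsTorsionFreeOn W Γ) (hvol : IsVolumeOn W vol)
    (hp : PreservesVolumeOn W Γ vol) (h : MetrisableOn W Γ) :
    ∃ η, SolvesMetrisability W Γ η := by
  obtain ⟨g, hg, hproj⟩ := h
  have hgs : SmoothMat W g := hg.smooth
  set F : Pt → ℝ := fun x =>
    Real.exp ((1 / 4) * Real.log (g x).det - (1 / 2) * Real.log (vol x)) with hF
  have hFs : ContDiffOn ℝ ∞ F W :=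
    ((contDiffOn_const.mul (hgs.det.log hg.nondeg)).sub
      (contDiffOn_const.mul (hvol.smooth.log hvol.ne_zero))).exp
  have hF0 : ∀ x, F x ≠ 0 := fun x => Real.exp_ne_zero _
  let Υ : Pt → Fin 3 → ℝ := fun x a => (1 / 4) * ∑ d, (leviCivita g x a d d - Γ x a d d)
  have hL : ∀ x ∈ W, ∀ a, cMat Γ x a = cMat (leviCivita g) x a - projChange (Υ x) a := by
    intro x hx a
    ext b c
    have := hproj.eq_add hW hΓ (fun x hx => leviCivita_symm hW hg hx) hx a b c
    simp only [cMat, projChange, Matrix.sub_apply, Matrix.of_apply, Υ]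
    linarith
  refine ⟨fun x => F x • (g x)⁻¹, (hgs.inv hg.nondeg).smul hFs,
    fun x hx => (isSymm_inv (hg.symm x hx)).smul _, fun x hx => ?_, fun x hx a b c => ?_⟩
  · rw [Matrix.det_smul, Matrix.det_nonsing_inv, Ring.inverse_eq_inv']
    exact mul_ne_zero (pow_ne_zero _ (hF0 x)) (inv_ne_zero (hg.nondeg x hx))
  · have hu := (hg.nondeg x hx).isUnit
    have hG := isSymm_inv (hg.symm x hx)
    have hpF : ∀ a, pd a F x = F x * (2 * Υ x a) := by
      intro a
      have hd1 := hgs.det.diffAt hW hx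
      have hd2 := hvol.smooth.diffAt hW hx
      have hl1 := (hgs.det.log hg.nondeg).diffAt hW hx
      have hl2 := (hvol.smooth.log hvol.ne_zero).diffAt hW hx
      have h1 : ((g x)⁻¹ * dMat a g x).trace = 2 * (cMat (leviCivita g) x a).trace := by
        rw [dMat_metric hW hg hx, Matrix.mul_add, Matrix.trace_add, ← Matrix.mul_assoc,
          Matrix.trace_mul_comm (_ * _) (g x), ← Matrix.mul_assoc, Matrix.mul_nonsing_inv _ hu,
          Matrix.one_mul, ← Matrix.mul_assoc, Matrix.nonsing_inv_mul _ hu, Matrix.one_mul,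
          Matrix.trace_transpose]
        ring
      have hm1 : DifferentiableAt ℝ (fun y => (1 / 4) * Real.log (g y).det) x := hl1.const_mul _
      have hm2 : DifferentiableAt ℝ (fun y => (1 / 2) * Real.log (vol y)) x := hl2.const_mul _
      have hm : DifferentiableAt ℝ
        (fun y => (1 / 4) * Real.log (g y).det - (1 / 2) * Real.log (vol y)) x := hm1.sub hm2
      change pd a (fun y => Real.exp ((1 / 4) * Real.log (g y).det - (1 / 2) * Real.log (vol y))) x
        = _
      rw [pd_comp (Real.hasDerivAt_exp _) hm, pd_sub hm1 hm2, pd_const_mul hl1, pd_const_mul hl2,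
        pd_comp (Real.hasDerivAt_log (hg.nondeg x hx)) hd1,
        pd_comp (Real.hasDerivAt_log (hvol.ne_zero x hx)) hd2,
        pd_det (hgs.diffAt hW hx) (hg.nondeg x hx), h1, hp.pd_eq hx,
        inv_mul_cancel_left₀ (hg.nondeg x hx), mul_comm _ (vol x),
        inv_mul_cancel_left₀ (hvol.ne_zero x hx)]
      congr 1
      simp only [Υ, cMat, Matrix.trace, Matrix.diag, Matrix.of_apply, Finset.sum_sub_distrib]
      ring
    have hcov : ∀ a b c, covD Γ (fun x => F x • (g x)⁻¹) x a b c =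
        kron a b * (-(F x • (g x)⁻¹.mulVec (Υ x))) c +
          kron a c * (-(F x • (g x)⁻¹.mulVec (Υ x))) b := by
      intro a b c
      have hmat : dMat a (fun x => F x • (g x)⁻¹) x + (cMat Γ x a).transpose * (F x • (g x)⁻¹) +
          (F x • (g x)⁻¹) * cMat Γ x a = -(F x • pureTrace ((g x)⁻¹.mulVec (Υ x)) a) := by
        have h2 := projChange_mul_add hG (Υ x) a
        have h3 : (g x)⁻¹ * dMat a g x * (g x)⁻¹ = (g x)⁻¹ * cMat (leviCivita g) x a +
            (cMat (leviCivita g) x a).transpose * (g x)⁻¹ := by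
          rw [dMat_metric hW hg hx, Matrix.mul_add, Matrix.add_mul]
          congr 1
          · rw [Matrix.mul_assoc, Matrix.mul_assoc, Matrix.mul_nonsing_inv _ hu, Matrix.mul_one]
          · rw [← Matrix.mul_assoc, Matrix.nonsing_inv_mul _ hu, Matrix.one_mul]
        rw [dMat_smul (hFs.diffAt hW hx) ((hgs.inv hg.nondeg).diffAt hW hx),
          dMat_inv hW hgs hg.nondeg hx, h3, hpF, hL x hx, eq_sub_of_add_eq' h2.symm]
        simp only [Matrix.sub_mul, Matrix.mul_sub, Matrix.transpose_sub, Matrix.mul_smul,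
          Matrix.smul_mul]
        module
      rw [covD_eq_matrix, hmat]
      simp only [pureTrace, Matrix.neg_apply, Matrix.smul_apply, Matrix.of_apply, smul_eq_mul,
        Pi.neg_apply, Pi.smul_apply]
      ring
    rw [show covD Γ (fun x => F x • (g x)⁻¹) x = fun a b c =>
      kron a b * (-(F x • (g x)⁻¹.mulVec (Υ x))) c + kron a c * (-(F x • (g x)⁻¹.mulVec (Υ x))) b by
        funext a b c; exact hcov a b c, tracefree_kron]

/-! ### The Weyl tensor and the integrability condition -/

theorem weylOf_symm (R : Fin 3 → Fin 3 → Fin 3 → Fin 3 → ℝ) (a b c : Fin 3) :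
    weylOf R a b c = weylOf R b a c := by
  unfold weylOf
  congr 1
  exact Finset.sum_congr rfl fun d _ => Finset.sum_congr rfl fun e _ => add_comm _ _

theorem weylV_eq (Γ : Christoffel) (vol : Pt → ℝ) (x : Pt) (a b c : Fin 3) :
    weylV Γ vol x a b c = (vol x)⁻¹ * weylOf (curv Γ x) a b c := by
  simp only [weylV, weylOf, Fin.sum_univ_three]
  ring

theorem pencilElt_eq (Γ : Christoffel) (vol : Pt → ℝ) (x : Pt) (T : Mat3) :
    pencilElt Γ vol x T = pencilMat (weylOf (curv Γ x)) (((vol x)⁻¹ * (vol x)⁻¹) • T) := by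
  ext b c
  simp only [pencilElt, pencilMat, weylV_eq, Matrix.of_apply, Fin.sum_univ_three,
    Matrix.smul_apply, smul_eq_mul]
  ring

theorem weylPencil_eq {Γ : Christoffel} {vol : Pt → ℝ} {x : Pt} (h : vol x ≠ 0) :
    weylPencil Γ vol x = pencilSet (weylOf (curv Γ x)) := by
  ext τ
  constructor
  · rintro ⟨T, hT, rfl⟩
    exact ⟨_, hT.smul _, pencilElt_eq Γ vol x T⟩
  · rintro ⟨T, hT, rfl⟩
    refine ⟨(vol x * vol x) • T, hT.smul _, ?_⟩
    rw [pencilElt_eq, smul_smul]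
    congr 1
    rw [show (vol x)⁻¹ * (vol x)⁻¹ * (vol x * vol x) = 1 by field_simp, one_smul]

theorem qVanishesAt_iff {Γ : Christoffel} {vol : Pt → ℝ} {x : Pt} (h : vol x ≠ 0) :
    QVanishesAt Γ vol x ↔ ∀ a b c, qOf (weylOf (curv Γ x)) a b c = 0 := by
  have h1 : ∀ a b c, tensorQ Γ vol x a b c = (vol x)⁻¹ * qOf (weylOf (curv Γ x)) a b c := by
    intro a b c
    have h2 : (vol x)⁻¹ = vol x * ((vol x)⁻¹ * (vol x)⁻¹) := by field_simp
    rw [h2]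
    simp only [tensorQ, qOf, weylV_eq, Finset.mul_sum]
    refine Finset.sum_congr rfl fun p _ => Finset.sum_congr rfl fun q _ =>
      Finset.sum_congr rfl fun r _ => ?_
    ring
  simp only [QVanishesAt, h1, mul_eq_zero, inv_eq_zero, h, false_or]

theorem obstruction_weylOf (R : Fin 3 → Fin 3 → Fin 3 → Fin 3 → ℝ) {H : Mat3} (hH : H.IsSymm)
    (a b c : Fin 3) : obstruction (weylOf R) H a b c = (1 / 2) * ∑ d, ∑ e,
      (lcs d e a * ∑ f, (R d e b f * H f c + H b f * R d e c f) +
        lcs d e b * ∑ f, (R d e c f * H f a + H c f * R d e a f) +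
        lcs d e c * ∑ f, (R d e a f * H f b + H a f * R d e b f)) := by
  have h : ∀ i f, H i f = H f i := fun i f => hH.apply f i
  simp only [h a, h b, h c, obstruction, weylOf, Fin.sum_univ_three]
  ring

theorem sum_lcs_pureTrace (n : Fin 3 → Fin 3 → ℝ) (a b c : Fin 3) : ∑ d, ∑ e,
    (lcs d e a * (pureTrace (n d) e b c - pureTrace (n e) d b c) +
      lcs d e b * (pureTrace (n d) e c a - pureTrace (n e) d c a) +
      lcs d e c * (pureTrace (n d) e a b - pureTrace (n e) d a b)) = 0 := by
  revert a b c
  simp only [pureTrace, Matrix.of_apply, forall_fin_three, Fin.sum_univ_three, kron_values,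
    lcs_012, lcs_120, lcs_201, lcs_021, lcs_210, lcs_102, lcs_aab, lcs_aba, lcs_baa]
  refine ⟨⟨⟨?_, ?_, ?_⟩, ⟨?_, ?_, ?_⟩, ?_, ?_, ?_⟩, ⟨⟨?_, ?_, ?_⟩, ⟨?_, ?_, ?_⟩, ?_, ?_, ?_⟩,
    ⟨?_, ?_, ?_⟩, ⟨?_, ?_, ?_⟩, ?_, ?_, ?_⟩ <;> ring

/-- The curvature endomorphism `R_{ab}` as a matrix, the lower index numbering the rows. -/
noncomputable def curvMat (Γ : Christoffel) (x : Pt) (a b : Fin 3) : Mat3 :=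
  Matrix.of fun d c => curv Γ x a b c d

theorem curvMat_eq (Γ : Christoffel) (x : Pt) (a b : Fin 3) : curvMat Γ x a b =
    dMat a (fun y => cMat Γ y b) x - dMat b (fun y => cMat Γ y a) x +
      cMat Γ x b * cMat Γ x a - cMat Γ x a * cMat Γ x b := by
  ext d c
  simp only [curvMat, curv, dMat, cMat, Matrix.of_apply, Matrix.sub_apply, Matrix.add_apply,
    Matrix.mul_apply, Finset.sum_sub_distrib, mul_comm]
  ring

theorem smoothMat_cMat {W : Set Pt} {Γ : Christoffel} (h : IsTorsionFreeOn W Γ) (a : Fin 3) :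
    SmoothMat W (fun x => cMat Γ x a) := fun d b => h.smooth a d b

theorem contDiffOn_covD {W : Set Pt} (hW : IsOpen W) {Γ : Christoffel} (hΓ : IsTorsionFreeOn W Γ)
    {τ : Pt → Mat3} (h : SmoothMat W τ) (a b c : Fin 3) :
    ContDiffOn ℝ ∞ (fun x => covD Γ τ x a b c) W := by
  unfold covD
  exact (((h b c).pd_of_isOpen hW a).add
    (ContDiffOn.sum fun d _ => (hΓ.smooth a d b).mul (h d c))).add
    (ContDiffOn.sum fun d _ => (hΓ.smooth a d c).mul (h b d))

/-- Commuting derivatives in `∇_a η^{bc} = δ_a^b μ^c + δ_a^c μ^b` shows that the curvature acts on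
`η` through pure trace terms, which the total symmetrisation kills. -/
theorem SolvesMetrisability.obstruction_eq_zero {W : Set Pt} (hW : IsOpen W) {Γ : Christoffel}
    (hΓ : IsTorsionFreeOn W Γ) {η : Pt → Mat3} (h : SolvesMetrisability W Γ η) {x : Pt}
    (hx : x ∈ W) (a b c : Fin 3) : obstruction (weylOf (curv Γ x)) (η x) a b c = 0 := by
  let μ : Pt → Fin 3 → ℝ := fun x c => (1 / 4) * ∑ d, covD Γ η x d c d
  have hμs : ∀ c, ContDiffOn ℝ ∞ (fun x => μ x c) W := fun c =>
    contDiffOn_const.mul (ContDiffOn.sum fun d _ => contDiffOn_covD hW hΓ h.smooth d c d)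
  have hμd : ∀ c, DifferentiableAt ℝ (fun x => μ x c) x := fun c => (hμs c).diffAt hW hx
  have hPs : ∀ a, SmoothMat W (fun x => pureTrace (μ x) a) := fun a b c =>
    (contDiffOn_const.mul (hμs c)).add (contDiffOn_const.mul (hμs b))
  have hPd : ∀ a b, dMat a (fun y => pureTrace (μ y) b) x =
      pureTrace (fun c => pd a (fun y => μ y c) x) b := by
    intro a b
    ext c d
    simp only [dMat, pureTrace, Matrix.of_apply]
    rw [pd_add ((hμd d).const_mul _) ((hμd c).const_mul _), pd_const_mul (hμd d),
      pd_const_mul (hμd c)]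
  have hCs := smoothMat_cMat hΓ
  have hCts : ∀ a, SmoothMat W (fun x => (cMat Γ x a).transpose) := fun a b c => hCs a c b
  have hmul : ∀ {σ τ : Pt → Mat3}, SmoothMat W σ → SmoothMat W τ →
      SmoothMat W (fun x => σ x * τ x) := fun hσ hτ b c => by
    simp only [Matrix.mul_apply]
    exact ContDiffOn.sum fun d _ => (hσ b d).mul (hτ d c)
  have hfirst : ∀ a, dMat a η x = pureTrace (μ x) a -
      ((cMat Γ x a).transpose * η x + η x * cMat Γ x a) := fun a => by
    rw [h.dMat_eq hx, sub_sub]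
  -- The second derivatives of `η`.
  have hsecond : ∀ a b, dMat a (fun y => dMat b η y) x =
      pureTrace (fun c => pd a (fun y => μ y c) x) b -
        ((dMat a (fun y => cMat Γ y b) x).transpose * η x +
          (cMat Γ x b).transpose * dMat a η x +
          (dMat a η x * cMat Γ x b + η x * dMat a (fun y => cMat Γ y b) x)) := by
    intro a b
    have hA := (hmul (hCts b) h.smooth)
    have hB := (hmul h.smooth (hCs b))
    have h1 : dMat a (fun y => dMat b η y) x = dMat a (fun y => pureTrace (μ y) b +
        (-1 : ℝ) • ((cMat Γ y b).transpose * η y + η y * cMat Γ y b)) x :=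
      dMat_congr hW (fun y hy => by rw [h.dMat_eq hy, sub_sub, sub_eq_add_neg, neg_one_smul]) hx a
    have hC : SmoothMat W
        (fun y => (-1 : ℝ) • ((cMat Γ y b).transpose * η y + η y * cMat Γ y b)) :=
      SmoothMat.smul contDiffOn_const (hA.add hB)
    rw [h1, dMat_add ((hPs b).diffAt hW hx) (hC.diffAt hW hx),
      dMat_smul (differentiableAt_const _) ((hA.add hB).diffAt hW hx),
      dMat_add (hA.diffAt hW hx) (hB.diffAt hW hx),
      dMat_mul ((hCts b).diffAt hW hx) (h.smooth.diffAt hW hx),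
      dMat_mul (h.smooth.diffAt hW hx) ((hCs b).diffAt hW hx), hPd, pd_const, zero_smul, zero_add,
      neg_one_smul, ← sub_eq_add_neg]
    rfl
  have hcomm : ∀ a b, dMat a (fun y => dMat b η y) x = dMat b (fun y => dMat a η y) x := by
    intro a b
    ext c d
    exact pd_comm hW (h.smooth c d) hx a b
  let n : Fin 3 → Fin 3 → ℝ := fun a c => pd a (fun y => μ y c) x + ∑ e, Γ x a e c * μ x e
  have hcurv : ∀ a b, (curvMat Γ x a b).transpose * η x + η x * curvMat Γ x a b =
      pureTrace (n a) b - pureTrace (n b) a := by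
    intro a b
    have h1 := hcomm a b
    rw [hsecond, hsecond, hfirst, hfirst] at h1
    have h2 : (curvMat Γ x a b).transpose * η x + η x * curvMat Γ x a b =
        (pureTrace (fun c => pd a (fun y => μ y c) x) b + (cMat Γ x a).transpose *
          pureTrace (μ x) b + pureTrace (μ x) b * cMat Γ x a) -
        (pureTrace (fun c => pd b (fun y => μ y c) x) a + (cMat Γ x b).transpose *
          pureTrace (μ x) a + pureTrace (μ x) a * cMat Γ x b) := by
      rw [curvMat_eq, ← sub_eq_zero]
      rw [← sub_eq_zero] at h1
      rw [← neg_eq_zero, ← h1]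
      simp only [Matrix.transpose_add, Matrix.transpose_sub, Matrix.transpose_mul]
      noncomm_ring
    rw [h2]
    ext c d
    have hs := hΓ.symm x hx
    have key : ∀ a b, (pureTrace (fun c => pd a (fun y => μ y c) x) b + (cMat Γ x a).transpose *
          pureTrace (μ x) b + pureTrace (μ x) b * cMat Γ x a) c d =
        pureTrace (n a) b c d + (Γ x a b c * μ x d + Γ x a b d * μ x c) := by
      intro a b
      simp only [pureTrace, cMat, n, Matrix.add_apply, Matrix.of_apply, Matrix.mul_apply,
        Matrix.transpose_apply]
      revert b
      simp only [forall_fin_three, Fin.sum_univ_three, kron_values]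
      refine ⟨?_, ?_, ?_⟩ <;> ring
    rw [Matrix.sub_apply, key, key, Matrix.sub_apply, hs a b, hs a b]
    ring
  have hent : ∀ d e b c, ∑ f, (curv Γ x d e b f * η x f c + η x b f * curv Γ x d e c f) =
      pureTrace (n d) e b c - pureTrace (n e) d b c := by
    intro d e b c
    have := congrFun (congrFun (hcurv d e) b) c
    simp only [Matrix.add_apply, Matrix.mul_apply, Matrix.transpose_apply, curvMat,
      Matrix.of_apply, Matrix.sub_apply] at this
    rw [Finset.sum_add_distrib, this]
  rw [obstruction_weylOf _ (h.symm x hx)]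
  simp only [hent, sum_lcs_pureTrace, mul_zero]

theorem curv_trace_eq_zero {W : Set Pt} (hW : IsOpen W) {Γ : Christoffel} {vol : Pt → ℝ}
    (hΓ : IsTorsionFreeOn W Γ) (hvol : IsVolumeOn W vol) (hp : PreservesVolumeOn W Γ vol)
    {x : Pt} (hx : x ∈ W) (a b : Fin 3) : ∑ c, curv Γ x a b c c = 0 := by
  have hts : ∀ b, ContDiffOn ℝ ∞ (fun y => ∑ c, Γ y b c c) W := fun b =>
    ContDiffOn.sum fun c _ => hΓ.smooth b c c
  have hd : ∀ a b, pd a (fun y => ∑ c, Γ y b c c) x = ∑ c, pd a (fun y => Γ y b c c) x :=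
    fun a b => pd_sum _ (fun c _ => (hΓ.smooth b c c).diffAt hW hx) a
  -- The trace of the connection is the logarithmic derivative of `vol`, hence closed.
  have hclosed : ∀ a b, pd a (pd b vol) x = (∑ c, pd a (fun y => Γ y b c c) x) * vol x +
      (∑ c, Γ x b c c) * ((∑ c, Γ x a c c) * vol x) := by
    intro a b
    rw [pd_congr_of_eqOn hW (g := fun y => (∑ c, Γ y b c c) * vol y)
      (fun y hy => by have := hp y hy b; linarith) hx a,
      pd_mul ((hts b).diffAt hW hx) (hvol.smooth.diffAt hW hx), hd,
      show pd a vol x = (∑ c, Γ x a c c) * vol x by have := hp x hx a; linarith]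
  have h1 := pd_comm hW hvol.smooth hx a b
  rw [hclosed, hclosed] at h1
  have h2 : ∑ c, pd a (fun y => Γ y b c c) x = ∑ c, pd b (fun y => Γ y a c c) x :=
    mul_right_cancel₀ (hvol.ne_zero x hx) (by linear_combination h1)
  simp only [curv, Finset.sum_add_distrib, Finset.sum_sub_distrib]
  rw [h2, sub_self, zero_add, sub_eq_zero, Finset.sum_comm]
  exact Finset.sum_congr rfl fun c _ => Finset.sum_congr rfl fun e _ => mul_comm _ _

theorem weylOf_trace_eq_zero {W : Set Pt} (hW : IsOpen W) {Γ : Christoffel} {vol : Pt → ℝ}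
    (hΓ : IsTorsionFreeOn W Γ) (hvol : IsVolumeOn W vol) (hp : PreservesVolumeOn W Γ vol)
    {x : Pt} (hx : x ∈ W) (a : Fin 3) : ∑ b, weylOf (curv Γ x) a b b = 0 := by
  have h1 : ∑ b, weylOf (curv Γ x) a b b = (1 / 2) * (∑ d, ∑ e, lcs d e a *
      (∑ b, curv Γ x d e b b) + ∑ b, ∑ d, ∑ e, lcs d e b * curv Γ x d e a b) := by
    simp only [weylOf, Fin.sum_univ_three]; ring
  have hd : ∀ d a b c, pd d (fun y => Γ y a b c) x = pd d (fun y => Γ y b a c) x :=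
    fun d a b c => pd_congr_of_eqOn hW (fun y hy => hΓ.symm y hy a b c) hx d
  have hbianchi : ∑ b, ∑ d, ∑ e, lcs d e b * curv Γ x d e a b = 0 := by
    simp only [curv, Fin.sum_univ_three, lcs_012, lcs_120, lcs_201, lcs_021, lcs_210, lcs_102,
      lcs_aab, lcs_aba, lcs_baa, hΓ.symm x hx 1 0, hΓ.symm x hx 2 0, hΓ.symm x hx 2 1,
      hd _ 1 0, hd _ 2 0, hd _ 2 1]
    ring
  rw [h1, hbianchi]
  simp only [curv_trace_eq_zero hW hΓ hvol hp hx, mul_zero, Finset.sum_const_zero, add_zero]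

/-! ### Necessary conditions for metrisability -/

theorem MetrisableOn.mono {U W : Set Pt} {Γ : Christoffel} (h : MetrisableOn U Γ) (hs : W ⊆ U) :
    MetrisableOn W Γ := by
  obtain ⟨g, hg, hp⟩ := h
  exact ⟨g, hg.mono hs, fun s t γ hγ => hp s t γ fun r hr => hs (hγ r hr)⟩

theorem IsVolumeOn.mono {U W : Set Pt} {vol : Pt → ℝ} (h : IsVolumeOn U vol) (hs : W ⊆ U) :
    IsVolumeOn W vol := ⟨h.smooth.mono hs, fun x hx => h.ne_zero x (hs hx)⟩

theorem PreservesVolumeOn.mono {U W : Set Pt} {Γ : Christoffel} {vol : Pt → ℝ}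
    (h : PreservesVolumeOn U Γ vol) (hs : W ⊆ U) : PreservesVolumeOn W Γ vol :=
  fun x hx => h x (hs hx)

theorem MetrisableNear.exists_solvesMetrisability {U : Set Pt} {Γ : Christoffel} {vol : Pt → ℝ}
    (hU : IsOpen U) (hΓ : IsTorsionFreeOn U Γ) (hvol : IsVolumeOn U vol)
    (hp : PreservesVolumeOn U Γ vol) {p : Pt} (hpU : p ∈ U) (h : MetrisableNear Γ p) :
    ∃ W, IsOpen W ∧ p ∈ W ∧ W ⊆ U ∧ MetrisableOn W Γ ∧ ∃ η, SolvesMetrisability W Γ η := by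
  obtain ⟨W, hW, hpW, hm⟩ := h
  have hs : W ∩ U ⊆ U := inter_subset_right
  have hm' := hm.mono (inter_subset_left : W ∩ U ⊆ W)
  exact ⟨W ∩ U, hW.inter hU, ⟨hpW, hpU⟩, hs, hm', hm'.exists_solvesMetrisability (hW.inter hU)
    (hΓ.mono hs) (hvol.mono hs) (hp.mono hs)⟩

theorem SolvesMetrisability.qVanishesAt {W : Set Pt} (hW : IsOpen W) {Γ : Christoffel}
    {vol : Pt → ℝ} (hΓ : IsTorsionFreeOn W Γ) (hvol : IsVolumeOn W vol)
    (hp : PreservesVolumeOn W Γ vol) {η : Pt → Mat3} (h : SolvesMetrisability W Γ η) {x : Pt}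
    (hx : x ∈ W) : QVanishesAt Γ vol x :=
  (qVanishesAt_iff (hvol.ne_zero x hx)).2 (qOf_eq_zero_of_obstruction (weylOf_symm _)
    (weylOf_trace_eq_zero hW hΓ hvol hp hx) (h.symm x hx) (h.nondeg x hx)
    (h.obstruction_eq_zero hW hΓ hx))

theorem SolvesMetrisability.mem_weylPencil {W : Set Pt} (hW : IsOpen W) {Γ : Christoffel}
    {vol : Pt → ℝ} (hΓ : IsTorsionFreeOn W Γ) (hvol : IsVolumeOn W vol)
    (hp : PreservesVolumeOn W Γ vol) {η : Pt → Mat3} (h : SolvesMetrisability W Γ η) {x : Pt}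
    (hx : x ∈ W) (hV : ∃ a b c, weylOf (curv Γ x) a b c ≠ 0) : η x ∈ weylPencil Γ vol x := by
  obtain ⟨Φ, -, -, he⟩ := pencilSet_eq_of_obstruction (weylOf_symm _)
    (weylOf_trace_eq_zero hW hΓ hvol hp hx) (h.symm x hx) (h.nondeg x hx)
    (h.obstruction_eq_zero hW hΓ hx) hV
  rw [weylPencil_eq (hvol.ne_zero x hx), he]
  exact ⟨0, 1, by simp⟩

theorem MetrisableNear.eventually_qVanishesAt {U : Set Pt} {Γ : Christoffel} {vol : Pt → ℝ}
    (hU : IsOpen U) (hΓ : IsTorsionFreeOn U Γ) (hvol : IsVolumeOn U vol)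
    (hp : PreservesVolumeOn U Γ vol) {p : Pt} (hpU : p ∈ U) (h : MetrisableNear Γ p) :
    ∀ᶠ x in 𝓝 p, QVanishesAt Γ vol x := by
  obtain ⟨W, hW, hpW, hs, -, η, hη⟩ := h.exists_solvesMetrisability hU hΓ hvol hp hpU
  filter_upwards [hW.mem_nhds hpW] with x hx
  exact hη.qVanishesAt hW (hΓ.mono hs) (hvol.mono hs) (hp.mono hs) hx

theorem MetrisableNear.isNonsingularPencil {U : Set Pt} {Γ : Christoffel} {vol : Pt → ℝ}
    (hU : IsOpen U) (hΓ : IsTorsionFreeOn U Γ) (hvol : IsVolumeOn U vol)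
    (hp : PreservesVolumeOn U Γ vol) {p : Pt} (hpU : p ∈ U) (h : MetrisableNear Γ p)
    (hV : ∃ a b c, weylV Γ vol p a b c ≠ 0) : IsNonsingularPencil (weylPencil Γ vol p) := by
  obtain ⟨W, hW, hpW, hs, -, η, hη⟩ := h.exists_solvesMetrisability hU hΓ hvol hp hpU
  obtain ⟨a, b, c, hne⟩ := hV
  rw [weylV_eq] at hne
  exact ⟨η p, hη.mem_weylPencil hW (hΓ.mono hs) (hvol.mono hs) (hp.mono hs) hpW
    ⟨a, b, c, right_ne_zero_of_mul hne⟩, hη.nondeg p hpW⟩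

/-! ### The test functional -/

theorem tracefree_add (S S' : Fin 3 → Fin 3 → Fin 3 → ℝ) (a b c : Fin 3) :
    tracefree (fun a b c => S a b c + S' a b c) a b c = tracefree S a b c + tracefree S' a b c := by
  simp only [tracefree, Fin.sum_univ_three]; ring

theorem tracefree_smul (r : ℝ) (S : Fin 3 → Fin 3 → Fin 3 → ℝ) (a b c : Fin 3) :
    tracefree (fun a b c => r * S a b c) a b c = r * tracefree S a b c := by
  simp only [tracefree, Fin.sum_univ_three]; ring

/-- The functional `S ↦ (ξ^d ξ_d σ_{bc} - 5 ξ_b ξ_c) ξ^a (S_a{}^{bc})_∘` at a point. -/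
noncomputable def testOf (σ : Mat3) (ξ : Fin 3 → ℝ) (S : Fin 3 → Fin 3 → Fin 3 → ℝ) : ℝ :=
  ∑ a, ∑ b, ∑ c, ((∑ d, (∑ e, σ d e * ξ e) * ξ d) * σ⁻¹ b c - 5 * ξ b * ξ c) *
    (∑ e, σ a e * ξ e) * tracefree S a b c

theorem scaleTest_eq (Γ : Christoffel) (σ : Pt → Mat3) (ξ : Pt → Fin 3 → ℝ) (τ : Pt → Mat3)
    (x : Pt) : scaleTest Γ σ ξ τ x = testOf (σ x) (ξ x) (covD Γ τ x) := rfl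

theorem testOf_add (σ : Mat3) (ξ : Fin 3 → ℝ) (S S' : Fin 3 → Fin 3 → Fin 3 → ℝ) :
    testOf σ ξ (fun a b c => S a b c + S' a b c) = testOf σ ξ S + testOf σ ξ S' := by
  simp only [testOf, tracefree_add, mul_add, Finset.sum_add_distrib]

theorem testOf_smul (σ : Mat3) (ξ : Fin 3 → ℝ) (r : ℝ) (S : Fin 3 → Fin 3 → Fin 3 → ℝ) :
    testOf σ ξ (fun a b c => r * S a b c) = r * testOf σ ξ S := by
  simp only [testOf, tracefree_smul, Finset.mul_sum]
  refine Finset.sum_congr rfl fun a _ => Finset.sum_congr rfl fun b _ =>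
    Finset.sum_congr rfl fun c _ => ?_
  ring

theorem testOf_eq {σ : Mat3} (hσ : σ.IsSymm) (h0 : σ.det ≠ 0) (ξ : Fin 3 → ℝ)
    (S : Fin 3 → Fin 3 → Fin 3 → ℝ) : testOf σ ξ S =
      ∑ a, σ.mulVec ξ a * ((∑ d, σ.mulVec ξ d * ξ d) * (∑ b, ∑ c, σ⁻¹ b c * S a b c) -
        5 * ∑ b, ∑ c, ξ b * ξ c * S a b c) +
      2 * (∑ d, σ.mulVec ξ d * ξ d) * ∑ c, ξ c * ∑ d, S d c d := by
  have hu : ∀ a, ∑ e, σ a e * ξ e = σ.mulVec ξ a := fun a => rfl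
  have hG : ∀ c, ∑ a, σ⁻¹ c a * σ.mulVec ξ a = ξ c := by
    intro c
    have : σ⁻¹.mulVec (σ.mulVec ξ) = ξ := by
      rw [Matrix.mulVec_mulVec, Matrix.nonsing_inv_mul _ h0.isUnit, Matrix.one_mulVec]
    exact congrFun this c
  obtain ⟨g1, g2, g3⟩ := isSymm_entries (isSymm_inv hσ)
  simp only [testOf, hu]
  generalize σ.mulVec ξ = u at *
  generalize σ⁻¹ = G at *
  have e0 := hG 0
  have e1 := hG 1
  have e2 := hG 2
  simp only [Fin.sum_univ_three, g1, g2, g3] at e0 e1 e2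
  simp only [tracefree, Fin.sum_univ_three, kron_values, g1, g2, g3]
  linear_combination (-(1 / 2) * (u 0 * ξ 0 + u 1 * ξ 1 + u 2 * ξ 2)) *
    ((S 0 0 0 + S 1 0 1 + S 2 0 2) * e0 + (S 0 1 0 + S 1 1 1 + S 2 1 2) * e1 +
      (S 0 2 0 + S 1 2 1 + S 2 2 2) * e2)

theorem sum_inv_mul_self {σ : Mat3} (hσ : σ.IsSymm) (h0 : σ.det ≠ 0) :
    ∑ b, ∑ c, σ⁻¹ b c * σ b c = 3 := by
  have : ∀ b, ∑ c, σ⁻¹ b c * σ b c = 1 := by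
    intro b
    have h := congrFun (congrFun (Matrix.nonsing_inv_mul _ h0.isUnit) b) b
    rw [Matrix.mul_apply, Matrix.one_apply_eq] at h
    rw [← h]
    exact Finset.sum_congr rfl fun c _ => by rw [hσ.apply c b]
  simp [this]

/-- The test functional annihilates the trace-free part of every `α_a σ^{bc}`. -/
theorem testOf_mul_self {σ : Mat3} (hσ : σ.IsSymm) (h0 : σ.det ≠ 0) (ξ α : Fin 3 → ℝ) :
    testOf σ ξ (fun a b c => α a * σ b c) = 0 := by
  rw [testOf_eq hσ h0]
  have h1 : ∀ a, ∑ b, ∑ c, σ⁻¹ b c * (α a * σ b c) = α a * 3 := by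
    intro a
    rw [← sum_inv_mul_self hσ h0]
    simp only [Fin.sum_univ_three]; ring
  obtain ⟨g1, g2, g3⟩ := isSymm_entries hσ
  simp only [h1]
  simp only [Fin.sum_univ_three, Matrix.mulVec, dotProduct, g1, g2, g3]
  ring

/-- The test functional annihilates the trace-free part of every `α_a ρ^{bc}` for which
`σ_{bc} ρ^{bc} = 0` and `ρ^{bc} ξ_b = 0`. -/
theorem testOf_mul_kernel {σ ρ : Mat3} (hσ : σ.IsSymm) (h0 : σ.det ≠ 0)
    {ξ : Fin 3 → ℝ} (htr : ∑ b, ∑ c, σ⁻¹ b c * ρ b c = 0) (hk : ∀ c, ∑ b, ρ b c * ξ b = 0)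
    (α : Fin 3 → ℝ) : testOf σ ξ (fun a b c => α a * ρ b c) = 0 := by
  rw [testOf_eq hσ h0]
  have h1 : ∀ a, ∑ b, ∑ c, σ⁻¹ b c * (α a * ρ b c) = 0 := by
    intro a
    rw [← mul_zero (α a), ← htr]
    simp only [Fin.sum_univ_three]; ring
  have h2 : ∀ a, ∑ b, ∑ c, ξ b * ξ c * (α a * ρ b c) = 0 := by
    intro a
    have : ∑ b, ∑ c, ξ b * ξ c * (α a * ρ b c) = α a * ∑ c, ξ c * ∑ b, ρ b c * ξ b := by
      simp only [Fin.sum_univ_three]; ring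
    rw [this]
    simp only [hk, mul_zero, Finset.sum_const_zero]
  have h3 : ∑ c, ξ c * ∑ d, α d * ρ c d = 0 := by
    have : ∑ c, ξ c * ∑ d, α d * ρ c d = ∑ d, α d * ∑ b, ρ b d * ξ b := by
      simp only [Fin.sum_univ_three]; ring
    rw [this]
    simp only [hk, mul_zero, Finset.sum_const_zero]
  simp only [h1, h2, h3, mul_zero, sub_zero, Finset.sum_const_zero, add_zero]

theorem covD_smul {Γ : Christoffel} {f : Pt → ℝ} {τ : Pt → Mat3} {x : Pt}
    (hf : DifferentiableAt ℝ f x) (hτ : ∀ b c, DifferentiableAt ℝ (fun y => τ y b c) x)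
    (a b c : Fin 3) : covD Γ (fun y => f y • τ y) x a b c =
      pd a f x * τ x b c + f x * covD Γ τ x a b c := by
  rw [covD_eq_matrix, covD_eq_matrix, dMat_smul hf hτ]
  simp only [Matrix.add_apply, Matrix.smul_apply, smul_eq_mul, Matrix.mul_smul, Matrix.smul_mul]
  ring

theorem covD_add {Γ : Christoffel} {τ τ' : Pt → Mat3} {x : Pt}
    (hτ : ∀ b c, DifferentiableAt ℝ (fun y => τ y b c) x)
    (hτ' : ∀ b c, DifferentiableAt ℝ (fun y => τ' y b c) x) (a b c : Fin 3) :
    covD Γ (fun y => τ y + τ' y) x a b c = covD Γ τ x a b c + covD Γ τ' x a b c := by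
  rw [covD_eq_matrix, covD_eq_matrix, covD_eq_matrix, dMat_add hτ hτ']
  simp only [Matrix.add_apply, Matrix.mul_add, Matrix.add_mul]
  ring

theorem covD_congr {Γ : Christoffel} {W : Set Pt} (hW : IsOpen W) {τ τ' : Pt → Mat3}
    (h : ∀ y ∈ W, τ y = τ' y) {x : Pt} (hx : x ∈ W) : covD Γ τ x = covD Γ τ' x := by
  funext a b c
  rw [covD_eq_matrix, covD_eq_matrix, dMat_congr hW h hx, h x hx]

theorem pencilMat_isSymm (V : Fin 3 → Fin 3 → Fin 3 → ℝ) (T : Mat3) : (pencilMat V T).IsSymm := by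
  apply Matrix.IsSymm.ext
  intro i j
  simp only [pencilMat, Matrix.of_apply]
  congr 1
  exact Finset.sum_congr rfl fun a _ => Finset.sum_congr rfl fun b _ =>
    Finset.sum_congr rfl fun c _ => add_comm _ _

theorem isSymm_of_mem_weylPencil {Γ : Christoffel} {vol : Pt → ℝ} {x : Pt} {τ : Mat3}
    (h : τ ∈ weylPencil Γ vol x) : τ.IsSymm := by
  obtain ⟨T, -, rfl⟩ := h
  rw [pencilElt_eq]
  exact pencilMat_isSymm _ _

namespace IsNormalFormOn

variable {Γ : Christoffel} {vol : Pt → ℝ} {W : Set Pt} {ρ σ : Pt → Mat3} {ξ : Pt → Fin 3 → ℝ}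

theorem mono (h : IsNormalFormOn Γ vol W ρ σ ξ) {W' : Set Pt} (hs : W' ⊆ W) :
    IsNormalFormOn Γ vol W' ρ σ ξ where
  smooth_rho b c := (h.smooth_rho b c).mono hs
  smooth_sigma b c := (h.smooth_sigma b c).mono hs
  smooth_xi b := (h.smooth_xi b).mono hs
  pencil_eq x hx := h.pencil_eq x (hs hx)
  linInd x hx := h.linInd x (hs hx)
  invertible x hx := h.invertible x (hs hx)
  trace_zero x hx := h.trace_zero x (hs hx)
  kernel x hx := h.kernel x (hs hx)
  xi_ne x hx := h.xi_ne x (hs hx)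

theorem isSymm_rho (h : IsNormalFormOn Γ vol W ρ σ ξ) {x : Pt} (hx : x ∈ W) : (ρ x).IsSymm :=
  isSymm_of_mem_weylPencil (by rw [h.pencil_eq x hx]; exact ⟨1, 0, by simp⟩)

theorem isSymm_sigma (h : IsNormalFormOn Γ vol W ρ σ ξ) {x : Pt} (hx : x ∈ W) : (σ x).IsSymm :=
  isSymm_of_mem_weylPencil (by rw [h.pencil_eq x hx]; exact ⟨0, 1, by simp⟩)

theorem rho_ne_zero (h : IsNormalFormOn Γ vol W ρ σ ξ) {x : Pt} (hx : x ∈ W) : ρ x ≠ 0 :=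
  (h.linInd x hx).ne_zero 0

theorem det_rho (h : IsNormalFormOn Γ vol W ρ σ ξ) {x : Pt} (hx : x ∈ W) : (ρ x).det = 0 :=
  Matrix.exists_vecMul_eq_zero_iff.1 ⟨ξ x, h.xi_ne x hx, by
    funext c
    rw [Matrix.vecMul, dotProduct, Pi.zero_apply, ← h.kernel x hx c]
    exact Finset.sum_congr rfl fun b _ => mul_comm _ _⟩

theorem weyl_ne_zero (h : IsNormalFormOn Γ vol W ρ σ ξ) {x : Pt} (hx : x ∈ W) :
    ∃ a b c, weylOf (curv Γ x) a b c ≠ 0 := by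
  by_contra! h0
  have hmem : ρ x ∈ weylPencil Γ vol x := by rw [h.pencil_eq x hx]; exact ⟨1, 0, by simp⟩
  obtain ⟨T, -, hT⟩ := hmem
  apply h.rho_ne_zero hx
  rw [hT, pencilElt_eq]
  ext b c
  simp [pencilMat, h0]

/-- A smooth section of the Weyl pencil has smooth components in a normal form. -/
theorem exists_components (h : IsNormalFormOn Γ vol W ρ σ ξ) {τ : Pt → Mat3}
    (hτ : SmoothMat W τ) (hmem : ∀ x ∈ W, τ x ∈ weylPencil Γ vol x) :
    ∃ f k : Pt → ℝ, ContDiffOn ℝ ∞ f W ∧ ContDiffOn ℝ ∞ k W ∧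
      ∀ x ∈ W, τ x = f x • ρ x + k x • σ x := by
  have hρs : SmoothMat W ρ := h.smooth_rho
  have hσs : SmoothMat W σ := h.smooth_sigma
  have hc : ∀ {A B : Pt → Mat3}, SmoothMat W A → SmoothMat W B →
      ContDiffOn ℝ ∞ (fun x => contr (A x) (B x)) W := fun hA hB =>
    ContDiffOn.sum fun a _ => ContDiffOn.sum fun b _ => (hA a b).mul (hB a b)
  let k : Pt → ℝ := fun x => (1 / 3) * contr (σ x)⁻¹ (τ x)
  have hk : ContDiffOn ℝ ∞ k W := contDiffOn_const.mul (hc (hσs.inv h.invertible) hτ)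
  let f : Pt → ℝ := fun x => contr (ρ x) (τ x - k x • σ x) / contr (ρ x) (ρ x)
  have hne : ∀ x ∈ W, contr (ρ x) (ρ x) ≠ 0 := fun x hx h0 =>
    h.rho_ne_zero hx (contr_self_eq_zero h0)
  refine ⟨f, k, (hc hρs (hτ.sub (hσs.smul hk))).div (hc hρs hρs) hne, hk, fun x hx => ?_⟩
  have hlin : ∀ (s t : ℝ) (A B C : Mat3),
      contr C (s • A + t • B) = s * contr C A + t * contr C B := by
    intro x y A B C
    simp only [contr, Fin.sum_univ_three, Matrix.add_apply, Matrix.smul_apply, smul_eq_mul]; ring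
  have hm := hmem x hx
  rw [h.pencil_eq x hx] at hm
  obtain ⟨s, t, hst⟩ := hm
  have hkt : k x = t := by
    have h1 : contr (σ x)⁻¹ (ρ x) = 0 := h.trace_zero x hx
    have h2 : contr (σ x)⁻¹ (σ x) = 3 := sum_inv_mul_self (h.isSymm_sigma hx) (h.invertible x hx)
    simp only [k, hst, hlin, h1, h2]; ring
  have hfs : f x = s := by
    simp only [f]
    rw [hkt, hst, add_sub_cancel_right, ← add_zero (s • ρ x), ← zero_smul ℝ (0 : Mat3), hlin,
      zero_mul, add_zero, mul_div_cancel_right₀ _ (hne x hx)]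
  rw [hkt, hfs, hst]

/-- On a section `f ρ + k σ` of the Weyl pencil the test function is `f φ + k ψ`, derivatives of the
components dropping out. -/
theorem scaleTest_section (hW : IsOpen W) (h : IsNormalFormOn Γ vol W ρ σ ξ) {τ : Pt → Mat3}
    {f k : Pt → ℝ} (hf : ContDiffOn ℝ ∞ f W) (hk : ContDiffOn ℝ ∞ k W)
    (hτ : ∀ x ∈ W, τ x = f x • ρ x + k x • σ x) {x : Pt} (hx : x ∈ W) :
    scaleTest Γ σ ξ τ x = f x * phiFn Γ ρ σ ξ x + k x * psiFn Γ ρ σ ξ x := by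
  have hρs : SmoothMat W ρ := h.smooth_rho
  have hσs : SmoothMat W σ := h.smooth_sigma
  have hcov : covD Γ τ x = fun a b c => (pd a f x * ρ x b c + f x * covD Γ ρ x a b c) +
      (pd a k x * σ x b c + k x * covD Γ σ x a b c) := by
    rw [covD_congr hW hτ hx]
    funext a b c
    rw [covD_add ((hρs.smul hf).diffAt hW hx) ((hσs.smul hk).diffAt hW hx),
      covD_smul (hf.diffAt hW hx) (hρs.diffAt hW hx), covD_smul (hk.diffAt hW hx)
      (hσs.diffAt hW hx)]
  rw [scaleTest_eq, hcov, testOf_add, testOf_add, testOf_add, testOf_smul, testOf_smul,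
    testOf_mul_self (h.isSymm_sigma hx) (h.invertible x hx),
    testOf_mul_kernel (h.isSymm_sigma hx) (h.invertible x hx)
      (h.trace_zero x hx) (h.kernel x hx), zero_add, zero_add]
  rfl

end IsNormalFormOn

/-! ### The algorithm decides metrisability -/

theorem sum_inv_mul_tracefree {τ : Mat3} (hτ : τ.IsSymm) (h0 : τ.det ≠ 0) (β : Fin 3 → ℝ)
    (a : Fin 3) : ∑ b, ∑ c, τ⁻¹ b c * tracefree (fun a b c => β a * τ b c) a b c =
      (5 / 2) * β a := by
  have h1 : ∀ c, ∑ b, τ⁻¹ a b * τ b c = kron a c := by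
    intro c
    have := congrFun (congrFun (Matrix.nonsing_inv_mul _ h0.isUnit) a) c
    simpa only [Matrix.mul_apply, Matrix.one_apply, kron] using this
  have hG : ∀ b, τ⁻¹ b a = τ⁻¹ a b := fun b => (isSymm_inv hτ).apply a b
  have h2 : ∑ b, ∑ c, τ⁻¹ b c * tracefree (fun a b c => β a * τ b c) a b c =
      β a * (∑ b, ∑ c, τ⁻¹ b c * τ b c) -
        (1 / 4) * (∑ c, τ⁻¹ a c * ∑ d, β d * τ c d + ∑ b, τ⁻¹ b a * ∑ d, β d * τ b d) := by
    simp only [tracefree]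
    clear h1 hG
    revert a
    simp only [forall_fin_three, Fin.sum_univ_three, kron_values]
    refine ⟨?_, ?_, ?_⟩ <;> ring
  have h3 : ∑ c, τ⁻¹ a c * ∑ d, β d * τ c d = ∑ d, β d * ∑ b, τ⁻¹ a b * τ b d := by
    simp only [Fin.sum_univ_three]; ring
  have h4 : ∑ d, β d * kron a d = β a := by simp [kron]
  rw [h2, sum_inv_mul_self hτ h0]
  simp only [hG, h3, h1, h4]
  ring

theorem contDiffOn_tracefree {E : Type*} [NormedAddCommGroup E] [NormedSpace ℝ E] {W : Set E}
    {S : E → Fin 3 → Fin 3 → Fin 3 → ℝ} (hS : ∀ a b c, ContDiffOn ℝ ∞ (fun x => S x a b c) W)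
    (a b c : Fin 3) : ContDiffOn ℝ ∞ (fun x => tracefree (S x) a b c) W :=
  (hS a b c).sub (contDiffOn_const.mul
    ((contDiffOn_const.mul (ContDiffOn.sum fun d _ => hS d c d)).add
      (contDiffOn_const.mul (ContDiffOn.sum fun d _ => hS d b d))))

theorem contDiffOn_testOf {E : Type*} [NormedAddCommGroup E] [NormedSpace ℝ E] {W : Set E}
    {σ : E → Mat3} {ξ : E → Fin 3 → ℝ} {S : E → Fin 3 → Fin 3 → Fin 3 → ℝ} (hσ : SmoothMat W σ)
    (h0 : ∀ x ∈ W, (σ x).det ≠ 0) (hξ : ∀ a, ContDiffOn ℝ ∞ (fun x => ξ x a) W)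
    (hS : ∀ a b c, ContDiffOn ℝ ∞ (fun x => S x a b c) W) :
    ContDiffOn ℝ ∞ (fun x => testOf (σ x) (ξ x) (S x)) W := by
  have hr : ∀ a, ContDiffOn ℝ ∞ (fun x => ∑ e, σ x a e * ξ x e) W := fun a =>
    ContDiffOn.sum fun b _ => (hσ a b).mul (hξ b)
  refine ContDiffOn.sum fun a _ => ContDiffOn.sum fun b _ => ContDiffOn.sum fun c _ => ?_
  exact ((((ContDiffOn.sum fun d _ => (hr d).mul (hξ d)).mul (hσ.inv h0 b c)).sub
    ((contDiffOn_const.mul (hξ b)).mul (hξ c))).mul (hr a)).mul (contDiffOn_tracefree hS a b c)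

section

variable {Γ : Christoffel} {vol : Pt → ℝ} {W : Set Pt} {ρ σ : Pt → Mat3} {ξ : Pt → Fin 3 → ℝ}

theorem contDiffOn_scaleTest (hW : IsOpen W) (hΓ : IsTorsionFreeOn W Γ)
    (h : IsNormalFormOn Γ vol W ρ σ ξ) {τ : Pt → Mat3} (hτ : SmoothMat W τ) :
    ContDiffOn ℝ ∞ (scaleTest Γ σ ξ τ) W :=
  contDiffOn_testOf h.smooth_sigma h.invertible h.smooth_xi (contDiffOn_covD hW hΓ hτ)

theorem contDiffOn_phiFn (hW : IsOpen W) (hΓ : IsTorsionFreeOn W Γ)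
    (h : IsNormalFormOn Γ vol W ρ σ ξ) : ContDiffOn ℝ ∞ (phiFn Γ ρ σ ξ) W :=
  contDiffOn_scaleTest hW hΓ h h.smooth_rho

theorem contDiffOn_psiFn (hW : IsOpen W) (hΓ : IsTorsionFreeOn W Γ)
    (h : IsNormalFormOn Γ vol W ρ σ ξ) : ContDiffOn ℝ ∞ (psiFn Γ ρ σ ξ) W :=
  contDiffOn_scaleTest hW hΓ h h.smooth_sigma

theorem smoothMat_candidate (hW : IsOpen W) (hΓ : IsTorsionFreeOn W Γ)
    (h : IsNormalFormOn Γ vol W ρ σ ξ) (hφ : ∀ x ∈ W, phiFn Γ ρ σ ξ x ≠ 0) :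
    SmoothMat W (candidate Γ ρ σ ξ) :=
  SmoothMat.sub h.smooth_sigma (SmoothMat.smul ((contDiffOn_psiFn hW hΓ h).div
    (contDiffOn_phiFn hW hΓ h) hφ) h.smooth_rho)

theorem isSymm_candidate (h : IsNormalFormOn Γ vol W ρ σ ξ) {x : Pt} (hx : x ∈ W) :
    (candidate Γ ρ σ ξ x).IsSymm := (h.isSymm_sigma hx).sub ((h.isSymm_rho hx).smul _)

theorem contDiffOn_omegaForm (hW : IsOpen W) (hΓ : IsTorsionFreeOn W Γ) {τ : Pt → Mat3}
    (hτ : SmoothMat W τ) (h0 : ∀ x ∈ W, (τ x).det ≠ 0) (a : Fin 3) :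
    ContDiffOn ℝ ∞ (fun x => omegaForm Γ τ x a) W :=
  ContDiffOn.sum fun b _ => ContDiffOn.sum fun c _ => (hτ.inv h0 b c).mul
    (contDiffOn_tracefree (contDiffOn_covD hW hΓ hτ) a b c)

/-- A solution of the metrisability equation is a section `f ρ + k σ` of the Weyl pencil, so that
`f φ + k ψ = 0` where `k ≠ 0`. Hence `φ ≠ 0` and the candidate is `k⁻¹` times the solution. -/
theorem IsNormalFormOn.algorithmAcceptsOn (hW : IsOpen W) (hΓ : IsTorsionFreeOn W Γ)
    (hvol : IsVolumeOn W vol) (hp : PreservesVolumeOn W Γ vol)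
    (h : IsNormalFormOn Γ vol W ρ σ ξ)
    (hne : ∀ x ∈ W, phiFn Γ ρ σ ξ x ≠ 0 ∨ psiFn Γ ρ σ ξ x ≠ 0) (hm : MetrisableOn W Γ) :
    AlgorithmAcceptsOn Γ ρ σ ξ W := by
  obtain ⟨η, hη⟩ := hm.exists_solvesMetrisability hW hΓ hvol hp
  obtain ⟨f, k, hf, hk, hfk⟩ := h.exists_components hη.smooth
    fun x hx => hη.mem_weylPencil hW hΓ hvol hp hx (h.weyl_ne_zero hx)
  have hk0 : ∀ x ∈ W, k x ≠ 0 := by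
    intro x hx h0
    apply hη.nondeg x hx
    rw [hfk x hx, h0, zero_smul, add_zero, Matrix.det_smul, h.det_rho hx, mul_zero]
  have htest : ∀ x ∈ W, f x * phiFn Γ ρ σ ξ x + k x * psiFn Γ ρ σ ξ x = 0 := by
    intro x hx
    rw [← h.scaleTest_section hW hf hk hfk hx]
    simp only [scaleTest, hη.eq x hx, mul_zero, Finset.sum_const_zero]
  have hφ : ∀ x ∈ W, phiFn Γ ρ σ ξ x ≠ 0 := by
    intro x hx h0
    have h1 := htest x hx
    rw [h0, mul_zero, zero_add, mul_eq_zero, or_iff_right (hk0 x hx)] at h1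
    exact (hne x hx).elim (fun h2 => h2 h0) fun h2 => h2 h1
  have hcand : ∀ x ∈ W, candidate Γ ρ σ ξ x = (k x)⁻¹ • η x := by
    intro x hx
    have h1 := htest x hx
    have h2 : psiFn Γ ρ σ ξ x / phiFn Γ ρ σ ξ x = -((k x)⁻¹ * f x) := by
      have := hφ x hx
      have := hk0 x hx
      field_simp
      linear_combination h1
    rw [candidate, h2, hfk x hx, smul_add, smul_smul, smul_smul, inv_mul_cancel₀ (hk0 x hx)]
    module
  have hdet : ∀ x ∈ W, (candidate Γ ρ σ ξ x).det ≠ 0 := by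
    intro x hx
    rw [hcand x hx, Matrix.det_smul]
    exact mul_ne_zero (pow_ne_zero _ (inv_ne_zero (hk0 x hx))) (hη.nondeg x hx)
  let u : Pt → ℝ := fun x => -(5 / 2) * Real.log (k x)
  have hu : ContDiffOn ℝ ∞ u W := contDiffOn_const.mul (hk.log hk0)
  have hpu : ∀ x ∈ W, ∀ a, pd a u x = (5 / 2) * (-(pd a k x / k x)) := by
    intro x hx a
    have h1 : DifferentiableAt ℝ (fun y => Real.log (k y)) x := (hk.log hk0).diffAt hW hx
    change pd a (fun y => -(5 / 2) * Real.log (k y)) x = _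
    rw [pd_const_mul h1, pd_comp (Real.hasDerivAt_log (hk0 x hx)) (hk.diffAt hW hx)]
    ring
  have hcov : ∀ x ∈ W, covD Γ (candidate Γ ρ σ ξ) x = fun a b c =>
      -(pd a k x / k x) * candidate Γ ρ σ ξ x b c + (k x)⁻¹ * covD Γ η x a b c := by
    intro x hx
    rw [covD_congr hW hcand hx]
    funext a b c
    have hi : DifferentiableAt ℝ (fun y => (k y)⁻¹) x := (hk.inv hk0).diffAt hW hx
    rw [covD_smul hi (hη.smooth.diffAt hW hx), pd_comp (hasDerivAt_inv (hk0 x hx))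
      (hk.diffAt hW hx), hcand x hx, Matrix.smul_apply, smul_eq_mul]
    have := hk0 x hx
    field_simp
  have htf : ∀ x ∈ W, ∀ a b c, tracefree (covD Γ (candidate Γ ρ σ ξ) x) a b c =
      tracefree (fun a b c => -(pd a k x / k x) * candidate Γ ρ σ ξ x b c) a b c := by
    intro x hx a b c
    rw [hcov x hx, tracefree_add, tracefree_smul, hη.eq x hx, mul_zero, add_zero]
  have homega : ∀ x ∈ W, ∀ a, omegaForm Γ (candidate Γ ρ σ ξ) x a =
      (5 / 2) * (-(pd a k x / k x)) := by
    intro x hx a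
    rw [omegaForm]
    simp only [htf x hx]
    exact sum_inv_mul_tracefree (isSymm_candidate h hx) (hdet x hx) _ a
  refine ⟨hφ, hdet, ⟨u, hu, fun x hx a => by rw [hpu x hx, homega x hx]⟩, fun x hx a b c => ?_⟩
  have h1 : (fun a b c => covD Γ (candidate Γ ρ σ ξ) x a b c -
      (2 / 5) * omegaForm Γ (candidate Γ ρ σ ξ) x a * candidate Γ ρ σ ξ x b c) =
      fun a b c => (k x)⁻¹ * covD Γ η x a b c := by
    funext a b c
    rw [homega x hx, hcov x hx]
    ring
  rw [h1, tracefree_smul, hη.eq x hx, mul_zero]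

/-- If `ω̂ = du`, then `exp (-2u/5) σ̂` solves the metrisability equation. -/
theorem IsNormalFormOn.metrisableOn (hW : IsOpen W) (hΓ : IsTorsionFreeOn W Γ)
    (hvol : IsVolumeOn W vol) (hp : PreservesVolumeOn W Γ vol)
    (h : IsNormalFormOn Γ vol W ρ σ ξ) (hacc : AlgorithmAcceptsOn Γ ρ σ ξ W) :
    MetrisableOn W Γ := by
  obtain ⟨hφ, hdet, ⟨u, hu, hdu⟩, hscale⟩ := hacc
  have hcs := smoothMat_candidate hW hΓ h hφ
  have hF : ContDiffOn ℝ ∞ (fun x => Real.exp (-(2 / 5) * u x)) W :=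
    (contDiffOn_const.mul hu).exp
  refine SolvesMetrisability.metrisableOn hW hΓ hvol hp
    (η := fun x => Real.exp (-(2 / 5) * u x) • candidate Γ ρ σ ξ x)
    ⟨hcs.smul hF, fun x hx => (isSymm_candidate h hx).smul _, fun x hx => ?_, fun x hx a b c => ?_⟩
  · rw [Matrix.det_smul]
    exact mul_ne_zero (pow_ne_zero _ (Real.exp_ne_zero _)) (hdet x hx)
  · have hud := hu.diffAt hW hx
    have h1 : covD Γ (fun x => Real.exp (-(2 / 5) * u x) • candidate Γ ρ σ ξ x) x =
        fun a b c => Real.exp (-(2 / 5) * u x) * (covD Γ (candidate Γ ρ σ ξ) x a b c -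
          (2 / 5) * omegaForm Γ (candidate Γ ρ σ ξ) x a * candidate Γ ρ σ ξ x b c) := by
      funext a b c
      have hm : DifferentiableAt ℝ (fun y => -(2 / 5) * u y) x := hud.const_mul _
      rw [covD_smul (hF.diffAt hW hx) (hcs.diffAt hW hx), pd_comp (Real.hasDerivAt_exp _) hm,
        pd_const_mul hud, hdu x hx]
      ring
    rw [h1, tracefree_smul, hscale x hx, mul_zero]

end

/-- The Poincaré lemma on convex open sets, for 1-forms given by their components. -/
theorem exactOn_of_closed {B : Set Pt} (hB : IsOpen B) (hc : Convex ℝ B) {θ : Pt → Fin 3 → ℝ}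
    (hθ : ∀ a, ContDiffOn ℝ ∞ (fun x => θ x a) B) (hcl : ∀ x ∈ B, ClosedAt θ x) :
    ExactOn B θ := by
  let form : Pt → Pt →L[ℝ] ℝ := fun x => ∑ a, θ x a • ContinuousLinearMap.proj (R := ℝ) a
  have hforms : ContDiffOn ℝ ∞ form B := ContDiffOn.sum fun a _ => (hθ a).smul contDiffOn_const
  have hθd : ∀ x ∈ B, ∀ a, DifferentiableAt ℝ (fun y => θ y a) x := fun x hx a =>
    (hθ a).diffAt hB hx
  have hder : ∀ x ∈ B, ∀ v w, fderiv ℝ form x v w = ∑ a, ∑ b, v b * w a * pd b (fun y => θ y a) x := by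
    intro x hx v w
    have h1 : HasFDerivAt form (∑ a, (fderiv ℝ (fun y => θ y a) x).smulRight
        (ContinuousLinearMap.proj (R := ℝ) a : Pt →L[ℝ] ℝ)) x := by
      refine HasFDerivAt.fun_sum fun a _ => ?_
      exact (hθd x hx a).hasFDerivAt.smul_const (ContinuousLinearMap.proj (R := ℝ) a : Pt →L[ℝ] ℝ)
    rw [h1.fderiv]
    simp only [_root_.sum_apply, ContinuousLinearMap.smulRight_apply,
      _root_.smul_apply, ContinuousLinearMap.proj_apply, smul_eq_mul,
      fderiv_apply_eq_sum_pd _ x v, Finset.sum_mul]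
    refine Finset.sum_congr rfl fun a _ => Finset.sum_congr rfl fun b _ => ?_
    ring
  obtain ⟨u, hu⟩ := hc.exists_forall_hasFDerivAt_of_fderiv_symmetric hB
    (hforms.differentiableOn (by simp)) fun x hx v w => by
      rw [hder x hx, hder x hx, Finset.sum_comm]
      refine Finset.sum_congr rfl fun a _ => Finset.sum_congr rfl fun b _ => ?_
      rw [hcl x hx a b]
      ring
  refine ⟨u, ?_, fun x hx a => ?_⟩
  · rw [contDiffOn_infty_iff_fderiv_of_isOpen hB]
    exact ⟨fun x hx => (hu x hx).differentiableAt.differentiableWithinAt,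
      hforms.congr fun x hx => (hu x hx).fderiv⟩
  · rw [pd, (hu x hx).fderiv]
    simp [form, Pi.single_apply]

theorem IsNormalFormOn.metrisableOn_iff {U W : Set Pt} {Γ : Christoffel} {vol : Pt → ℝ}
    {ρ σ : Pt → Mat3} {ξ : Pt → Fin 3 → ℝ} (hΓ : IsTorsionFreeOn U Γ)
    (hvol : IsVolumeOn U vol) (hp : PreservesVolumeOn U Γ vol) (hW : IsOpen W) (hs : W ⊆ U)
    (h : IsNormalFormOn Γ vol W ρ σ ξ)
    (hne : ∀ x ∈ W, phiFn Γ ρ σ ξ x ≠ 0 ∨ psiFn Γ ρ σ ξ x ≠ 0) :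
    MetrisableOn W Γ ↔ AlgorithmAcceptsOn Γ ρ σ ξ W :=
  ⟨h.algorithmAcceptsOn hW (hΓ.mono hs) (hvol.mono hs) (hp.mono hs) hne,
    h.metrisableOn hW (hΓ.mono hs) (hvol.mono hs) (hp.mono hs)⟩

/-- The local form of `IsNormalFormOn.metrisableOn_iff`: the conditions at `p` persist on a ball, and
on a ball closed 1-forms are exact. -/
theorem IsNormalFormOn.metrisableNear_iff {U W : Set Pt} {Γ : Christoffel} {vol : Pt → ℝ}
    {ρ σ : Pt → Mat3} {ξ : Pt → Fin 3 → ℝ} (hΓ : IsTorsionFreeOn U Γ)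
    (hvol : IsVolumeOn U vol) (hp : PreservesVolumeOn U Γ vol) (hW : IsOpen W) (hs : W ⊆ U)
    (h : IsNormalFormOn Γ vol W ρ σ ξ) {p : Pt} (hpW : p ∈ W)
    (hne : phiFn Γ ρ σ ξ p ≠ 0 ∨ psiFn Γ ρ σ ξ p ≠ 0) :
    MetrisableNear Γ p ↔ AlgorithmAcceptsAt Γ ρ σ ξ p := by
  have hnhds := hW.mem_nhds hpW
  have hφc := ((contDiffOn_phiFn hW (hΓ.mono hs) h).continuousOn).continuousAt hnhds
  have hψc := ((contDiffOn_psiFn hW (hΓ.mono hs) h).continuousOn).continuousAt hnhds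
  constructor
  · rintro ⟨W₁, hW₁, hpW₁, hm⟩
    have hev : ∀ᶠ x in 𝓝 p, phiFn Γ ρ σ ξ x ≠ 0 ∨ psiFn Γ ρ σ ξ x ≠ 0 := by
      rcases hne with h0 | h0
      · filter_upwards [hφc.eventually_ne h0] with x hx using Or.inl hx
      · filter_upwards [hψc.eventually_ne h0] with x hx using Or.inr hx
    obtain ⟨W₂, hW₂, hW₂o, hpW₂⟩ := eventually_nhds_iff.1 hev
    have hW₃ : IsOpen (W ∩ W₁ ∩ W₂) := (hW.inter hW₁).inter hW₂o
    have hs₃ : W ∩ W₁ ∩ W₂ ⊆ U := fun x hx => hs hx.1.1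
    have hacc := (h.mono fun x (hx : x ∈ W ∩ W₁ ∩ W₂) => hx.1.1).algorithmAcceptsOn hW₃
      (hΓ.mono hs₃) (hvol.mono hs₃) (hp.mono hs₃) (fun x hx => hW₂ x hx.2)
      (hm.mono fun x hx => hx.1.2)
    obtain ⟨h1, h2, ⟨u, hu, hdu⟩, h4⟩ := hacc
    have hp₃ : p ∈ W ∩ W₁ ∩ W₂ := ⟨⟨hpW, hpW₁⟩, hpW₂⟩
    refine ⟨h1 p hp₃, h2 p hp₃, ?_⟩
    filter_upwards [hW₃.mem_nhds hp₃] with x hx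
    refine ⟨fun a b => ?_, h4 x hx⟩
    rw [pd_congr_of_eqOn hW₃ (fun y hy => (hdu y hy b).symm) hx a,
      pd_congr_of_eqOn hW₃ (fun y hy => (hdu y hy a).symm) hx b]
    exact pd_comm hW₃ hu hx a b
  · rintro ⟨hφ, hdet, hev⟩
    obtain ⟨W₂, hW₂, hW₂o, hpW₂⟩ := eventually_nhds_iff.1 (hφc.eventually_ne hφ)
    have hW₃ : IsOpen (W ∩ W₂) := hW.inter hW₂o
    have hs₃ : W ∩ W₂ ⊆ U := fun x hx => hs hx.1
    have h₃ := h.mono fun x (hx : x ∈ W ∩ W₂) => hx.1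
    have hcs := smoothMat_candidate hW₃ (hΓ.mono hs₃) h₃ fun x hx => hW₂ x hx.2
    have hdc : ContinuousAt (fun x => (candidate Γ ρ σ ξ x).det) p :=
      hcs.det.continuousOn.continuousAt (hW₃.mem_nhds ⟨hpW, hpW₂⟩)
    have hall := (hev.and (hdc.eventually_ne hdet)).and (hW₃.mem_nhds ⟨hpW, hpW₂⟩)
    obtain ⟨r, hr, hball⟩ := Metric.eventually_nhds_iff_ball.1 hall
    have hs₄ : Metric.ball p r ⊆ W ∩ W₂ := fun x hx => (hball x hx).2
    have hs₅ := hs₄.trans hs₃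
    have hB : IsOpen (Metric.ball p r) := Metric.isOpen_ball
    refine ⟨Metric.ball p r, hB, Metric.mem_ball_self hr, (h₃.mono hs₄).metrisableOn hB
      (hΓ.mono hs₅) (hvol.mono hs₅) (hp.mono hs₅) ⟨fun x hx => hW₂ x (hs₄ hx).2,
        fun x hx => (hball x hx).1.2, ?_, fun x hx => (hball x hx).1.1.2⟩⟩
    exact exactOn_of_closed hB (convex_ball p r) (contDiffOn_omegaForm hB (hΓ.mono hs₅)
      (hcs.mono hs₄) fun x hx => (hball x hx).1.2) fun x hx => (hball x hx).1.1.1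

/-! ### Existence of normal forms -/

theorem isInvertible_comp_inr {E : Type*} [NormedAddCommGroup E] [NormedSpace ℝ E]
    {L : E × ℝ →L[ℝ] ℝ} (h : L (0, 1) ≠ 0) :
    (L ∘L ContinuousLinearMap.inr ℝ E ℝ).IsInvertible := by
  refine ⟨ContinuousLinearEquiv.unitsEquivAut ℝ (Units.mk0 _ h), ?_⟩
  ext
  simp

/-- The smooth implicit function theorem with one real unknown. Mathlib's version gives smoothness
at the base point only, where the neighbourhood depends on the order of differentiation; by local
uniqueness, it applies at the nearby points of the same solution. -/
theorem exists_contDiffOn_root {E : Type*} [NormedAddCommGroup E] [NormedSpace ℝ E]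
    [CompleteSpace E] {F : E × ℝ → ℝ} {A : Set (E × ℝ)} (hA : IsOpen A)
    (hF : ContDiffOn ℝ ∞ F A) {p : E} {r : ℝ} (hp : (p, r) ∈ A) (h0 : F (p, r) = 0)
    (hd : fderiv ℝ F (p, r) (0, 1) ≠ 0) :
    ∃ (W : Set E) (t : E → ℝ), IsOpen W ∧ p ∈ W ∧ ContDiffOn ℝ ∞ t W ∧ t p = r ∧
      ∀ x ∈ W, F (x, t x) = 0 := by
  have hAt : ∀ u ∈ A, ContDiffAt ℝ ∞ F u := fun u hu => hF.contDiffAt (hA.mem_nhds hu)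
  have hinf : (∞ : WithTop ℕ∞) ≠ 0 := by simp
  have hinv := isInvertible_comp_inr hd
  let t : E → ℝ := (hAt _ hp).implicitFunction hinf hinv
  have htp : t p = r := (hAt _ hp).implicitFunction_apply_self hinf hinv
  have ht1 : ContDiffAt ℝ 1 t p :=
    ((hAt _ hp).contDiffAt_implicitFunction hinf hinv).of_le (by simp)
  have hcont : ∀ᶠ x in 𝓝 p, ContinuousAt t x :=
    (ht1.eventually (by simp)).mono fun x hx => hx.continuousAt
  have hroot : ∀ᶠ x in 𝓝 p, F (x, t x) = 0 := by
    filter_upwards [(hAt _ hp).eventually_apply_implicitFunction hinf hinv] with x hx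
    rw [← h0]; exact hx
  have hpair : Tendsto (fun x => (x, t x)) (𝓝 p) (𝓝 (p, r)) := by
    have := (continuousAt_id (x := p)).prodMk ht1.continuousAt
    rw [← htp]
    exact this
  have hmem : ∀ᶠ x in 𝓝 p, (x, t x) ∈ A := hpair.eventually (hA.mem_nhds hp)
  have hdc : ∀ᶠ x in 𝓝 p, fderiv ℝ F (x, t x) (0, 1) ≠ 0 := by
    have h1 : ContinuousAt (fun u => fderiv ℝ F u (0, 1)) (p, r) :=
      ((hF.continuousOn_fderiv_of_isOpen hA (by simp)).continuousAt (hA.mem_nhds hp)).clm_apply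
        continuousAt_const
    exact hpair.eventually (h1.eventually_ne hd)
  obtain ⟨W, hW, hWo, hpW⟩ := eventually_nhds_iff.1 ((hcont.and hroot).and (hmem.and hdc))
  refine ⟨W, t, hWo, hpW, fun x hx => ContDiffAt.contDiffWithinAt ?_, htp,
    fun x hx => (hW x hx).1.2⟩
  obtain ⟨⟨hc, hr⟩, hm, hne⟩ := hW x hx
  have hinv' := isInvertible_comp_inr hne
  refine ((hAt _ hm).contDiffAt_implicitFunction hinf hinv').congr_of_eventuallyEq ?_
  have h1 : Tendsto (fun y => (y, t y)) (𝓝 x) (𝓝 (x, t x)) := continuousAt_id.prodMk hc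
  filter_upwards [h1.eventually ((hAt _ hm).eventually_apply_eq_iff_implicitFunction hinf hinv'),
    hWo.mem_nhds hx] with y hy hyW
  exact (hy.1 (by rw [hr, (hW y hyW).1.2])).symm

/-- A degenerate member of a smooth pencil spanned by `K` and `M` at which `det (K + t M)` has a
simple root belongs to a smooth family of degenerate members. -/
theorem exists_contDiffOn_degenerate {E : Type*} [NormedAddCommGroup E] [NormedSpace ℝ E]
    [CompleteSpace E] {K M : E → Mat3} {U : Set E} (hU : IsOpen U)
    (hK : SmoothMat U K) (hM : SmoothMat U M) {p : E} (hp : p ∈ U)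
    (h0 : (K p).det = 0) (hβ : ((K p).adjugate * M p).trace ≠ 0) :
    ∃ (W : Set E) (t : E → ℝ), IsOpen W ∧ p ∈ W ∧ ContDiffOn ℝ ∞ t W ∧ t p = 0 ∧
      ∀ x ∈ W, (K x + t x • M x).det = 0 := by
  let F : E × ℝ → ℝ := fun u => (K u.1 + u.2 • M u.1).det
  have hFs : ContDiffOn ℝ ∞ F (U ×ˢ univ) := by
    have hK' : SmoothMat (U ×ˢ univ) (fun u : E × ℝ => K u.1) := fun b c =>
      (hK b c).comp contDiffOn_fst fun u hu => hu.1
    have hM' : SmoothMat (U ×ˢ univ) (fun u : E × ℝ => M u.1) := fun b c =>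
      (hM b c).comp contDiffOn_fst fun u hu => hu.1
    exact (hK'.add (hM'.smul contDiffOn_snd)).det
  have hA : IsOpen (U ×ˢ (univ : Set ℝ)) := hU.prod isOpen_univ
  have hpA : (p, (0 : ℝ)) ∈ U ×ˢ (univ : Set ℝ) := ⟨hp, mem_univ _⟩
  refine exists_contDiffOn_root hA hFs hpA (by simp [F, h0]) ?_
  have h1 : HasFDerivAt F (fderiv ℝ F (p, 0)) (p, 0) :=
    ((hFs.contDiffAt (hA.mem_nhds hpA)).differentiableAt (by simp)).hasFDerivAt
  have h2 : HasDerivAt (fun t : ℝ => F (p, t)) (fderiv ℝ F (p, 0) (0, 1)) 0 :=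
    h1.comp_hasDerivAt (0 : ℝ) ((hasDerivAt_const (0 : ℝ) p).prodMk (hasDerivAt_id (0 : ℝ)))
  have h3 : HasDerivAt (fun t : ℝ => F (p, t)) ((K p).adjugate * M p).trace 0 := by
    have h4 := ((((hasDerivAt_id (0 : ℝ)).mul_const ((K p).adjugate * M p).trace).const_add
      (K p).det).add ((hasDerivAt_pow 2 (0 : ℝ)).mul_const ((M p).adjugate * K p).trace)).add
        ((hasDerivAt_pow 3 (0 : ℝ)).mul_const (M p).det)
    refine (h4.congr_deriv (by simp)).congr_of_eventuallyEq (Eventually.of_forall fun t => ?_)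
    have h5 := det_combination (K p) (M p) 1 t
    rw [one_smul] at h5
    simp only [F, h5, Pi.add_apply, id]
    ring
  rw [h2.unique h3]
  exact hβ

theorem linearIndependent_of_det {A B : Mat3} (hA : A ≠ 0) (hA0 : A.det = 0) (hB : B.det ≠ 0) :
    LinearIndependent ℝ ![A, B] := by
  rw [linearIndependent_pair_iff']
  intro s t h
  have ht : t = 0 := by
    by_contra ht
    have h1 : t • B = -s • A := by rw [neg_smul]; exact eq_neg_of_add_eq_zero_right h
    have h2 : t ^ 3 * B.det = 0 := by
      have := congrArg Matrix.det h1
      rw [Matrix.det_smul, Matrix.det_smul, hA0, mul_zero] at this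
      exact this
    exact mul_ne_zero (pow_ne_zero 3 ht) hB h2
  rw [ht, zero_smul, add_zero, smul_eq_zero] at h
  exact ⟨h.resolve_right hA, ht⟩

theorem pencilOf_eq_of_mem {Φ H A B : Mat3} (hA : A ∈ pencilOf Φ H) (hB : B ∈ pencilOf Φ H)
    (hi : LinearIndependent ℝ ![A, B]) : pencilOf Φ H = pencilOf A B := by
  obtain ⟨a, b, hA⟩ := hA
  obtain ⟨c, e, hB⟩ := hB
  rw [linearIndependent_pair_iff'] at hi
  have hD : a * e - b * c ≠ 0 := by
    intro hD
    have h1 : e • A + (-b) • B = 0 := by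
      rw [hA, hB]
      have : e • (a • Φ + b • H) + (-b) • (c • Φ + e • H) = (a * e - b * c) • Φ := by module
      rw [this, hD, zero_smul]
    have h2 : (-c) • A + a • B = 0 := by
      rw [hA, hB]
      have : (-c) • (a • Φ + b • H) + a • (c • Φ + e • H) = (a * e - b * c) • H := by module
      rw [this, hD, zero_smul]
    obtain ⟨-, hb⟩ := hi _ _ h1
    obtain ⟨-, ha⟩ := hi _ _ h2
    have hA0 : A = 0 := by rw [hA, ha, neg_eq_zero.1 hb]; simp
    exact one_ne_zero (hi 1 0 (by rw [hA0]; simp)).1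
  ext τ
  constructor
  · rintro ⟨s, t, rfl⟩
    refine ⟨(s * e - t * c) / (a * e - b * c), (t * a - s * b) / (a * e - b * c), ?_⟩
    have h1 : (a * e - b * c) • (s • Φ + t • H) = (s * e - t * c) • A + (t * a - s * b) • B := by
      rw [hA, hB]; module
    rw [div_eq_inv_mul, div_eq_inv_mul, mul_smul, mul_smul, ← smul_add, ← h1, smul_smul,
      inv_mul_cancel₀ hD, one_smul]
  · rintro ⟨s, t, rfl⟩
    exact ⟨s * a + t * c, s * b + t * e, by rw [hA, hB]; module⟩

/-- The combination `2 β H - α ρ` with `α = tr (adj H ρ)` and `β = tr (adj ρ H)`; for degenerate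
`ρ`, it is the element of the pencil of `ρ` and `H`, unique up to scale, whose inverse is
orthogonal to `ρ`. -/
noncomputable def normalPartner (ρ H : Mat3) : Mat3 :=
  (2 * (ρ.adjugate * H).trace) • H + (-(H.adjugate * ρ).trace) • ρ

theorem det_normalPartner {ρ H : Mat3} (hρ : ρ.det = 0) : (normalPartner ρ H).det =
    2 * (ρ.adjugate * H).trace ^ 2 *
      (4 * (ρ.adjugate * H).trace * H.det - (H.adjugate * ρ).trace ^ 2) := by
  rw [normalPartner, det_combination, hρ]; ring

theorem trace_adjugate_normalPartner {ρ H : Mat3} (hρ : ρ.det = 0) :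
    ((normalPartner ρ H).adjugate * ρ).trace = 0 := by
  rw [normalPartner, trace_adjugate_combination, hρ]; ring

theorem sum_inv_mul_eq_trace {σ ρ : Mat3} (hρ : ρ.IsSymm) :
    ∑ b, ∑ c, σ⁻¹ b c * ρ b c = (σ.det)⁻¹ * (σ.adjugate * ρ).trace := by
  simp only [Matrix.inv_def, Ring.inverse_eq_inv', Matrix.smul_apply, smul_eq_mul, Matrix.trace,
    Matrix.diag, Matrix.mul_apply, Finset.mul_sum]
  refine Finset.sum_congr rfl fun b _ => Finset.sum_congr rfl fun c _ => ?_
  rw [hρ.apply b c]; ring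

theorem sum_mul_adjugate_row {ρ : Mat3} (hρ : ρ.det = 0) (i c : Fin 3) :
    ∑ b, ρ b c * ρ.adjugate i b = 0 := by
  have h := congrFun (congrFun (Matrix.adjugate_mul ρ) i) c
  rw [hρ, zero_smul, Matrix.mul_apply] at h
  rw [← Matrix.zero_apply (α := ℝ) i c, ← h]
  exact Finset.sum_congr rfl fun b _ => mul_comm _ _

theorem smoothMat_pencilMat {U : Set Pt} (hU : IsOpen U) {Γ : Christoffel}
    (hΓ : IsTorsionFreeOn U Γ) (T : Mat3) :
    SmoothMat U (fun x => pencilMat (weylOf (curv Γ x)) T) := by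
  have hc : ∀ a b c d, ContDiffOn ℝ ∞ (fun x => curv Γ x a b c d) U := fun a b c d =>
    (((hΓ.smooth b d c).pd_of_isOpen hU a).sub ((hΓ.smooth a d c).pd_of_isOpen hU b)).add
      (ContDiffOn.sum fun e _ => ((hΓ.smooth a e c).mul (hΓ.smooth b d e)).sub
        ((hΓ.smooth b e c).mul (hΓ.smooth a d e)))
  have hw : ∀ a b c, ContDiffOn ℝ ∞ (fun x => weylOf (curv Γ x) a b c) U := fun a b c =>
    contDiffOn_const.mul (ContDiffOn.sum fun d _ => ContDiffOn.sum fun e _ =>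
      (contDiffOn_const.mul (hc d e b c)).add (contDiffOn_const.mul (hc d e a c)))
  intro b c
  exact contDiffOn_const.mul (ContDiffOn.sum fun a _ => ContDiffOn.sum fun d _ =>
    ContDiffOn.sum fun e _ => ((contDiffOn_const.mul (hw a b e)).mul contDiffOn_const).add
      ((contDiffOn_const.mul (hw a c e)).mul contDiffOn_const))

/-- A normal form is determined by two elements of the Weyl pencil at one point, a degenerate one
and a non-degenerate one, subject to the conditions expressing regularity. The degenerate element
extends to a smooth degenerate section since it corresponds to a simple root of the cubic
`det (K + t H)`. -/
theorem exists_isNormalFormOn {U : Set Pt} {Γ : Christoffel} {vol : Pt → ℝ} (hU : IsOpen U)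
    (hΓ : IsTorsionFreeOn U Γ) (hvol : IsVolumeOn U vol) (hp : PreservesVolumeOn U Γ vol) {p : Pt}
    (hpU : p ∈ U) (hQ : ∀ᶠ x in 𝓝 p, QVanishesAt Γ vol x) {T S N H : Mat3} (hT : T.IsSymm)
    (hS : S.IsSymm) (hN : pencilMat (weylOf (curv Γ p)) T = N)
    (hH : pencilMat (weylOf (curv Γ p)) S = H) (hH0 : H.det ≠ 0) (hN0 : N.det = 0)
    (hβ : (N.adjugate * H).trace ≠ 0)
    (hdisc : 4 * (N.adjugate * H).trace * H.det ≠ (H.adjugate * N).trace ^ 2)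
    {i : Fin 3} (hi : N.adjugate i ≠ 0) :
    ∃ (W : Set Pt) (ρ σ : Pt → Mat3) (ξ : Pt → Fin 3 → ℝ),
      IsOpen W ∧ p ∈ W ∧ W ⊆ U ∧ IsNormalFormOn Γ vol W ρ σ ξ ∧ ρ p = N ∧
        σ p = normalPartner N H ∧ ξ p = N.adjugate i := by
  let K : Pt → Mat3 := fun x => pencilMat (weylOf (curv Γ x)) T
  let M : Pt → Mat3 := fun x => pencilMat (weylOf (curv Γ x)) S
  have hKs : SmoothMat U K := smoothMat_pencilMat hU hΓ T
  have hMs : SmoothMat U M := smoothMat_pencilMat hU hΓ S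
  have hKp : K p = N := hN
  have hMp : M p = H := hH
  obtain ⟨W₀, t, hW₀, hpW₀, hts, htp, hroot⟩ := exists_contDiffOn_degenerate hU hKs hMs hpU
    (by rw [hKp, hN0]) (by rwa [hKp, hMp])
  let ρ : Pt → Mat3 := fun x => K x + t x • M x
  have hρp : ρ p = N := by simp [ρ, htp, hKp]
  have hW₁ : IsOpen (W₀ ∩ U) := hW₀.inter hU
  have hρs : SmoothMat (W₀ ∩ U) ρ := (hKs.mono inter_subset_right).add
    ((hMs.mono inter_subset_right).smul (hts.mono inter_subset_left))
  have hMs' : SmoothMat (W₀ ∩ U) M := hMs.mono inter_subset_right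
  let β : Pt → ℝ := fun x => ((ρ x).adjugate * M x).trace
  let α : Pt → ℝ := fun x => ((M x).adjugate * ρ x).trace
  have hβs : ContDiffOn ℝ ∞ β (W₀ ∩ U) := hρs.adjugate.trace_mul hMs'
  have hαs : ContDiffOn ℝ ∞ α (W₀ ∩ U) := hMs'.adjugate.trace_mul hρs
  let σ : Pt → Mat3 := fun x => normalPartner (ρ x) (M x)
  have hσs : SmoothMat (W₀ ∩ U) σ := (hMs'.smul (contDiffOn_const.mul hβs)).add
    (hρs.smul hαs.neg)
  let ξ : Pt → Fin 3 → ℝ := fun x => (ρ x).adjugate i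
  have hξs : ∀ b, ContDiffOn ℝ ∞ (fun x => ξ x b) (W₀ ∩ U) := fun b => hρs.adjugate i b
  have hpW₁ : p ∈ W₀ ∩ U := ⟨hpW₀, hpU⟩
  have hcont : ∀ {f : Pt → ℝ}, ContDiffOn ℝ ∞ f (W₀ ∩ U) → f p ≠ 0 → ∀ᶠ x in 𝓝 p, f x ≠ 0 :=
    fun hf h0 => (hf.continuousOn.continuousAt (hW₁.mem_nhds hpW₁)).eventually_ne h0
  have hσdet : (σ p).det ≠ 0 := by
    simp only [σ]
    rw [det_normalPartner (by rw [hρp, hN0]), hρp, hMp]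
    exact mul_ne_zero (mul_ne_zero two_ne_zero (pow_ne_zero 2 hβ)) (sub_ne_zero.2 hdisc)
  obtain ⟨j, hj⟩ := Function.ne_iff.1 hi
  obtain ⟨W, hW, hWo, hpW⟩ := eventually_nhds_iff.1 (((hcont hMs'.det (by rwa [hMp])).and
    (hcont hβs (by simpa only [β, hρp, hMp] using hβ))).and
    ((hcont hσs.det hσdet).and ((hcont (hξs j) (by simp only [ξ, hρp]; exact hj)).and
      ((show ∀ᶠ x in 𝓝 p, x ∈ W₀ ∩ U from hW₁.mem_nhds hpW₁).and hQ))))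
  have hs : W ⊆ W₀ ∩ U := fun x hx => (hW x hx).2.2.2.1
  have hdetρ : ∀ x ∈ W, (ρ x).det = 0 := fun x hx =>
    hroot x (hs hx).1
  have hsymm : ∀ x, (ρ x).IsSymm := fun x =>
    (pencilMat_isSymm _ _).add ((pencilMat_isSymm _ _).smul _)
  have hξ0 : ∀ x ∈ W, ξ x ≠ 0 := fun x hx h0 => (hW x hx).2.2.1 (by rw [h0]; rfl)
  have hρ0 : ∀ x ∈ W, ρ x ≠ 0 := fun x hx h0 => hξ0 x hx (by
    simp only [ξ, h0, Matrix.adjugate_zero]; rfl)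
  have hli : ∀ x ∈ W, LinearIndependent ℝ ![ρ x, σ x] := fun x hx =>
    linearIndependent_of_det (hρ0 x hx) (hdetρ x hx) (hW x hx).2.1
  refine ⟨W, ρ, σ, ξ, hWo, hpW, fun x hx => (hs hx).2, ⟨fun b c => (hρs b c).mono hs,
    fun b c => (hσs b c).mono hs, fun b => (hξs b).mono hs, fun x hx => ?_, hli,
    fun x hx => (hW x hx).2.1, fun x hx => ?_, fun x hx c => ?_, hξ0⟩, hρp, ?_, ?_⟩
  · obtain ⟨⟨hMx, -⟩, -, -, hxU, hQx⟩ := hW x hx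
    have hxU := hxU.2
    have hv := hvol.ne_zero x hxU
    have hsy := weylOf_symm (curv Γ x)
    have htr := weylOf_trace_eq_zero hU hΓ hvol hp hxU
    have hV : ∃ a b c, weylOf (curv Γ x) a b c ≠ 0 := by
      by_contra! h0
      apply hMx
      have : M x = 0 := by
        ext b c
        simp [M, pencilMat, h0]
      rw [this, Matrix.det_zero]
    obtain ⟨Φ, -, -, hP⟩ := pencilSet_eq_of_obstruction hsy htr (pencilMat_isSymm _ _) hMx
      (obstruction_pencilMat hsy htr ((qVanishesAt_iff hv).1 hQx) hS) hV
    have hK' : K x ∈ pencilOf Φ (M x) := hP ▸ ⟨T, hT, rfl⟩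
    obtain ⟨a, b, hab⟩ := hK'
    have hρ' : ρ x ∈ pencilOf Φ (M x) := ⟨a, b + t x, by simp only [ρ, hab]; module⟩
    have hM' : M x ∈ pencilOf (ρ x) (M x) := ⟨0, 1, by simp⟩
    rw [weylPencil_eq hv, hP, pencilOf_eq_of_mem hρ' ⟨0, 1, by simp⟩
      (linearIndependent_of_det (hρ0 x hx) (hdetρ x hx) hMx)]
    exact pencilOf_eq_of_mem ⟨1, 0, by simp⟩ ⟨_, _, add_comm _ _⟩ (hli x hx)
  · rw [sum_inv_mul_eq_trace (hsymm x), trace_adjugate_normalPartner (hdetρ x hx), mul_zero]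
  · exact sum_mul_adjugate_row (hdetρ x hx) i c
  · simp only [σ, hρp, hMp]
  · simp only [ξ, hρp]

theorem exists_adjugate_row_ne_zero {N H : Mat3} (hβ : (N.adjugate * H).trace ≠ 0) :
    ∃ i, N.adjugate i ≠ 0 := by
  by_contra! h0
  apply hβ
  have : N.adjugate = 0 := by funext i; exact h0 i
  rw [this, Matrix.zero_mul, Matrix.trace_zero]

theorem exists_root_of_cubic (a b c : ℝ) : ∃ t : ℝ, t ^ 3 + a * t ^ 2 + b * t + c = 0 := by
  set R : ℝ := 1 + |a| + |b| + |c| with hR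
  have ha := abs_nonneg a
  have hb := abs_nonneg b
  have hc := abs_nonneg c
  have h1 : 1 ≤ R := by linarith
  have h2 : R ≤ R ^ 2 := by nlinarith
  have hbR : |b| * R ≤ |b| * R ^ 2 := mul_le_mul_of_nonneg_left h2 hb
  have hcR : |c| ≤ |c| * R ^ 2 := by nlinarith
  have hR3 : R ^ 3 = R ^ 2 + |a| * R ^ 2 + |b| * R ^ 2 + |c| * R ^ 2 := by
    calc R ^ 3 = R * R ^ 2 := by ring
      _ = (1 + |a| + |b| + |c|) * R ^ 2 := by rw [← hR]
      _ = _ := by ring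
  have ha1 := mul_le_mul_of_nonneg_right (neg_abs_le a) (sq_nonneg R)
  have ha2 := mul_le_mul_of_nonneg_right (le_abs_self a) (sq_nonneg R)
  have hb1 := mul_le_mul_of_nonneg_right (neg_abs_le b) (zero_le_one.trans h1)
  have hb2 := mul_le_mul_of_nonneg_right (le_abs_self b) (zero_le_one.trans h1)
  have hc1 := neg_abs_le c
  have hc2 := le_abs_self c
  have hcont : Continuous fun t : ℝ => t ^ 3 + a * t ^ 2 + b * t + c := by fun_prop
  have hmem : (0 : ℝ) ∈ Icc ((-R) ^ 3 + a * (-R) ^ 2 + b * (-R) + c)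
      (R ^ 3 + a * R ^ 2 + b * R + c) :=
    ⟨by nlinarith, by nlinarith⟩
  obtain ⟨t, -, ht⟩ := intermediate_value_Icc (by linarith : -R ≤ R) hcont.continuousOn hmem
  exact ⟨t, ht⟩

theorem exists_det_eq_zero {A H : Mat3} (hH : H.det ≠ 0) : ∃ t : ℝ, (A + t • H).det = 0 := by
  obtain ⟨t, ht⟩ := exists_root_of_cubic ((H.adjugate * A).trace / H.det)
    ((A.adjugate * H).trace / H.det) (A.det / H.det)
  refine ⟨t, ?_⟩
  have h1 := det_combination A H 1 t
  rw [one_smul] at h1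
  rw [h1, ← mul_zero H.det, ← ht]
  field_simp
  ring

theorem IsRegularPencil.exists_degenerate {P : Set Mat3} (h : IsRegularPencil P) :
    ∃ N ∈ P, N ≠ 0 ∧ N.det = 0 := by
  obtain ⟨A, H, hH, rfl, hcard⟩ := h
  obtain ⟨t, ht⟩ := exists_det_eq_zero (A := A) hH
  refine ⟨A + t • H, ⟨1, t, by simp⟩, fun h0 => ?_, ht⟩
  -- If `A = - t H`, the cubic is `(s - t)³`.
  have hA : A = (-t) • H := by rw [neg_smul]; exact eq_neg_of_add_eq_zero_left h0
  have hset : {z : ℂ | pencilCubic A H 1 z = 0} ⊆ {(t : ℂ)} := by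
    intro z hz
    rw [mem_singleton_iff]
    have h1 : H⁻¹ * A = (-t) • (1 : Mat3) := by
      rw [hA, Matrix.mul_smul, Matrix.nonsing_inv_mul _ hH.isUnit]
    have h2 : pencilCubic A H 1 z = (z - t) ^ 3 := by
      rw [pencilCubic, h1]
      simp [Matrix.det_fin_three]
      ring
    have h3 : (z - t) ^ 3 = 0 := by rw [← h2]; exact hz
    exact sub_eq_zero.1 (pow_eq_zero_iff (by norm_num) |>.1 h3)
  have := Set.ncard_le_ncard hset (Set.toFinite _)
  rw [hcard, Set.ncard_singleton] at this
  omega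

/-- Regularity makes a degenerate element `N` a simple root of the cubic of the pencil, which is what
`exists_isNormalFormOn` needs to extend `N` to a smooth degenerate section. -/
theorem exists_isNormalFormOn_of_isRegularPencil {U : Set Pt} {Γ : Christoffel} {vol : Pt → ℝ}
    (hU : IsOpen U) (hΓ : IsTorsionFreeOn U Γ) (hvol : IsVolumeOn U vol)
    (hp : PreservesVolumeOn U Γ vol) {p : Pt} (hpU : p ∈ U)
    (hQ : ∀ᶠ x in 𝓝 p, QVanishesAt Γ vol x) (hreg : IsRegularPencil (weylPencil Γ vol p))
    {N : Mat3} (hN : N ∈ weylPencil Γ vol p) (hN0 : N ≠ 0) (hdet : N.det = 0) :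
    ∃ (W : Set Pt) (ρ σ : Pt → Mat3) (ξ : Pt → Fin 3 → ℝ),
      IsOpen W ∧ p ∈ W ∧ W ⊆ U ∧ IsNormalFormOn Γ vol W ρ σ ξ ∧ ρ p = N := by
  obtain ⟨A, H, hH, hP, -⟩ := id hreg
  have hHm : H ∈ weylPencil Γ vol p := by rw [hP]; exact ⟨0, 1, by simp⟩
  have hPN : weylPencil Γ vol p = pencilOf N H := by
    rw [hP]
    exact pencilOf_eq_of_mem (hP ▸ hN) ⟨0, 1, by simp⟩ (linearIndependent_of_det hN0 hdet hH)
  rw [hPN] at hreg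
  obtain ⟨hβ, hdisc⟩ := coefficients_of_isRegularPencil hH hdet hreg
  rw [weylPencil_eq (hvol.ne_zero p hpU)] at hN hHm
  obtain ⟨T, hT, hTN⟩ := hN
  obtain ⟨S, hS, hSH⟩ := hHm
  obtain ⟨i, hi⟩ := exists_adjugate_row_ne_zero hβ
  obtain ⟨W, ρ, σ, ξ, h1, h2, h3, h4, h5, -, -⟩ := exists_isNormalFormOn hU hΓ hvol hp hpU hQ hT hS
    hTN.symm hSH.symm hH hdet hβ hdisc hi
  exact ⟨W, ρ, σ, ξ, h1, h2, h3, h4, h5⟩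

/-! ### Genericity in terms of jets -/

/-- The curvature as a function of the 2-jet of the connection. -/
noncomputable def jetCurv (j : Jet2) (a b c d : Fin 3) : ℝ :=
  j.2.1 a b d c - j.2.1 b a d c + ∑ e, (j.1 a e c * j.1 b d e - j.1 b e c * j.1 a d e)

/-- The coordinate derivative `∂_k` of the curvature as a function of the 2-jet of the
connection. -/
noncomputable def jetDCurv (j : Jet2) (k a b c d : Fin 3) : ℝ :=
  j.2.2 k a b d c - j.2.2 k b a d c +
    ∑ e, (j.2.1 k a e c * j.1 b d e + j.1 a e c * j.2.1 k b d e -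
      (j.2.1 k b e c * j.1 a d e + j.1 b e c * j.2.1 k a d e))

/-- The element of the Weyl pencil given by `T` as a function of the 2-jet of the connection. -/
noncomputable def jetPencil (j : Jet2) (T : Mat3) : Mat3 := pencilMat (weylOf (jetCurv j)) T

/-- The covariant derivative, at the base point of the jet, of the section of the Weyl pencil given
by the constant matrix `T`. -/
noncomputable def jetCovD (j : Jet2) (T : Mat3) (a b c : Fin 3) : ℝ :=
  pencilMat (weylOf (jetDCurv j a)) T b c + ∑ d, j.1 a d b * jetPencil j T d c +
    ∑ d, j.1 a d c * jetPencil j T b d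

theorem jetCurv_jet2 (Γ : Christoffel) (p : Pt) : jetCurv (jet2 Γ p) = curv Γ p := rfl

section

variable {U : Set Pt} {Γ : Christoffel} {vol : Pt → ℝ} {p : Pt}

theorem pd_curv (hU : IsOpen U) (hΓ : IsTorsionFreeOn U Γ) (hp : p ∈ U) (k a b c d : Fin 3) :
    pd k (fun x => curv Γ x a b c d) p = jetDCurv (jet2 Γ p) k a b c d := by
  have h0 : ∀ a b c, DifferentiableAt ℝ (fun x => Γ x a b c) p := fun a b c =>
    (hΓ.smooth a b c).diffAt hU hp
  have h1 : ∀ k a b c, DifferentiableAt ℝ (fun x => pd k (fun y => Γ y a b c) x) p :=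
    fun k a b c => ((hΓ.smooth a b c).pd_of_isOpen hU k).diffAt hU hp
  unfold curv
  rw [pd_add ((h1 a b d c).fun_sub (h1 b a d c)) (by fun_prop), pd_sub (h1 a b d c) (h1 b a d c),
    pd_sum _ fun e _ => by fun_prop]
  simp only [jetDCurv, jet2]
  congr 1
  refine Finset.sum_congr rfl fun e _ => ?_
  rw [pd_sub ((h0 a e c).fun_mul (h0 b d e)) ((h0 b e c).fun_mul (h0 a d e)),
    pd_mul (h0 a e c) (h0 b d e), pd_mul (h0 b e c) (h0 a d e)]

theorem pd_pencilMat (hU : IsOpen U) (hΓ : IsTorsionFreeOn U Γ) (hp : p ∈ U) (T : Mat3)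
    (k b c : Fin 3) : pd k (fun x => pencilMat (weylOf (curv Γ x)) T b c) p =
      pencilMat (weylOf (jetDCurv (jet2 Γ p) k)) T b c := by
  have hc : ∀ a b c d, DifferentiableAt ℝ (fun x => curv Γ x a b c d) p := by
    have h0 : ∀ a b c, DifferentiableAt ℝ (fun x => Γ x a b c) p := fun a b c =>
      (hΓ.smooth a b c).diffAt hU hp
    have h1 : ∀ k a b c, DifferentiableAt ℝ (fun x => pd k (fun y => Γ y a b c) x) p :=
      fun k a b c => ((hΓ.smooth a b c).pd_of_isOpen hU k).diffAt hU hp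
    intro a b c d
    unfold curv
    fun_prop
  have hw : ∀ a b c, DifferentiableAt ℝ (fun x => weylOf (curv Γ x) a b c) p := by
    intro a b c
    unfold weylOf
    fun_prop
  have hwd : ∀ a b c, pd k (fun x => weylOf (curv Γ x) a b c) p =
      weylOf (jetDCurv (jet2 Γ p) k) a b c := by
    intro a b c
    unfold weylOf
    rw [pd_const_mul (by fun_prop), pd_sum _ fun d _ => by fun_prop]
    congr 1
    refine Finset.sum_congr rfl fun d _ => ?_
    rw [pd_sum _ fun e _ => by fun_prop]
    refine Finset.sum_congr rfl fun e _ => ?_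
    rw [pd_add ((hc d e b c).const_mul _) ((hc d e a c).const_mul _), pd_const_mul (hc d e b c),
      pd_const_mul (hc d e a c), pd_curv hU hΓ hp, pd_curv hU hΓ hp]
  simp only [pencilMat, Matrix.of_apply]
  rw [pd_const_mul (by fun_prop), pd_sum _ fun a _ => by fun_prop]
  congr 1
  refine Finset.sum_congr rfl fun a _ => ?_
  rw [pd_sum _ fun d _ => by fun_prop]
  refine Finset.sum_congr rfl fun d _ => ?_
  rw [pd_sum _ fun e _ => by fun_prop]
  refine Finset.sum_congr rfl fun e _ => ?_
  simp only [mul_right_comm _ _ (lcs _ _ _)]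
  rw [pd_add ((hw a b e).const_mul _) ((hw a c e).const_mul _), pd_const_mul (hw a b e),
    pd_const_mul (hw a c e), hwd, hwd]

theorem covD_pencilMat (hU : IsOpen U) (hΓ : IsTorsionFreeOn U Γ) (hp : p ∈ U) (T : Mat3) :
    covD Γ (fun x => pencilMat (weylOf (curv Γ x)) T) p = jetCovD (jet2 Γ p) T := by
  funext a b c
  rw [covD, pd_pencilMat hU hΓ hp]
  rfl

/-- The value of `φ` may be computed from the section of the Weyl pencil given by a constant
matrix: this section is `f ρ + k σ` with `f = 1` and `k = 0` at `p`, and the test functional does not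
see the derivatives of `f` and `k`. Hence `φ(p)` depends only on the 2-jet of the connection, `ρ(p)`
and the choice of `σ(p)` and `ξ(p)`. -/
theorem IsNormalFormOn.phiFn_eq_testOf {W : Set Pt} {ρ σ : Pt → Mat3} {ξ : Pt → Fin 3 → ℝ}
    (h : IsNormalFormOn Γ vol W ρ σ ξ) (hW : IsOpen W) (hΓ : IsTorsionFreeOn W Γ)
    (hvol : IsVolumeOn W vol) (hp : p ∈ W) {T : Mat3} (hT : T.IsSymm)
    (hTp : jetPencil (jet2 Γ p) T = ρ p) :
    phiFn Γ ρ σ ξ p = testOf (σ p) (ξ p) (jetCovD (jet2 Γ p) T) := by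
  obtain ⟨f, k, hf, hk, hfk⟩ := h.exists_components (smoothMat_pencilMat hW hΓ T)
    fun x hx => (weylPencil_eq (hvol.ne_zero x hx)) ▸ ⟨T, hT, rfl⟩
  have h1 : (f p - 1) • ρ p + k p • σ p = 0 := by
    have h2 : ρ p = f p • ρ p + k p • σ p := by
      rw [← hfk p hp, ← hTp]; rfl
    rw [sub_smul, one_smul, sub_add_eq_add_sub, ← h2, sub_self]
  obtain ⟨hf1, hk0⟩ := linearIndependent_pair_iff'.1 (h.linInd p hp) _ _ h1
  have h3 := h.scaleTest_section hW hf hk hfk hp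
  rw [hk0, sub_eq_zero.1 hf1, one_mul, zero_mul, add_zero, scaleTest_eq,
    covD_pencilMat hW hΓ hp] at h3
  exact h3.symm

end

theorem testOf_zero_right (σ : Mat3) (S : Fin 3 → Fin 3 → Fin 3 → ℝ) : testOf σ 0 S = 0 := by
  simp [testOf]

theorem testOf_smul_left {σ : Mat3} (h0 : σ.det ≠ 0) {r : ℝ} (hr : r ≠ 0) (ξ : Fin 3 → ℝ)
    (S : Fin 3 → Fin 3 → Fin 3 → ℝ) : testOf (r • σ) ξ S = r * testOf σ ξ S := by
  have hinv : (r • σ)⁻¹ = r⁻¹ • σ⁻¹ := by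
    refine Matrix.inv_eq_left_inv ?_
    rw [Matrix.smul_mul, Matrix.mul_smul, smul_smul, inv_mul_cancel₀ hr, one_smul,
      Matrix.nonsing_inv_mul _ h0.isUnit]
  have h1 : ∀ d, ∑ e, (r • σ) d e * ξ e = r * ∑ e, σ d e * ξ e := by
    intro d
    rw [Finset.mul_sum]
    exact Finset.sum_congr rfl fun e _ => by rw [Matrix.smul_apply, smul_eq_mul, mul_assoc]
  have h2 : ∑ d, r * (∑ e, σ d e * ξ e) * ξ d = r * ∑ d, (∑ e, σ d e * ξ e) * ξ d := by
    rw [Finset.mul_sum]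
    exact Finset.sum_congr rfl fun e _ => by ring
  simp only [testOf, hinv, h1, h2]
  simp only [Matrix.smul_apply, smul_eq_mul]
  refine Eq.trans (Finset.sum_congr rfl fun a _ => ?_) (Finset.mul_sum _ _ _).symm
  refine Eq.trans (Finset.sum_congr rfl fun b _ => ?_) (Finset.mul_sum _ _ _).symm
  refine Eq.trans (Finset.sum_congr rfl fun c _ => ?_) (Finset.mul_sum _ _ _).symm
  field_simp

theorem testOf_smul_mid (σ : Mat3) (r : ℝ) (ξ : Fin 3 → ℝ) (S : Fin 3 → Fin 3 → Fin 3 → ℝ) :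
    testOf σ (r • ξ) S = r ^ 3 * testOf σ ξ S := by
  have h1 : ∀ d, ∑ e, σ d e * (r • ξ) e = r * ∑ e, σ d e * ξ e := by
    intro d
    rw [Finset.mul_sum]
    exact Finset.sum_congr rfl fun e _ => by rw [Pi.smul_apply, smul_eq_mul]; ring
  have h2 : ∑ d, r * (∑ e, σ d e * ξ e) * (r * ξ d) =
      r ^ 2 * ∑ d, (∑ e, σ d e * ξ e) * ξ d := by
    rw [Finset.mul_sum]
    exact Finset.sum_congr rfl fun e _ => by ring
  simp only [testOf, h1]
  simp only [Pi.smul_apply, smul_eq_mul, h2]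
  refine Eq.trans (Finset.sum_congr rfl fun a _ => ?_) (Finset.mul_sum _ _ _).symm
  refine Eq.trans (Finset.sum_congr rfl fun b _ => ?_) (Finset.mul_sum _ _ _).symm
  refine Eq.trans (Finset.sum_congr rfl fun c _ => ?_) (Finset.mul_sum _ _ _).symm
  ring

/-- A kernel vector of a symmetric matrix of rank two is a multiple of a row of the adjugate, which
is the cross product of two rows of the matrix. -/
theorem exists_eq_smul_adjugate_row {ρ : Mat3} (hs : ρ.IsSymm) {v : Fin 3 → ℝ}
    (hv : ∀ c, ∑ b, ρ b c * v b = 0) {i : Fin 3} (hi : ρ.adjugate i ≠ 0) :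
    ∃ r : ℝ, v = r • ρ.adjugate i := by
  obtain ⟨j, hj⟩ := Function.ne_iff.1 hi
  have hj' : ρ.adjugate i j ≠ 0 := hj
  -- The components of `(u × w) × v = (u ⬝ v) w - (w ⬝ v) u`, for the rows `u` and `w` of `ρ`.
  have key' : ∀ i, ρ.adjugate i 0 * v 1 = ρ.adjugate i 1 * v 0 ∧
      ρ.adjugate i 0 * v 2 = ρ.adjugate i 2 * v 0 ∧
      ρ.adjugate i 1 * v 2 = ρ.adjugate i 2 * v 1 := by
    obtain ⟨a1, a2, a3⟩ := isSymm_entries hs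
    have e0 := hv 0
    have e1 := hv 1
    have e2 := hv 2
    simp only [Fin.sum_univ_three, a1, a2, a3] at e0 e1 e2
    simp only [forall_fin_three, Matrix.adjugate_fin_three, Matrix.of_apply, Matrix.cons_val',
      Matrix.cons_val_zero, Matrix.cons_val_one, Matrix.cons_val, Matrix.cons_val_fin_one, a1, a2,
      a3]
    refine ⟨⟨?_, ?_, ?_⟩, ⟨?_, ?_, ?_⟩, ?_, ?_, ?_⟩
    · linear_combination ρ 2 2 * e1 - ρ 1 2 * e2
    · linear_combination ρ 1 1 * e2 - ρ 1 2 * e1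
    · linear_combination ρ 0 2 * e1 - ρ 0 1 * e2
    · linear_combination ρ 0 2 * e2 - ρ 2 2 * e0
    · linear_combination ρ 1 2 * e0 - ρ 0 1 * e2
    · linear_combination ρ 0 0 * e2 - ρ 0 2 * e0
    · linear_combination ρ 1 2 * e0 - ρ 0 2 * e1
    · linear_combination ρ 0 1 * e1 - ρ 1 1 * e0
    · linear_combination ρ 0 1 * e0 - ρ 0 0 * e1
  have key : ∀ i j k, ρ.adjugate i j * v k = ρ.adjugate i k * v j := by
    intro i
    obtain ⟨h01, h02, h12⟩ := key' i
    simp only [forall_fin_three]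
    exact ⟨⟨trivial, h01, h02⟩, ⟨h01.symm, trivial, h12⟩, h02.symm, h12.symm, trivial⟩
  refine ⟨v j / ρ.adjugate i j, funext fun k => ?_⟩
  rw [Pi.smul_apply, smul_eq_mul, div_mul_eq_mul_div, eq_div_iff hj', mul_comm (v j), ← key,
    mul_comm]

/-- The 2-jets of generic structures: some element `ρ` of the Weyl pencil is degenerate, some `H` is
not, the conditions for regularity hold, and the test functional of the resulting normal form does
not vanish on `∇ρ`. -/
def genericJets : Set Jet2 :=
  {j | ∃ T S : Mat3, T.IsSymm ∧ S.IsSymm ∧ ∃ i : Fin 3, (jetPencil j T).det = 0 ∧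
    (jetPencil j S).det ≠ 0 ∧ ((jetPencil j T).adjugate * jetPencil j S).trace ≠ 0 ∧
    4 * ((jetPencil j T).adjugate * jetPencil j S).trace * (jetPencil j S).det ≠
      ((jetPencil j S).adjugate * jetPencil j T).trace ^ 2 ∧
    testOf (normalPartner (jetPencil j T) (jetPencil j S)) ((jetPencil j T).adjugate i)
      (jetCovD j T) ≠ 0}

theorem isGenericAt_of_mem_genericJets {U : Set Pt} {Γ : Christoffel} {vol : Pt → ℝ}
    (hU : IsOpen U) (hΓ : IsTorsionFreeOn U Γ) (hvol : IsVolumeOn U vol)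
    (hp : PreservesVolumeOn U Γ vol) {p : Pt} (hpU : p ∈ U)
    (hQ : ∀ᶠ x in 𝓝 p, QVanishesAt Γ vol x) (h : jet2 Γ p ∈ genericJets) :
    IsGenericAt Γ vol p := by
  obtain ⟨T, S, hT, hS, i, hN0, hH0, hβ, hdisc, htest⟩ := h
  have hi : (jetPencil (jet2 Γ p) T).adjugate i ≠ 0 := by
    intro h0
    rw [h0, testOf_zero_right] at htest
    exact htest rfl
  obtain ⟨W, ρ, σ, ξ, hW, hpW, hWU, hnf, hρ, hσ, hξ⟩ := exists_isNormalFormOn hU hΓ hvol hp hpU hQ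
    hT hS rfl rfl hH0 hN0 hβ hdisc hi
  have hHm : jetPencil (jet2 Γ p) S ∈ weylPencil Γ vol p := by
    rw [weylPencil_eq (hvol.ne_zero p hpU)]
    exact ⟨S, hS, rfl⟩
  have hρ0 := hnf.rho_ne_zero hpW
  rw [hρ] at hρ0
  have hpen : weylPencil Γ vol p = pencilOf (jetPencil (jet2 Γ p) T) (jetPencil (jet2 Γ p) S) := by
    rw [hnf.pencil_eq p hpW] at hHm ⊢
    exact pencilOf_eq_of_mem ⟨1, 0, by rw [hρ]; simp [jetPencil, jetCurv_jet2]⟩ hHm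
      (linearIndependent_of_det hρ0 hN0 hH0)
  refine ⟨hQ, ⟨_, hHm, hH0⟩, ?_, W, ρ, σ, ξ, hW, hpW, hnf, ?_⟩
  · rw [hpen]
    exact isRegularPencil_of_coefficients hH0 hN0 hβ hdisc
  · rw [hnf.phiFn_eq_testOf hW (hΓ.mono hWU) (hvol.mono hWU) hpW hT hρ.symm, hσ, hξ]
    exact htest

theorem IsGenericAt.mem_genericJets {U : Set Pt} {Γ : Christoffel} {vol : Pt → ℝ}
    (hU : IsOpen U) (hΓ : IsTorsionFreeOn U Γ) (hvol : IsVolumeOn U vol) {p : Pt} (hpU : p ∈ U)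
    (h : IsGenericAt Γ vol p) : jet2 Γ p ∈ genericJets := by
  obtain ⟨-, -, hreg, W, ρ, σ, ξ, hW, hpW, hnf, hφ⟩ := h
  have hs : W ∩ U ⊆ U := inter_subset_right
  have hpWU : p ∈ W ∩ U := ⟨hpW, hpU⟩
  have hpen := weylPencil_eq (Γ := Γ) (hvol.ne_zero p hpU)
  have hρm : ρ p ∈ weylPencil Γ vol p := by rw [hnf.pencil_eq p hpW]; exact ⟨1, 0, by simp⟩
  have hσm : σ p ∈ weylPencil Γ vol p := by rw [hnf.pencil_eq p hpW]; exact ⟨0, 1, by simp⟩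
  rw [hpen] at hρm hσm
  obtain ⟨T, hT, hTρ⟩ := hρm
  obtain ⟨S, hS, hSσ⟩ := hσm
  have hTρ' : jetPencil (jet2 Γ p) T = ρ p := hTρ.symm
  have hSσ' : jetPencil (jet2 Γ p) S = σ p := hSσ.symm
  rw [hnf.pencil_eq p hpW] at hreg
  have hσ0 := hnf.invertible p hpW
  have hρ0 := hnf.det_rho hpW
  obtain ⟨hβ, hdisc⟩ := coefficients_of_isRegularPencil hσ0 hρ0 hreg
  obtain ⟨i, hi⟩ := exists_adjugate_row_ne_zero hβ
  obtain ⟨r, hr⟩ := exists_eq_smul_adjugate_row (hnf.isSymm_rho hpW) (hnf.kernel p hpW) hi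
  have hα : ((σ p).adjugate * ρ p).trace = 0 := by
    have h1 := hnf.trace_zero p hpW
    rw [sum_inv_mul_eq_trace (hnf.isSymm_rho hpW), mul_eq_zero] at h1
    exact h1.resolve_left (inv_ne_zero hσ0)
  have hσn : normalPartner (ρ p) (σ p) = (2 * ((ρ p).adjugate * σ p).trace) • σ p := by
    rw [normalPartner, hα, neg_zero, zero_smul, add_zero]
  rw [(hnf.mono inter_subset_left).phiFn_eq_testOf (hW.inter hU) (hΓ.mono hs) (hvol.mono hs) hpWU
    hT hTρ', hr, testOf_smul_mid] at hφ
  refine ⟨T, S, hT, hS, i, ?_⟩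
  rw [hTρ', hSσ']
  refine ⟨hρ0, hσ0, hβ, hdisc, ?_⟩
  rw [hσn, testOf_smul_left hσ0 (mul_ne_zero two_ne_zero hβ)]
  exact mul_ne_zero (mul_ne_zero two_ne_zero hβ) (right_ne_zero_of_mul hφ)

theorem pencilMat_add_smul (V : Fin 3 → Fin 3 → Fin 3 → ℝ) (T S : Mat3) (t : ℝ) :
    pencilMat V (T + t • S) = pencilMat V T + t • pencilMat V S := by
  ext b c
  simp only [pencilMat, Matrix.of_apply, Matrix.add_apply, Matrix.smul_apply, smul_eq_mul,
    Finset.mul_sum, ← Finset.sum_add_distrib]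
  refine Finset.sum_congr rfl fun a _ => Finset.sum_congr rfl fun d _ =>
    Finset.sum_congr rfl fun e _ => ?_
  ring

theorem jetPencil_add_smul (j : Jet2) (T S : Mat3) (t : ℝ) :
    jetPencil j (T + t • S) = jetPencil j T + t • jetPencil j S := pencilMat_add_smul _ T S t

theorem jetCovD_add_smul (j : Jet2) (T S : Mat3) (t : ℝ) (a b c : Fin 3) :
    jetCovD j (T + t • S) a b c = jetCovD j T a b c + t * jetCovD j S a b c := by
  simp only [jetCovD, jetPencil_add_smul, pencilMat_add_smul, Matrix.add_apply, Matrix.smul_apply,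
    smul_eq_mul, Fin.sum_univ_three]
  ring

theorem contDiff_pencilMat {E : Type*} [NormedAddCommGroup E] [NormedSpace ℝ E]
    {R : E → Fin 3 → Fin 3 → Fin 3 → Fin 3 → ℝ}
    (hR : ∀ a b c d, ContDiff ℝ ∞ (fun x => R x a b c d)) (T : Mat3) (b c : Fin 3) :
    ContDiff ℝ ∞ (fun x => pencilMat (weylOf (R x)) T b c) := by
  have hw : ∀ a b c, ContDiff ℝ ∞ (fun x => weylOf (R x) a b c) := by
    intro a b c
    unfold weylOf
    fun_prop
  simp only [pencilMat, Matrix.of_apply]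
  fun_prop

theorem contDiff_jetPencil (T : Mat3) (b c : Fin 3) :
    ContDiff ℝ ∞ (fun j => jetPencil j T b c) := by
  refine contDiff_pencilMat (fun a b c d => ?_) T b c
  unfold jetCurv
  fun_prop

theorem contDiff_jetCovD (T : Mat3) (a b c : Fin 3) :
    ContDiff ℝ ∞ (fun j => jetCovD j T a b c) := by
  have h1 : ∀ b c, ContDiff ℝ ∞ (fun j : Jet2 => pencilMat (weylOf (jetDCurv j a)) T b c) := by
    refine contDiff_pencilMat (fun b c d e => ?_) T
    unfold jetDCurv
    fun_prop
  have h2 := contDiff_jetPencil T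
  unfold jetCovD
  fun_prop

/-- A degenerate element of the pencil corresponding to a simple root of the cubic persists under
small changes of the jet. -/
theorem isOpen_genericJets : IsOpen genericJets := by
  rw [isOpen_iff_mem_nhds]
  rintro j ⟨T, S, hT, hS, i, hN0, hH0, hβ, hdisc, htest⟩
  have hKs : SmoothMat univ (fun j => jetPencil j T) := fun b c =>
    (contDiff_jetPencil T b c).contDiffOn
  have hMs : SmoothMat univ (fun j => jetPencil j S) := fun b c =>
    (contDiff_jetPencil S b c).contDiffOn
  obtain ⟨W, t, hW, hjW, hts, htj, hroot⟩ :=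
    exists_contDiffOn_degenerate isOpen_univ hKs hMs (mem_univ j) hN0 hβ
  let ρ : Jet2 → Mat3 := fun j => jetPencil j (T + t j • S)
  have hρs : SmoothMat W ρ := by
    simp only [ρ, jetPencil_add_smul]
    exact (hKs.mono (subset_univ W)).add ((hMs.mono (subset_univ W)).smul hts)
  have hMs' : SmoothMat W (fun j => jetPencil j S) := hMs.mono (subset_univ W)
  have hρj : ρ j = jetPencil j T := by simp [ρ, htj]
  have hβs := hρs.adjugate.trace_mul hMs'
  have hαs := hMs'.adjugate.trace_mul hρs
  have hσs : SmoothMat W (fun j => normalPartner (ρ j) (jetPencil j S)) :=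
    (hMs'.smul (contDiffOn_const.mul hβs)).add (hρs.smul hαs.neg)
  have hSs : ∀ a b c, ContDiffOn ℝ ∞ (fun j => jetCovD j (T + t j • S) a b c) W := by
    intro a b c
    simp only [jetCovD_add_smul]
    exact (contDiff_jetCovD T a b c).contDiffOn.add
      (hts.mul (contDiff_jetCovD S a b c).contDiffOn)
  have hcont : ∀ {f : Jet2 → ℝ}, ContinuousOn f W → f j ≠ 0 → ∀ᶠ x in 𝓝 j, f x ≠ 0 :=
    fun hf h0 => (hf.continuousAt (hW.mem_nhds hjW)).eventually_ne h0
  have hdiscs := ((contDiffOn_const (c := (4 : ℝ))).mul hβs).mul hMs'.det |>.sub (hαs.pow 2)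
  have hσj : (normalPartner (ρ j) (jetPencil j S)).det ≠ 0 := by
    rw [hρj, det_normalPartner hN0]
    exact mul_ne_zero (mul_ne_zero two_ne_zero (pow_ne_zero 2 hβ)) (sub_ne_zero.2 hdisc)
  obtain ⟨W₁, hW₁, hW₁o, hjW₁⟩ := eventually_nhds_iff.1
    ((show ∀ᶠ x in 𝓝 j, x ∈ W from hW.mem_nhds hjW).and (hcont hσs.det.continuousOn hσj))
  have hs : W₁ ⊆ W := fun x hx => (hW₁ x hx).1
  have htests : ContinuousOn (fun j => testOf (normalPartner (ρ j) (jetPencil j S))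
      ((ρ j).adjugate i) (jetCovD j (T + t j • S))) W₁ :=
    (contDiffOn_testOf (hσs.mono hs) (fun x hx => (hW₁ x hx).2)
      (fun a => (hρs.adjugate i a).mono hs) fun a b c => (hSs a b c).mono hs).continuousOn
  have htest' := (htests.continuousAt (hW₁o.mem_nhds hjW₁)).eventually_ne (y := 0) (by
    simp only [hρj, htj, zero_smul, add_zero]; exact htest)
  filter_upwards [hW.mem_nhds hjW, hcont hMs'.det.continuousOn hH0,
    hcont hβs.continuousOn (by simp only [hρj]; exact hβ),
    hcont hdiscs.continuousOn (by simp only [hρj]; exact sub_ne_zero.2 hdisc), htest']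
    with x hx h1 h2 h3 h4
  refine ⟨T + t x • S, S, hT.add (hS.smul _), hS, i, ?_, h1, h2, sub_ne_zero.1 h3, h4⟩
  rw [jetPencil_add_smul]
  exact hroot x hx

/-! ### The explicit connection -/

theorem pd_pow {f : Pt → ℝ} {x : Pt} (hf : DifferentiableAt ℝ f x) (n : ℕ) (a : Fin 3) :
    pd a (fun y => f y ^ n) x = n * f x ^ (n - 1) * pd a f x :=
  pd_comp (hasDerivAt_pow n (f x)) hf a

theorem isOpen_exDomain : IsOpen exDomain := by
  refine (isOpen_ne_fun (continuous_apply 0) continuous_const).inter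
    ((isOpen_ne_fun (continuous_apply 2) continuous_const).inter
      (isOpen_ne_fun ?_ continuous_const))
  fun_prop

theorem exDomain_nonempty : exDomain.Nonempty := ⟨![1, 0, 1], by simp [exDomain]⟩

theorem isTorsionFreeOn_exConn : IsTorsionFreeOn exDomain exConn where
  smooth := by
    have h1 : ∀ p ∈ exDomain, p 0 * p 1 + p 2 ≠ 0 := fun p hp => hp.2.2
    have h2 : ∀ p ∈ exDomain, p 2 ≠ 0 := fun p hp => hp.2.1
    have h3 : ∀ p : Pt, 1 + p 0 ^ 2 ≠ 0 := fun p => by positivity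
    have hw : ContDiffOn ℝ ∞ (fun p : Pt => p 0 * p 1 + p 2) exDomain := by fun_prop
    have hA : ContDiffOn ℝ ∞ (fun p : Pt => (p 1 + 4 * p 0 * p 2 + 5 * p 0 ^ 2 * p 1) /
        ((p 0 * p 1 + p 2) * (1 + p 0 ^ 2))) exDomain :=
      ContDiffOn.div (by fun_prop) (by fun_prop) fun p hp => mul_ne_zero (h1 p hp) (h3 p)
    have hB : ContDiffOn ℝ ∞ (fun p : Pt => p 0 / (p 0 * p 1 + p 2)) exDomain :=
      ContDiffOn.div (by fun_prop) (by fun_prop) h1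
    have hC : ContDiffOn ℝ ∞ (fun p : Pt => (p 0 * p 1 + 2 * p 2) /
        ((p 0 * p 1 + p 2) * p 2)) exDomain :=
      ContDiffOn.div (by fun_prop) (by fun_prop) fun p hp => mul_ne_zero (h1 p hp) (h2 p hp)
    have hF : ContDiffOn ℝ ∞ (fun p : Pt => 2 * p 0 / (1 + p 0 ^ 2)) exDomain :=
      ContDiffOn.div (by fun_prop) (by fun_prop) fun p _ => h3 p
    have hD : ContDiffOn ℝ ∞ (fun p : Pt => -(p 0 * p 1 + p 2) * p 0 * p 2 ^ 2) exDomain := by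
      fun_prop
    have hE : ContDiffOn ℝ ∞ (fun p : Pt => -(p 0 * p 1 + p 2) * (p 0 * p 1 + 2 * p 2) * p 2)
        exDomain := by fun_prop
    have h0 : ContDiffOn ℝ ∞ (fun _ : Pt => (0 : ℝ)) exDomain := contDiffOn_const
    simp only [forall_fin_three]
    exact ⟨⟨⟨hA, hD, hE⟩, ⟨hB, hF, h0⟩, hC, h0, hF⟩, ⟨⟨hB, hF, h0⟩, ⟨h0, h0, h0⟩, h0, h0, h0⟩,
      ⟨hC, h0, hF⟩, ⟨h0, h0, h0⟩, h0, h0, h0⟩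
  symm p _ a b c := by fin_cases a <;> fin_cases b <;> fin_cases c <;> rfl

theorem isVolumeOn_exVol : IsVolumeOn exDomain exVol where
  smooth := by unfold exVol; fun_prop
  ne_zero p hp := mul_ne_zero (mul_ne_zero (by positivity) hp.2.2) hp.2.1

theorem pd_exVol (p : Pt) : pd 0 exVol p = 8 * p 0 * (1 + p 0 ^ 2) ^ 3 *
      (p 0 * p 1 + p 2) * p 2 + (1 + p 0 ^ 2) ^ 4 * p 1 * p 2 ∧
    pd 1 exVol p = (1 + p 0 ^ 2) ^ 4 * p 0 * p 2 ∧
    pd 2 exVol p = (1 + p 0 ^ 2) ^ 4 * (p 0 * p 1 + 2 * p 2) := by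
  unfold exVol
  simp (disch := fun_prop) only [pd_mul, pd_add, pd_pow, pd_coord, pd_const, kron_values]
  refine ⟨?_, ?_, ?_⟩ <;> push_cast <;> ring

theorem preservesVolumeOn_exConn : PreservesVolumeOn exDomain exConn exVol := by
  intro p hp
  obtain ⟨hx, hz, hw⟩ := hp
  have hx2 : 1 + p 0 ^ 2 ≠ 0 := by positivity
  obtain ⟨h0, h1, h2⟩ := pd_exVol p
  simp only [forall_fin_three, Fin.sum_univ_three, h0, h1, h2]
  simp [exConn, exMatrices, exVol]
  refine ⟨?_, ?_, ?_⟩ <;> field_simp <;> ring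

/-- The solution `(1 + x²)⁻² diag (q⁻², 1, 1)`, with `q = (xy + z) z`, of the metrisability equation
of the explicit connection. -/
noncomputable def exSolution (p : Pt) : Mat3 :=
  Matrix.diagonal ![((1 + p 0 ^ 2) ^ 2 * ((p 0 * p 1 + p 2) * p 2) ^ 2)⁻¹,
    ((1 + p 0 ^ 2) ^ 2)⁻¹, ((1 + p 0 ^ 2) ^ 2)⁻¹]

theorem solvesMetrisability_exSolution : SolvesMetrisability exDomain exConn exSolution := by
  have hP : ∀ p ∈ exDomain, (1 + p 0 ^ 2) ^ 2 * ((p 0 * p 1 + p 2) * p 2) ^ 2 ≠ 0 := fun p hp =>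
    mul_ne_zero (by positivity) (pow_ne_zero 2 (mul_ne_zero hp.2.2 hp.2.1))
  have hR : ∀ p : Pt, (1 + p 0 ^ 2) ^ 2 ≠ 0 := fun p => by positivity
  have h0 : ContDiffOn ℝ ∞ (fun _ : Pt => (0 : ℝ)) exDomain := contDiffOn_const
  have hs1 : ContDiffOn ℝ ∞ (fun p : Pt => ((1 + p 0 ^ 2) ^ 2 *
      ((p 0 * p 1 + p 2) * p 2) ^ 2)⁻¹) exDomain := ContDiffOn.inv (by fun_prop) hP
  have hs2 : ContDiffOn ℝ ∞ (fun p : Pt => ((1 + p 0 ^ 2) ^ 2)⁻¹) exDomain :=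
    ContDiffOn.inv (by fun_prop) fun p _ => hR p
  refine ⟨?_, fun p _ => Matrix.isSymm_diagonal _, fun p hp => ?_, fun p hp a b c => ?_⟩
  · unfold SmoothMat
    simp only [forall_fin_three, exSolution]
    exact ⟨⟨hs1, h0, h0⟩, ⟨h0, hs2, h0⟩, h0, h0, hs2⟩
  · simp only [exSolution, Matrix.det_diagonal, Fin.prod_univ_three]
    exact mul_ne_zero (mul_ne_zero (inv_ne_zero (hP p hp)) (inv_ne_zero (hR p)))
      (inv_ne_zero (hR p))
  · have hd1 : DifferentiableAt ℝ (fun p : Pt => (1 + p 0 ^ 2) ^ 2 *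
        ((p 0 * p 1 + p 2) * p 2) ^ 2) p := by fun_prop
    have hd2 : DifferentiableAt ℝ (fun p : Pt => (1 + p 0 ^ 2) ^ 2) p := by fun_prop
    have e0 : ∀ i j, i ≠ j → (∀ a, pd a (fun y => exSolution y i j) p = 0) ∧
        exSolution p i j = 0 := fun i j h => by
      simp [exSolution, Matrix.diagonal_apply_ne _ h]
    have e1 : ∀ a, pd a (fun y => exSolution y 0 0) p = _ := fun a =>
      pd_comp (hasDerivAt_inv (hP p hp)) hd1 a
    have e2 : ∀ a, pd a (fun y => exSolution y 1 1) p = _ := fun a =>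
      pd_comp (hasDerivAt_inv (hR p)) hd2 a
    have e3 : ∀ a, pd a (fun y => exSolution y 2 2) p = _ := fun a =>
      pd_comp (hasDerivAt_inv (hR p)) hd2 a
    simp (disch := fun_prop) only [pd_mul, pd_add, pd_pow, pd_coord, pd_const] at e1 e2 e3
    have hcov : covD exConn exSolution p = fun a b c =>
        kron a b * (if c = 0 then 2 * p 0 / (1 + p 0 ^ 2) * exSolution p 0 0 else 0) +
        kron a c * (if b = 0 then 2 * p 0 / (1 + p 0 ^ 2) * exSolution p 0 0 else 0) := by
      obtain ⟨hx, hz, hw⟩ := hp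
      have hx2 : 1 + p 0 ^ 2 ≠ 0 := by positivity
      have v0 : exSolution p 0 0 = ((1 + p 0 ^ 2) ^ 2 * ((p 0 * p 1 + p 2) * p 2) ^ 2)⁻¹ := rfl
      have v1 : exSolution p 1 1 = ((1 + p 0 ^ 2) ^ 2)⁻¹ := rfl
      have v2 : exSolution p 2 2 = ((1 + p 0 ^ 2) ^ 2)⁻¹ := rfl
      have o01 := e0 0 1 (by decide)
      have o02 := e0 0 2 (by decide)
      have o10 := e0 1 0 (by decide)
      have o12 := e0 1 2 (by decide)
      have o20 := e0 2 0 (by decide)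
      have o21 := e0 2 1 (by decide)
      suffices h : ∀ a b c, covD exConn exSolution p a b c =
          kron a b * (if c = 0 then 2 * p 0 / (1 + p 0 ^ 2) * exSolution p 0 0 else 0) +
          kron a c * (if b = 0 then 2 * p 0 / (1 + p 0 ^ 2) * exSolution p 0 0 else 0) by
        funext a b c; exact h a b c
      simp only [forall_fin_three, covD, Fin.sum_univ_three, e1, e2, e3, o01, o02, o10, o12, o20,
        o21, kron_values, v0, v1, v2]
      simp [exConn, exMatrices]
      refine ⟨⟨⟨?_, ?_, ?_⟩, ⟨?_, ?_⟩, ?_, ?_⟩, ?_, ?_⟩ <;> field_simp <;> ring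
    rw [hcov]
    exact tracefree_kron _ a b c

/-- The function `q = (xy + z) z`. -/
def exQ (p : Pt) : ℝ := (p 0 * p 1 + p 2) * p 2

/-- The degenerate section `ρ` of the Weyl pencil of the explicit connection. -/
noncomputable def exRho (p : Pt) : Mat3 := !![0, 0, 0; 0, -2, p 0; 0, p 0, 0]

/-- The section `σ = q² ρ - x² diag (1, q², q²)` of the Weyl pencil of the explicit connection. -/
noncomputable def exSigma (p : Pt) : Mat3 :=
  !![-p 0 ^ 2, 0, 0; 0, -exQ p ^ 2 * (p 0 ^ 2 + 2), exQ p ^ 2 * p 0;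
    0, exQ p ^ 2 * p 0, -exQ p ^ 2 * p 0 ^ 2]

theorem exQ_ne_zero {p : Pt} (hp : p ∈ exDomain) : exQ p ≠ 0 := mul_ne_zero hp.2.2 hp.2.1

/-- The components of the Weyl tensor that enter into the element of the pencil given by the matrix
with one non-zero entry `T₁₁ = 1`. -/
theorem weylOf_exConn {p : Pt} (hp : p ∈ exDomain) :
    (weylOf (curv exConn p) 0 0 1 = 0 ∧ weylOf (curv exConn p) 0 0 2 = 0) ∧
    (weylOf (curv exConn p) 0 1 1 = p 0 / exQ p ∧ weylOf (curv exConn p) 0 1 2 = 2 / exQ p) ∧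
    weylOf (curv exConn p) 0 2 1 = 0 ∧ weylOf (curv exConn p) 0 2 2 = -p 0 / exQ p := by
  obtain ⟨hx, hz, hw⟩ := hp
  have hw' : p 1 * p 0 + p 2 ≠ 0 := by rwa [mul_comm]
  have hwz : (p 0 * p 1 + p 2) * p 2 ≠ 0 := mul_ne_zero hw hz
  have eB : ∀ a, pd a (fun y => exConn y 0 1 0) p = _ := fun a =>
    pd_div (f := fun y => y 0) (g := fun y => y 0 * y 1 + y 2) (by fun_prop) (by fun_prop) hw a
  have eC : ∀ a, pd a (fun y => exConn y 0 2 0) p = _ :=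
    fun a => pd_div (f := fun y => y 0 * y 1 + 2 * y 2) (g := fun y => (y 0 * y 1 + y 2) * y 2)
      (by fun_prop) (by fun_prop) hwz a
  simp (disch := fun_prop) only [pd_mul, pd_add, pd_coord, pd_const] at eB eC
  have hz' : ∀ i j c, i ≠ 0 → j ≠ 0 → ∀ y, exConn y i j c = 0 := by
    intro i j c hi hj y
    fin_cases i <;> fin_cases j <;> fin_cases c <;> first | rfl | exact absurd rfl hi |
      exact absurd rfl hj
  have vB : exConn p 0 1 0 = p 0 / (p 0 * p 1 + p 2) := rfl
  have vB' : exConn p 1 0 0 = p 0 / (p 0 * p 1 + p 2) := rfl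
  have vC : exConn p 0 2 0 = (p 0 * p 1 + 2 * p 2) / ((p 0 * p 1 + p 2) * p 2) := rfl
  have vC' : exConn p 2 0 0 = (p 0 * p 1 + 2 * p 2) / ((p 0 * p 1 + p 2) * p 2) := rfl
  have hskew : ∀ a b c d, curv exConn p b a c d = -curv exConn p a b c d := by
    intro a b c d
    simp only [curv, Fin.sum_univ_three]; ring
  have h1 : (1 : Fin 3) ≠ 0 := by decide
  have h2 : (2 : Fin 3) ≠ 0 := by decide
  have c12 : ∀ b c, c ≠ 0 → curv exConn p 1 2 b c = 0 := by
    intro b c hc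
    simp only [curv, Fin.sum_univ_three, pd_const, hz' _ _ _ h1 hc,
      hz' _ _ _ h2 hc]
    ring
  have c201 : curv exConn p 2 0 0 1 = p 0 / exQ p := by
    simp only [curv, Fin.sum_univ_three, pd_const, eB, hz' _ _ _ h2 h1, hz' _ _ _ h2 h2,
      vB, vC', kron_values, exQ]
    field_simp
    ring
  have c202 : curv exConn p 2 0 0 2 = 2 / exQ p := by
    simp only [curv, Fin.sum_univ_three, pd_const, eC, hz' _ _ _ h2 h1, hz' _ _ _ h2 h2,
      vC, vC', kron_values, exQ, zero_mul, mul_zero, zero_add, add_zero]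
    field_simp
    ring
  have c011 : curv exConn p 0 1 0 1 = 0 := by
    simp only [curv, Fin.sum_univ_three, pd_const, eB, hz' _ _ _ h1 h1, hz' _ _ _ h1 h2,
      vB, vB', kron_values]
    field_simp
    ring
  have c012 : curv exConn p 0 1 0 2 = -p 0 / exQ p := by
    simp only [curv, Fin.sum_univ_three, pd_const, eC, hz' _ _ _ h1 h1, hz' _ _ _ h1 h2,
      vC, vB', kron_values, exQ, zero_mul, mul_zero]
    field_simp
    ring
  simp only [weylOf, Fin.sum_univ_three, lcs_012, lcs_120, lcs_201, lcs_021, lcs_210, lcs_102,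
    lcs_aab, lcs_aba, lcs_baa, hskew 1 2, hskew 2 0, hskew 0 1, c12 _ _ h1, c12 _ _ h2, c201, c202,
    c011, c012]
  refine ⟨⟨?_, ?_⟩, ⟨?_, ?_⟩, ?_, ?_⟩ <;> ring

theorem pencilMat_exConn {p : Pt} (hp : p ∈ exDomain) :
    pencilMat (weylOf (curv exConn p)) (Matrix.single 0 0 (exQ p)) = exRho p := by
  obtain ⟨⟨h1, h2⟩, ⟨h3, h4⟩, h5, h6⟩ := weylOf_exConn hp
  have hq := exQ_ne_zero hp
  ext b c
  revert b c
  simp only [forall_fin_three, pencilMat, Matrix.of_apply, Fin.sum_univ_three, lcs_012, lcs_120,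
    lcs_201, lcs_021, lcs_210, lcs_102, lcs_aab, lcs_aba, lcs_baa, h1, h2, h3, h4, h5, h6]
  simp [Matrix.single, exRho]
  constructor <;> field_simp <;> ring

theorem det_exSigma (p : Pt) :
    (exSigma p).det = -(p 0 ^ 4 * exQ p ^ 4 * (p 0 ^ 2 + 1)) := by
  simp [Matrix.det_fin_three, exSigma]
  ring

theorem smoothMat_exRho : SmoothMat exDomain exRho := by
  have h0 : ∀ r : ℝ, ContDiffOn ℝ ∞ (fun _ : Pt => r) exDomain := fun _ => contDiffOn_const
  have h1 : ContDiffOn ℝ ∞ (fun p : Pt => p 0) exDomain := by fun_prop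
  unfold SmoothMat
  simp only [forall_fin_three]
  exact ⟨⟨h0 0, h0 0, h0 0⟩, ⟨h0 0, h0 (-2), h1⟩, h0 0, h1, h0 0⟩

theorem smoothMat_exSigma : SmoothMat exDomain exSigma := by
  have h0 : ContDiffOn ℝ ∞ (fun _ : Pt => (0 : ℝ)) exDomain := contDiffOn_const
  have h1 : ContDiffOn ℝ ∞ (fun p : Pt => -p 0 ^ 2) exDomain := by fun_prop
  have h2 : ContDiffOn ℝ ∞ (fun p : Pt => -exQ p ^ 2 * (p 0 ^ 2 + 2)) exDomain := by
    unfold exQ; fun_prop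
  have h3 : ContDiffOn ℝ ∞ (fun p : Pt => exQ p ^ 2 * p 0) exDomain := by unfold exQ; fun_prop
  have h4 : ContDiffOn ℝ ∞ (fun p : Pt => -exQ p ^ 2 * p 0 ^ 2) exDomain := by
    unfold exQ; fun_prop
  unfold SmoothMat
  simp only [forall_fin_three]
  exact ⟨⟨h1, h0, h0⟩, ⟨h0, h2, h3⟩, h0, h3, h4⟩

theorem exSigma_eq {p : Pt} (hp : p ∈ exDomain) : exSigma p = exQ p ^ 2 • exRho p +
    (-(p 0 ^ 2 * exQ p ^ 2 * (1 + p 0 ^ 2) ^ 2)) • exSolution p := by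
  have hq := exQ_ne_zero hp
  have hx : 1 + p 0 ^ 2 ≠ 0 := by positivity
  have hQ : (p 0 * p 1 + p 2) * p 2 = exQ p := rfl
  ext b c
  revert b c
  simp only [forall_fin_three, exSolution, hQ, Matrix.add_apply, Matrix.smul_apply, smul_eq_mul]
  simp [exSigma, exRho]
  refine ⟨?_, ?_, ?_⟩ <;> field_simp
  ring

theorem isSymm_exRho (p : Pt) : (exRho p).IsSymm := by
  apply Matrix.IsSymm.ext
  simp [forall_fin_three, exRho]

theorem det_exSigma_ne_zero {p : Pt} (hp : p ∈ exDomain) : (exSigma p).det ≠ 0 := by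
  rw [det_exSigma]
  have := exQ_ne_zero hp
  have := hp.1
  simp only [ne_eq, neg_eq_zero]
  positivity

theorem linearIndependent_ex {p : Pt} (hp : p ∈ exDomain) :
    LinearIndependent ℝ ![exRho p, exSigma p] := by
  refine linearIndependent_of_det (fun h => ?_) ?_ (det_exSigma_ne_zero hp)
  · have h11 := congrFun (congrFun h 1) 1
    simp [exRho] at h11
  · simp [Matrix.det_fin_three, exRho]

theorem isNormalFormOn_ex :
    IsNormalFormOn exConn exVol exDomain exRho exSigma fun _ => Pi.single 0 1 where
  smooth_rho := smoothMat_exRho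
  smooth_sigma := smoothMat_exSigma
  smooth_xi b := contDiffOn_const
  pencil_eq p hp := by
    have h := solvesMetrisability_exSolution
    have hV : ∃ a b c, weylOf (curv exConn p) a b c ≠ 0 :=
      ⟨0, 1, 2, by rw [(weylOf_exConn hp).2.1.2]; exact div_ne_zero two_ne_zero (exQ_ne_zero hp)⟩
    obtain ⟨Φ, -, -, hP⟩ := pencilSet_eq_of_obstruction (weylOf_symm _)
      (weylOf_trace_eq_zero isOpen_exDomain isTorsionFreeOn_exConn isVolumeOn_exVol
        preservesVolumeOn_exConn hp) (h.symm p hp) (h.nondeg p hp)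
      (h.obstruction_eq_zero isOpen_exDomain isTorsionFreeOn_exConn hp) hV
    have hρ : exRho p ∈ pencilOf Φ (exSolution p) :=
      hP ▸ ⟨Matrix.single 0 0 (exQ p), by simp [Matrix.IsSymm], (pencilMat_exConn hp).symm⟩
    have hσ : exSigma p ∈ pencilOf Φ (exSolution p) := by
      obtain ⟨a, b, hab⟩ := hρ
      rw [exSigma_eq hp, hab]
      exact ⟨exQ p ^ 2 * a, exQ p ^ 2 * b - p 0 ^ 2 * exQ p ^ 2 * (1 + p 0 ^ 2) ^ 2, by module⟩
    rw [weylPencil_eq (isVolumeOn_exVol.ne_zero p hp), hP]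
    exact pencilOf_eq_of_mem hρ hσ (linearIndependent_ex hp)
  linInd p hp := linearIndependent_ex hp
  invertible p hp := det_exSigma_ne_zero hp
  trace_zero p hp := by
    rw [sum_inv_mul_eq_trace (isSymm_exRho p)]
    refine mul_eq_zero_of_right _ ?_
    simp [Matrix.trace, Matrix.adjugate_fin_three, Fin.sum_univ_three, exRho,
      exSigma]
    ring
  kernel p hp c := by
    fin_cases c <;> simp [Fin.sum_univ_three, exRho]
  xi_ne p _ h := one_ne_zero (α := ℝ) (by simpa using congrFun h 0)

theorem inv_exSigma {p : Pt} (hp : p ∈ exDomain) : (exSigma p)⁻¹ =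
    !![-1 / p 0 ^ 2, 0, 0;
      0, -1 / (exQ p ^ 2 * (p 0 ^ 2 + 1)), -1 / (exQ p ^ 2 * p 0 * (p 0 ^ 2 + 1));
      0, -1 / (exQ p ^ 2 * p 0 * (p 0 ^ 2 + 1)),
        -(p 0 ^ 2 + 2) / (exQ p ^ 2 * p 0 ^ 2 * (p 0 ^ 2 + 1))] := by
  have hq := exQ_ne_zero hp
  have hx := hp.1
  have hx2 : p 0 ^ 2 + 1 ≠ 0 := by positivity
  refine Matrix.inv_eq_left_inv ?_
  ext b c
  revert b c
  simp only [forall_fin_three, Matrix.mul_apply, Fin.sum_univ_three]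
  simp [exSigma]
  refine ⟨?_, ⟨?_, ?_⟩, ?_, ?_⟩ <;> field_simp <;> ring

theorem phiFn_ex {p : Pt} (hp : p ∈ exDomain) :
    phiFn exConn exRho exSigma (fun _ => Pi.single 0 1) p =
      -2 * p 0 ^ 3 / (exQ p ^ 2 * (p 0 ^ 2 + 1)) := by
  have hq := exQ_ne_zero hp
  have hx := hp.1
  have hx2 : p 0 ^ 2 + 1 ≠ 0 := by positivity
  -- The only entries of `ρ` with non-zero derivative are `ρ²³ = ρ³² = x`.
  have h00 : ∀ a, covD exConn exRho p a 0 0 = 0 := by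
    intro a
    simp [covD, Fin.sum_univ_three, exRho]
  have h11 : covD exConn exRho p 0 1 1 = -4 * (2 * p 0 / (1 + p 0 ^ 2)) := by
    simp [covD, Fin.sum_univ_three, exRho, exConn, exMatrices]
    ring
  have h12 : covD exConn exRho p 0 1 2 = 1 + 2 * p 0 * (2 * p 0 / (1 + p 0 ^ 2)) := by
    simp [covD, Fin.sum_univ_three, exRho, exConn, exMatrices, pd_coord, kron]
    ring
  have h21 : covD exConn exRho p 0 2 1 = 1 + 2 * p 0 * (2 * p 0 / (1 + p 0 ^ 2)) := by
    simp [covD, Fin.sum_univ_three, exRho, exConn, exMatrices, pd_coord, kron]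
    ring
  have h22 : covD exConn exRho p 0 2 2 = 0 := by
    simp [covD, Fin.sum_univ_three, exRho, exConn, exMatrices]
  have h101 : covD exConn exRho p 1 0 1 = 0 := by
    simp [covD, Fin.sum_univ_three, exRho, exConn, exMatrices]
  have h202 : covD exConn exRho p 2 0 2 = 0 := by
    simp [covD, Fin.sum_univ_three, exRho, exConn, exMatrices]
  rw [phiFn, scaleTest_eq, testOf_eq (isNormalFormOn_ex.isSymm_sigma hp) (det_exSigma_ne_zero hp),
    inv_exSigma hp]
  simp [Fin.sum_univ_three, Matrix.mulVec, dotProduct, exSigma, h00, h11, h12, h21, h22,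
    h101, h202]
  field_simp
  ring

theorem metrisableOn_exConn : MetrisableOn exDomain exConn :=
  solvesMetrisability_exSolution.metrisableOn isOpen_exDomain isTorsionFreeOn_exConn
    isVolumeOn_exVol preservesVolumeOn_exConn

theorem isGenericAt_exConn {p : Pt} (hp : p ∈ exDomain) : IsGenericAt exConn exVol p := by
  have hq := exQ_ne_zero hp
  have hx := hp.1
  have hP := isNormalFormOn_ex.pencil_eq p hp
  have hdet := det_exSigma_ne_zero hp
  have hρ : (exRho p).det = 0 := isNormalFormOn_ex.det_rho hp
  have hβ : ((exRho p).adjugate * exSigma p).trace = p 0 ^ 4 := by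
    simp [Matrix.trace, Matrix.adjugate_fin_three, Fin.sum_univ_three, exRho, exSigma]
    ring
  have hα : ((exSigma p).adjugate * exRho p).trace = 0 := by
    simp [Matrix.trace, Matrix.adjugate_fin_three, Fin.sum_univ_three, exRho, exSigma]
    ring
  refine ⟨?_, ⟨exSigma p, hP ▸ ⟨0, 1, by simp⟩, hdet⟩, ?_, exDomain, exRho, exSigma, _,
    isOpen_exDomain, hp, isNormalFormOn_ex, ?_⟩
  · filter_upwards [isOpen_exDomain.mem_nhds hp] with x hx
    exact solvesMetrisability_exSolution.qVanishesAt isOpen_exDomain isTorsionFreeOn_exConn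
      isVolumeOn_exVol preservesVolumeOn_exConn hx
  · rw [hP]
    refine isRegularPencil_of_coefficients hdet hρ ?_ ?_
    · rw [hβ]; exact pow_ne_zero 4 hx
    · rw [hα, hβ, zero_pow two_ne_zero]
      exact mul_ne_zero (mul_ne_zero four_ne_zero (pow_ne_zero 4 hx)) hdet
  · rw [phiFn_ex hp]
    exact div_ne_zero (mul_ne_zero (by norm_num) (pow_ne_zero 3 hx))
      (mul_ne_zero (pow_ne_zero 2 hq) (by positivity))

/-- The metrisability problem is solved for generic three-dimensional projective structures. -/
theorem mainTheorem1 :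
    -- every projective structure has a representative preserving a given volume form
    (∀ (U : Set Pt) (Γ : Christoffel) (vol : Pt → ℝ), IsOpen U → IsTorsionFreeOn U Γ →
      IsVolumeOn U vol →
      ∃ Γ' : Christoffel, IsTorsionFreeOn U Γ' ∧ ProjEquivOn U Γ Γ' ∧
        PreservesVolumeOn U Γ' vol) ∧
    -- the algorithm for such a representative
    (∀ (U : Set Pt) (Γ : Christoffel) (vol : Pt → ℝ), IsOpen U → IsTorsionFreeOn U Γ →
      IsVolumeOn U vol → PreservesVolumeOn U Γ vol →
      -- first test: if `Q` does not vanish, the structure is not metrisable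
      (∀ p ∈ U, MetrisableNear Γ p → ∀ᶠ x in 𝓝 p, QVanishesAt Γ vol x) ∧
      -- second test: if `V` is non-zero and the pencil is degenerate, it is not metrisable
      (∀ p ∈ U, (∃ a b c, weylV Γ vol p a b c ≠ 0) → MetrisableNear Γ p →
        IsNonsingularPencil (weylPencil Γ vol p)) ∧
      -- otherwise, if the pencil is regular, it has a smooth normal form near `p`, for each of
      -- the (at least one) choices of a degenerate element at `p`
      (∀ p ∈ U, (∀ᶠ x in 𝓝 p, QVanishesAt Γ vol x) →
        IsNonsingularPencil (weylPencil Γ vol p) → IsRegularPencil (weylPencil Γ vol p) →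
        (∃ N ∈ weylPencil Γ vol p, N ≠ 0 ∧ N.det = 0) ∧
        ∀ N ∈ weylPencil Γ vol p, N ≠ 0 → N.det = 0 →
          ∃ (W : Set Pt) (ρ σ : Pt → Mat3) (ξ : Pt → Fin 3 → ℝ),
            IsOpen W ∧ p ∈ W ∧ W ⊆ U ∧ IsNormalFormOn Γ vol W ρ σ ξ ∧ ρ p = N) ∧
      -- for a normal form, the algorithm decides metrisability near a point, and on open sets
      (∀ (W : Set Pt) (ρ σ : Pt → Mat3) (ξ : Pt → Fin 3 → ℝ),
        IsOpen W → W ⊆ U → IsNormalFormOn Γ vol W ρ σ ξ →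
        (∀ p ∈ W, phiFn Γ ρ σ ξ p ≠ 0 ∨ psiFn Γ ρ σ ξ p ≠ 0 →
          (MetrisableNear Γ p ↔ AlgorithmAcceptsAt Γ ρ σ ξ p)) ∧
        ((∀ p ∈ W, phiFn Γ ρ σ ξ p ≠ 0 ∨ psiFn Γ ρ σ ξ p ≠ 0) →
          (MetrisableOn W Γ ↔ AlgorithmAcceptsOn Γ ρ σ ξ W)))) ∧
    -- among the structures with `Q = 0`, genericity is an open condition on the 2-jet
    (∃ O : Set Jet2, IsOpen O ∧
      ∀ (U : Set Pt) (Γ : Christoffel) (vol : Pt → ℝ), IsOpen U → IsTorsionFreeOn U Γ →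
        IsVolumeOn U vol → PreservesVolumeOn U Γ vol →
        ∀ p ∈ U, (∀ᶠ x in 𝓝 p, QVanishesAt Γ vol x) →
          (IsGenericAt Γ vol p ↔ jet2 Γ p ∈ O)) ∧
    -- the condition is non-empty: the explicit connection is generic everywhere, and metrisable
    (IsOpen exDomain ∧ exDomain.Nonempty ∧ IsTorsionFreeOn exDomain exConn ∧
      IsVolumeOn exDomain exVol ∧ PreservesVolumeOn exDomain exConn exVol ∧
      (∀ p ∈ exDomain, IsGenericAt exConn exVol p) ∧ MetrisableOn exDomain exConn) := by
  refine ⟨fun U Γ vol hU hΓ hvol => exists_projEquivOn_preservesVolumeOn hU hΓ hvol,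
    fun U Γ vol hU hΓ hvol hp => ⟨?_, ?_, ?_, ?_⟩, ?_, isOpen_exDomain, exDomain_nonempty,
    isTorsionFreeOn_exConn, isVolumeOn_exVol, preservesVolumeOn_exConn,
    fun p hp => isGenericAt_exConn hp, metrisableOn_exConn⟩
  · exact fun p hpU h => h.eventually_qVanishesAt hU hΓ hvol hp hpU
  · exact fun p hpU hV h => h.isNonsingularPencil hU hΓ hvol hp hpU hV
  · exact fun p hpU hQ _ hreg => ⟨hreg.exists_degenerate, fun N hN hN0 hdet =>
      exists_isNormalFormOn_of_isRegularPencil hU hΓ hvol hp hpU hQ hreg hN hN0 hdet⟩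
  · exact fun W ρ σ ξ hW hWU h =>
      ⟨fun p hpW hne => h.metrisableNear_iff hΓ hvol hp hW hWU hpW hne,
        fun hne => h.metrisableOn_iff hΓ hvol hp hW hWU hne⟩
  · exact ⟨genericJets, isOpen_genericJets, fun U Γ vol hU hΓ hvol hp p hpU hQ =>
      ⟨fun h => h.mem_genericJets hU hΓ hvol hpU,
        fun h => isGenericAt_of_mem_genericJets hU hΓ hvol hp hpU hQ h⟩⟩
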